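/- Let $G$ be a finite group, $H\le G$ a subgroup, and $W=W_GH=N_GH/H$ its Weyl group. Let $\mathrm{Ch}(\mathbb{Q})$ and $\mathrm{Ch}(\mathbb{Q}W)$ be the categories of ($\mathbb{Z}$-graded, unbounded) chain complexes of rational vector spaces and of left $\mathbb{Q}W$-modules. Give $\mathrm{Ch}(\mathbb{Q}W)$ the tensor product $\otimes_{\mathbb{Q}}$ with diagonal $W$-action, the symmetry $x\otimes y\mapsto(-1)^{|x||y|}y\otimes x$, and the $\mathrm{Ch}(\mathbb{Q})$-enrichment $\hom_{\mathbb{Q}}(X,Y)^W$, where $\hom_{\mathbb{Q}}(X,Y)_n=\prod_k\hom_{\mathbb{Q}}(X_k,Y_{k+n})$, $W$ acts by conjugation and $d(f)=d\circ f-(-1)^{|f|}f\circ d$. Let $\mathcal{G}=\mathcal{G}_a^H$ be the family of objects $\mathbb{Q}(W^n)$, $n=0,1,2,\dots$ (in degree $0$, with diagonal $W$-action), and let $\mathcal{E}=\mathcal{E}_a^H$ be the full $\mathrm{Ch}(\mathbb{Q})$-subcategory of $\mathrm{Ch}(\mathbb{Q}W)$ on $\mathcal{G}$, with $\mathcal{E}(a,b)=\hom_{\mathbb{Q}}(a,b)^W$.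 It is symmetric monoidal via $\mathbb{Q}(W^m)\otimes\mathbb{Q}(W^n)\cong\mathbb{Q}(W^{m+n})$, with unit $\mathbb{Q}=\mathbb{Q}(W^0)$. Let $\mathrm{mod}\text{-}\mathcal{E}$ be the category of right $\mathcal{E}$-modules, that is, contravariant $\mathrm{Ch}(\mathbb{Q})$-enriched functors $\mathcal{E}\to\mathrm{Ch}(\mathbb{Q})$ and enriched natural transformations. Let $\underline{\mathrm{Hom}}(\mathcal{G},-)\colon\mathrm{Ch}(\mathbb{Q}W)\to\mathrm{mod}\text{-}\mathcal{E}$ be the functor $X\mapsto\hom_{\mathbb{Q}}(-,X)^W$. Then the following hold. 1. $\mathrm{Ch}(\mathbb{Q}W)$ has a model structure in which the weak equivalences are the homology isomorphisms and the fibrations are the degreewise surjections. $\mathrm{mod}\text{-}\mathcal{E}$ has a model structure in which a map $f\colon M\to N$ is a weak equivalence (fibration) if and only if each $f(a)\colon M(a)\to N(a)$ is a homology isomorphism (degreewise surjection). 2. $\mathrm{mod}\text{-}\mathcal{E}$ has a symmetric monoidal structure given by the box product $$(M\,\square\,N)(a)=\int^{b,c}M(b)\otimes_{\mathbb{Q}}N(c)\otimes_{\mathbb{Q}}\mathcal{E}(a,b\otimes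 c),$$ with unit $\mathcal{E}(-,\mathbb{Q})$ and with associativity, unit and symmetry isomorphisms induced by those of $\mathcal{E}$ and of $\mathrm{Ch}(\mathbb{Q})$. 3. With these structures, $\mathrm{Ch}(\mathbb{Q}W)$ and $\mathrm{mod}\text{-}\mathcal{E}$ are both symmetric monoidal model categories: they are complete, cocomplete, cofibrantly generated and closed symmetric monoidal; the pushout product of two cofibrations is a cofibration, which is a weak equivalence if one of the two is; and if $X$ is cofibrant and $q\colon\widehat{c}I\to I$ is a cofibrant replacement of the unit, then $X\otimes q$ is a weak equivalence. Both satisfy the monoid axiom: every transfinite composition of pushouts of maps $\mathrm{id}_Z\otimes f$, with $Z$ any object and $f$ any acyclic cofibration, is a weak equivalence. 4. $\underline{\mathrm{Hom}}(\mathcal{G},-)$ has a left adjoint $$M\mapsto M\otimes_{\mathcal{E}}\mathcal{G}=\int^{a}M(a)\otimes a,$$ where the adjunction sends $u\colon M\otimes_{\mathcal{E}}\mathcal{G}\to X$ to $m\mapsto(x\mapsto u(m\otimes x))$. 5. The adjoint pair $\bigl((-)\otimes_{\mathcal{E}}\mathcal{G},\ \underline{\mathrm{Hom}}(\mathcal{G},-)\bigr)$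 is a strong symmetric monoidal Quillen equivalence. That is: the left adjoint preserves cofibrations and acyclic cofibrations; for $M$ cofibrant and $X$ fibrant, a map $M\otimes_{\mathcal{E}}\mathcal{G}\to X$ is a weak equivalence if and only if its adjunct $M\to\underline{\mathrm{Hom}}(\mathcal{G},X)$ is; the left adjoint is a strong symmetric monoidal functor; and for each cofibrant replacement $\widehat{c}I\to I$ of the unit of $\mathrm{mod}\text{-}\mathcal{E}$ the composite $\widehat{c}I\otimes_{\mathcal{E}}\mathcal{G}\to I\otimes_{\mathcal{E}}\mathcal{G}\cong\mathbb{Q}$ is a weak equivalence. -/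

import Mathlib

open CategoryTheory Limits MonoidalCategory

set_option linter.unusedSectionVars false

noncomputable section

namespace RatG

/-! ### The symmetry of the tensor product of complexes -/

/-- The sign `(-1)^(i * j)`. -/
abbrev bSign (i j : ℤ) : ℤˣ := Int.negOnePow (i * j)

section
open GradedObject GradedObject.Monoidal

variable {C : Type*} [Category* C] [MonoidalCategory C] [SymmetricCategory C] [Preadditive C]
  [MonoidalPreadditive C]
  [∀ (X₁ X₂ : GradedObject ℤ C), HasTensor X₁ X₂]
  [∀ (X₁ X₂ X₃ : GradedObject ℤ C), HasGoodTensor₁₂Tensor X₁ X₂ X₃]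
  [∀ (X₁ X₂ X₃ : GradedObject ℤ C), HasGoodTensorTensor₂₃ X₁ X₂ X₃]

/-- The symmetry `x ⊗ y ↦ (-1)^(i * j) y ⊗ x` for `x` of degree `i` and `y` of degree `j`. -/
def gBraid (X Y : GradedObject ℤ C) :
    GradedObject.Monoidal.tensorObj X Y ⟶ GradedObject.Monoidal.tensorObj Y X :=
  fun k => GradedObject.Monoidal.tensorObjDesc (fun i j hij => bSign i j • ((β_ (X i) (Y j)).hom ≫
    GradedObject.Monoidal.ιTensorObj Y X j i k (by lia)))

variable (X Y Z : GradedObject ℤ C)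

lemma ι_gBraid (i j k : ℤ) (h : i + j = k) :
    GradedObject.Monoidal.ιTensorObj X Y i j k h ≫ gBraid X Y k =
    bSign i j • ((β_ (X i) (Y j)).hom ≫
    GradedObject.Monoidal.ιTensorObj Y X j i k (by lia)) := by
  simp [gBraid]

lemma ι_gBraid_assoc (i j k : ℤ) (h : i + j = k) {T : C}
    (u : GradedObject.Monoidal.tensorObj Y X k ⟶ T) :
    GradedObject.Monoidal.ιTensorObj X Y i j k h ≫ gBraid X Y k ≫ u =
    (bSign i j • ((β_ (X i) (Y j)).hom ≫
    GradedObject.Monoidal.ιTensorObj Y X j i k (by lia))) ≫ u := by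
  rw [← ι_gBraid X Y i j k h, Category.assoc]

lemma units_smul_whiskerRight (s : ℤˣ) {A B : C} (f : A ⟶ B) (D : C) :
    (s • f) ▷ D = s • (f ▷ D) := by
  rcases Int.units_eq_one_or s with rfl | rfl
  · simp
  · simp only [Units.neg_smul, one_smul]
    exact (tensoringRight C).obj D |>.map_neg (f := f)

lemma whiskerLeft_units_smul (s : ℤˣ) {A B : C} (f : A ⟶ B) (D : C) :
    D ◁ (s • f) = s • (D ◁ f) := by
  rcases Int.units_eq_one_or s with rfl | rfl
  · simp
  · simp only [Units.neg_smul, one_smul]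
    exact (tensoringLeft C).obj D |>.map_neg (f := f)

lemma ι_whiskerRight_g (i j k l : ℤ) (h : i + j + k = l) :
    ιTensorObj₃' X Y Z i j k l h ≫ tensorHom (gBraid X Y) (𝟙 Z) l =
      bSign i j • ((β_ (X i) (Y j)).hom ▷ Z k ≫ ιTensorObj₃' Y X Z j i k l (by lia)) := by
  rw [ιTensorObj₃'_eq X Y Z i j k l h _ rfl, Category.assoc, ι_tensorHom]
  rw [GradedObject.categoryOfGradedObjects_id, MonoidalCategory.tensorHom_id,
    ← MonoidalCategory.comp_whiskerRight_assoc, ι_gBraid, units_smul_whiskerRight,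
    Linear.units_smul_comp, MonoidalCategory.comp_whiskerRight, Category.assoc,
    ← ιTensorObj₃'_eq]

lemma ι_whiskerLeft_g (i j k l : ℤ) (h : i + j + k = l) :
    ιTensorObj₃ X Y Z i j k l h ≫ tensorHom (𝟙 X) (gBraid Y Z) l =
      bSign j k • (X i ◁ (β_ (Y j) (Z k)).hom ≫ ιTensorObj₃ X Z Y i k j l (by lia)) := by
  rw [ιTensorObj₃_eq X Y Z i j k l h _ rfl, Category.assoc, ι_tensorHom]
  rw [GradedObject.categoryOfGradedObjects_id, MonoidalCategory.id_tensorHom,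
    ← MonoidalCategory.whiskerLeft_comp_assoc, ι_gBraid, whiskerLeft_units_smul,
    Linear.units_smul_comp, MonoidalCategory.whiskerLeft_comp, Category.assoc,
    ← ιTensorObj₃_eq]

lemma gHexagon_forward :
    (associator X Y Z).hom ≫ (gBraid X (GradedObject.Monoidal.tensorObj Y Z)) ≫
        (associator Y Z X).hom =
      tensorHom (gBraid X Y) (𝟙 Z) ≫ (associator Y X Z).hom ≫
        tensorHom (𝟙 Y) (gBraid X Z) := by
  ext l i j k h
  dsimp only [GradedObject.categoryOfGradedObjects_comp]
  have h1 : ιTensorObj₃' X Y Z i j k l h ≫ (associator X Y Z).hom l ≫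
      (gBraid X (GradedObject.Monoidal.tensorObj Y Z)) l ≫ (associator Y Z X).hom l =
      bSign i (j + k) • ((α_ _ _ _).hom ≫ (β_ (X i) (Y j ⊗ Z k)).hom ≫ (α_ _ _ _).hom ≫
        ιTensorObj₃ Y Z X j k i l (by lia)) := by
    rw [ιTensorObj₃'_associator_hom_assoc, ιTensorObj₃_eq X Y Z i j k l h _ rfl,
      Category.assoc, ι_gBraid_assoc, Linear.units_smul_comp, Category.assoc,
      Linear.comp_units_smul, Linear.comp_units_smul,
      BraidedCategory.braiding_naturality_right_assoc,
      ← ιTensorObj₃'_eq_assoc Y Z X j k i l (by lia) _ rfl, ιTensorObj₃'_associator_hom]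
  rw [h1]
  have h2 := reassoc_of% (ι_whiskerRight_g X Y Z i j k l h)
  rw [h2, Linear.units_smul_comp, Category.assoc, ιTensorObj₃'_associator_hom_assoc,
    ι_whiskerLeft_g, Linear.comp_units_smul, Linear.comp_units_smul, smul_smul,
    BraidedCategory.hexagon_forward_assoc, ← Int.negOnePow_add, ← mul_add]

lemma gHexagon_reverse :
    (associator X Y Z).inv ≫ (gBraid (GradedObject.Monoidal.tensorObj X Y) Z) ≫
        (associator Z X Y).inv =
      tensorHom (𝟙 X) (gBraid Y Z) ≫ (associator X Z Y).inv ≫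
        tensorHom (gBraid X Z) (𝟙 Y) := by
  ext l i j k h
  dsimp only [GradedObject.categoryOfGradedObjects_comp]
  have h1 : ιTensorObj₃ X Y Z i j k l h ≫ (associator X Y Z).inv l ≫
      (gBraid (GradedObject.Monoidal.tensorObj X Y) Z) l ≫ (associator Z X Y).inv l =
      bSign (i + j) k • ((α_ _ _ _).inv ≫ (β_ (X i ⊗ Y j) (Z k)).hom ≫ (α_ _ _ _).inv ≫
        ιTensorObj₃' Z X Y k i j l (by lia)) := by
    rw [ιTensorObj₃_associator_inv_assoc, ιTensorObj₃'_eq X Y Z i j k l h _ rfl,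
      Category.assoc, ι_gBraid_assoc, Linear.units_smul_comp, Category.assoc,
      Linear.comp_units_smul, Linear.comp_units_smul,
      BraidedCategory.braiding_naturality_left_assoc,
      ← ιTensorObj₃_eq_assoc Z X Y k i j l (by lia) _ rfl, ιTensorObj₃_associator_inv]
  rw [h1]
  have h2 := reassoc_of% (ι_whiskerLeft_g X Y Z i j k l h)
  rw [h2, Linear.units_smul_comp, Category.assoc, ιTensorObj₃_associator_inv_assoc,
    ι_whiskerRight_g, Linear.comp_units_smul, Linear.comp_units_smul, smul_smul,
    BraidedCategory.hexagon_reverse_assoc, ← Int.negOnePow_add, ← add_mul, add_comm i j]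

lemma gBraid_symm : gBraid X Y ≫ gBraid Y X = 𝟙 _ := by
  ext l i j h
  dsimp only [GradedObject.categoryOfGradedObjects_comp]
  rw [ι_gBraid_assoc, Linear.units_smul_comp, Category.assoc, ι_gBraid, Linear.comp_units_smul,
    SymmetricCategory.symmetry_assoc, smul_smul, ← Int.negOnePow_add, mul_comm j i,
    ← two_mul, Int.negOnePow_two_mul, one_smul]
  exact (Category.comp_id _).symm

variable {X Y} in
lemma gBraid_naturality_left (f : X ⟶ Y) :
    tensorHom f (𝟙 Z) ≫ gBraid Y Z = gBraid X Z ≫ tensorHom (𝟙 Z) f := by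
  ext l i j h
  dsimp only [GradedObject.categoryOfGradedObjects_comp]
  rw [ι_tensorHom_assoc, ι_gBraid, ι_gBraid_assoc, Linear.comp_units_smul, Linear.units_smul_comp,
    Category.assoc, ι_tensorHom, GradedObject.categoryOfGradedObjects_id, MonoidalCategory.tensorHom_id,
    MonoidalCategory.id_tensorHom, BraidedCategory.braiding_naturality_left_assoc]

variable {X Y} in
lemma gBraid_naturality_right (f : X ⟶ Y) :
    tensorHom (𝟙 Z) f ≫ gBraid Z Y = gBraid Z X ≫ tensorHom f (𝟙 Z) := by
  ext l i j h
  dsimp only [GradedObject.categoryOfGradedObjects_comp]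
  rw [ι_tensorHom_assoc, ι_gBraid, ι_gBraid_assoc, Linear.comp_units_smul, Linear.units_smul_comp,
    Category.assoc, ι_tensorHom, GradedObject.categoryOfGradedObjects_id, MonoidalCategory.tensorHom_id,
    MonoidalCategory.id_tensorHom, BraidedCategory.braiding_naturality_right_assoc]
end

/-- The sign `(-1)^i` in `d (x ⊗ y) = d x ⊗ y + (-1)^i x ⊗ d y` for `x` of degree `i`. -/
instance tensorSignsDownInt : ComplexShape.TensorSigns (ComplexShape.down ℤ) where
  ε' := MonoidHom.mk' (fun i : Multiplicative ℤ => Int.negOnePow (Multiplicative.toAdd i))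
    (fun a b => Int.negOnePow_add _ _)
  rel_add p q r (hpq : q + 1 = p) := show q + r + 1 = p + r by lia
  add_rel p q r (hpq : q + 1 = p) := show r + q + 1 = r + p by lia
  ε'_succ p q (h : q + 1 = p) := by
    subst h
    change Int.negOnePow q = - Int.negOnePow (q + 1)
    rw [Int.negOnePow_succ, neg_neg]

/-- Chain complexes of rational vector spaces. -/
abbrev ChQ : Type 1 := HomologicalComplex (ModuleCat.{0} ℚ) (ComplexShape.down ℤ)
/-- Chain complexes of `ℚ W`-modules. Their tensor product over `ℚ`, with the diagonal action, is
the one that Mathlib provides. -/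
abbrev ChRep (W : Type) [Group W] : Type 1 :=
  HomologicalComplex (Rep.{0} ℚ W) (ComplexShape.down ℤ)

variable {W : Type} [Group W]

lemma eps_down (n : ℤ) : (ComplexShape.down ℤ).ε n = n.negOnePow := rfl

section
open GradedObject.Monoidal HomologicalComplex

lemma ι_tensor_d (X Y : ChRep W) (i j k i' j' k' : ℤ) (h : i + j = k) (hi : i' + 1 = i)
    (hj : j' + 1 = j) (hk : k' + 1 = k) :
    HomologicalComplex.ιTensorObj X Y i j k h ≫ (X ⊗ Y).d k k' =
      (X.d i i' ▷ Y.X j) ≫ HomologicalComplex.ιTensorObj X Y i' j k' (by lia) +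
      i.negOnePow • ((X.X i ◁ Y.d j j') ≫ HomologicalComplex.ιTensorObj X Y i j' k' (by lia)) := by
  change HomologicalComplex.ιTensorObj X Y i j k h ≫
    (HomologicalComplex.tensorObj X Y).d k k' = _
  rw [HomologicalComplex.mapBifunctor.d_eq, Preadditive.comp_add,
    HomologicalComplex.mapBifunctor.ι_D₁, HomologicalComplex.mapBifunctor.ι_D₂,
    HomologicalComplex.mapBifunctor.d₁_eq _ _ _ _ (show (ComplexShape.down ℤ).Rel i i' from hi)
      _ _ (show i' + j = k' by lia),
    HomologicalComplex.mapBifunctor.d₂_eq _ _ _ _ _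
      (show (ComplexShape.down ℤ).Rel j j' from hj) _ (show i + j' = k' by lia)]
  erw [one_smul]
  rfl

/-- The symmetry `X ⊗ Y ⟶ Y ⊗ X` with the Koszul sign. -/
def braidHom (X Y : ChRep W) : X ⊗ Y ⟶ Y ⊗ X where
  f k := mapBifunctorDesc (fun i j hij => bSign i j • ((β_ (X.X i) (Y.X j)).hom ≫
    HomologicalComplex.ιTensorObj Y X j i k (by change j + i = k; change i + j = k at hij; lia)))
  comm' k k' hk := by
    replace hk : k' + 1 = k := hk
    apply HomologicalComplex.mapBifunctor.hom_ext
    intro i j h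
    replace h : i + j = k := h
    rw [HomologicalComplex.ι_mapBifunctorDesc_assoc, Linear.units_smul_comp, Category.assoc,
      ι_tensor_d Y X j i k (j-1) (i-1) k' (by lia) (by lia) (by lia) hk]
    have := ι_tensor_d X Y i j k (i-1) (j-1) k' h (by lia) (by lia) hk
    refine Eq.trans ?_ (congrArg (· ≫ _) this).symm |>.trans (Category.assoc _ _ _)
    simp only [Preadditive.add_comp, Linear.units_smul_comp, Category.assoc,
      HomologicalComplex.ι_mapBifunctorDesc, Preadditive.comp_add, Linear.comp_units_smul,
      smul_add, smul_smul]
    rw [BraidedCategory.braiding_naturality_left_assoc,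
      BraidedCategory.braiding_naturality_right_assoc, add_comm]
    congr 2
    · rw [← Int.negOnePow_add]
      rw [Int.negOnePow_eq_iff]
      exact ⟨j, by ring⟩
    · rw [← Int.negOnePow_add]
      rw [Int.negOnePow_eq_iff]
      exact ⟨0, by ring⟩


lemma braidHom_f (X Y : ChRep W) (k : ℤ) :
    (braidHom X Y).f k = gBraid (C := Rep.{0} ℚ W) X.X Y.X k := by
  apply HomologicalComplex.mapBifunctor.hom_ext
  intro i j h
  dsimp only [braidHom]
  rw [HomologicalComplex.ι_mapBifunctorDesc]
  exact (ι_gBraid (C := Rep.{0} ℚ W) X.X Y.X i j k h).symm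

lemma braidHom_symm (X Y : ChRep W) : braidHom X Y ≫ braidHom Y X = 𝟙 _ := by
  ext1 k
  rw [HomologicalComplex.comp_f, braidHom_f, braidHom_f]
  exact congrFun (gBraid_symm (C := Rep.{0} ℚ W) X.X Y.X) k

instance braided : BraidedCategory (ChRep W) where
  braiding X Y := ⟨braidHom X Y, braidHom Y X, braidHom_symm X Y, braidHom_symm Y X⟩
  braiding_naturality_left f Z := by
    ext1 k
    simp only [HomologicalComplex.comp_f, braidHom_f]
    exact congrFun (gBraid_naturality_left (C := Rep.{0} ℚ W) Z.X f.f) k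
  braiding_naturality_right Z _ _ f := by
    ext1 k
    simp only [HomologicalComplex.comp_f, braidHom_f]
    exact congrFun (gBraid_naturality_right (C := Rep.{0} ℚ W) Z.X f.f) k
  hexagon_forward X Y Z := by
    ext1 k
    simp only [HomologicalComplex.comp_f, braidHom_f]
    refine (congrFun (gHexagon_forward (C := Rep.{0} ℚ W) X.X Y.X Z.X) k).trans ?_
    have : (braidHom X Y).f = gBraid (C := Rep.{0} ℚ W) X.X Y.X := funext (braidHom_f X Y)
    rw [← this]
    have : (braidHom X Z).f = gBraid (C := Rep.{0} ℚ W) X.X Z.X := funext (braidHom_f X Z)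
    rw [← this]
    rfl
  hexagon_reverse X Y Z := by
    ext1 k
    simp only [HomologicalComplex.comp_f, braidHom_f]
    refine (congrFun (gHexagon_reverse (C := Rep.{0} ℚ W) X.X Y.X Z.X) k).trans ?_
    have : (braidHom Y Z).f = gBraid (C := Rep.{0} ℚ W) Y.X Z.X := funext (braidHom_f Y Z)
    rw [← this]
    have : (braidHom X Z).f = gBraid (C := Rep.{0} ℚ W) X.X Z.X := funext (braidHom_f X Z)
    rw [← this]
    rfl

instance symmetric : SymmetricCategory (ChRep W) where
  symmetry X Y := braidHom_symm X Y
end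
/-! ### Categories enriched over `Ch(ℚ)` and their right modules -/

/-- Bilinear maps `A × B ⟶ C` corresponding to chain maps `A ⊗ B ⟶ C`. -/
structure DGBilin (A B C : ChQ) where
  app (p q r : ℤ) (h : p + q = r) : A.X p →ₗ[ℚ] B.X q →ₗ[ℚ] C.X r
  d_app (p q r : ℤ) (h : p + q = r) (x : A.X p) (y : B.X q) :
    (C.d r (r - 1)).hom (app p q r h x y) =
      app (p - 1) q (r - 1) (by lia) ((A.d p (p - 1)).hom x) y +
      p.negOnePow • app p (q - 1) (r - 1) (by lia) x ((B.d q (q - 1)).hom y)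

/-- Trilinear maps `A × B × C ⟶ D` corresponding to chain maps `A ⊗ B ⊗ C ⟶ D`. -/
structure DGTrilin (A B C D : ChQ) where
  app (p q s r : ℤ) (h : p + q + s = r) : A.X p →ₗ[ℚ] B.X q →ₗ[ℚ] C.X s →ₗ[ℚ] D.X r
  d_app (p q s r : ℤ) (h : p + q + s = r) (x : A.X p) (y : B.X q) (z : C.X s) :
    (D.d r (r - 1)).hom (app p q s r h x y z) =
      app (p - 1) q s (r - 1) (by lia) ((A.d p (p - 1)).hom x) y z +
      p.negOnePow • app p (q - 1) s (r - 1) (by lia) x ((B.d q (q - 1)).hom y) z +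
      (p + q).negOnePow • app p q (s - 1) (r - 1) (by lia) x y ((C.d s (s - 1)).hom z)

/-- A small category enriched over `Ch(ℚ)`; `comp a b c` is `(g, f) ↦ g ∘ f`. -/
structure DGCategory where
  obj : Type
  hom : obj → obj → ChQ
  one (a : obj) : (hom a a).X 0
  comp (a b c : obj) : DGBilin (hom b c) (hom a b) (hom a c)
  d_one (a : obj) : ((hom a a).d 0 (-1)).hom (one a) = 0
  one_comp (a b : obj) (p : ℤ) (f : (hom a b).X p) :
    (comp a b b).app 0 p p (by lia) (one b) f = f
  comp_one (a b : obj) (p : ℤ) (f : (hom a b).X p) :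
    (comp a a b).app p 0 p (by lia) f (one a) = f
  assoc (a b c d : obj) (p q r pq qr pqr : ℤ) (hpq : p + q = pq) (hqr : q + r = qr)
    (h : p + q + r = pqr) (f : (hom c d).X p) (g : (hom b c).X q) (k : (hom a b).X r) :
    (comp a b d).app pq r pqr (by lia) ((comp b c d).app p q pq hpq f g) k =
      (comp a c d).app p qr pqr (by lia) f ((comp a b c).app q r qr hqr g k)

/-- A right module over `E`: a contravariant enriched functor from `E` to `Ch(ℚ)`, given by its
action maps `M(b) ⊗ E(a, b) ⟶ M(a)`. -/
structure RightModule (E : DGCategory) where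
  obj : E.obj → ChQ
  act (a b : E.obj) : DGBilin (obj b) (E.hom a b) (obj a)
  act_one (a : E.obj) (p : ℤ) (m : (obj a).X p) :
    (act a a).app p 0 p (by lia) m (E.one a) = m
  act_comp (a b c : E.obj) (p q r pq qr pqr : ℤ) (hpq : p + q = pq) (hqr : q + r = qr)
    (h : p + q + r = pqr) (m : (obj c).X p) (f : (E.hom b c).X q) (g : (E.hom a b).X r) :
    (act a b).app pq r pqr (by lia) ((act b c).app p q pq hpq m f) g =
      (act a c).app p qr pqr (by lia) m ((E.comp a b c).app q r qr hqr f g)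

namespace RightModule

variable {E : DGCategory}

/-- Enriched natural transformations. -/
@[ext]
structure Hom (M N : RightModule E) where
  app (a : E.obj) : M.obj a ⟶ N.obj a
  map_act (a b : E.obj) (p q r : ℤ) (h : p + q = r) (m : (M.obj b).X p) (f : (E.hom a b).X q) :
    ((app a).f r).hom ((M.act a b).app p q r h m f) =
      (N.act a b).app p q r h (((app b).f p).hom m) f

instance : Category (RightModule E) where
  Hom M N := Hom M N
  id M := { app := fun a => 𝟙 (M.obj a), map_act := fun _ _ _ _ _ _ _ _ => rfl }
  comp f g :=
    { app := fun a => f.app a ≫ g.app a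
      map_act := fun a b p q r h m x => by
        simp [f.map_act, g.map_act] }
  id_comp f := by ext1; funext a; exact Category.id_comp _
  comp_id f := by ext1; funext a; exact Category.comp_id _
  assoc f g h := by ext1; funext a; exact Category.assoc _ _ _

/-- The free module `E(-, b)`. -/
def free (b : E.obj) : RightModule E where
  obj a := E.hom a b
  act a a' := E.comp a a' b
  act_one a p f := E.comp_one a b p f
  act_comp a a' a'' p q r pq qr pqr hpq hqr h m f g :=
    E.assoc a a' a'' b p q r pq qr pqr hpq hqr h m f g

end RightModule

section HomComplex

variable {W : Type} [Group W]

/-- The pairs `(k, l)` with `k + n = l`. -/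
abbrev HomIdx (n : ℤ) : Type := {t : ℤ × ℤ // t.1 + n = t.2}

/-- The degree `n` part of `hom_ℚ(X, Y)^W`: the elements of `∏ k, hom_ℚ(X k, Y (k + n))` that are
fixed by the conjugation action of `W`. -/
def fixedHom (X Y : ChRep W) (n : ℤ) :
    Submodule ℚ (∀ t : HomIdx n, (X.X t.1.1).V →ₗ[ℚ] (Y.X t.1.2).V) where
  carrier := {f | ∀ (g : W) (t : HomIdx n),
    (Y.X t.1.2).ρ g ∘ₗ f t ∘ₗ (X.X t.1.1).ρ g⁻¹ = f t}
  add_mem' {f f'} hf hf' g t := by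
    rw [Pi.add_apply, LinearMap.add_comp, LinearMap.comp_add, hf g t, hf' g t]
  zero_mem' g t := by simp
  smul_mem' c f hf g t := by
    rw [Pi.smul_apply, LinearMap.smul_comp, LinearMap.comp_smul, hf g t]

variable {X Y Z T : ChRep W}

/-- The component `X k → Y l` of an element of degree `n`, where `k + n = l`. -/
def ev {n : ℤ} (f : fixedHom X Y n) (k l : ℤ) (h : k + n = l) :
    (X.X k).V →ₗ[ℚ] (Y.X l).V := f.1 ⟨(k, l), h⟩

lemma ev_ρ {n : ℤ} (f : fixedHom X Y n) (k l : ℤ) (h : k + n = l) (g : W) (x : (X.X k).V) :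
    ev f k l h ((X.X k).ρ g x) = (Y.X l).ρ g (ev f k l h x) := by
  have := LinearMap.congr_fun (f.2 g ⟨(k, l), h⟩) ((X.X k).ρ g x)
  simp only [LinearMap.comp_apply, Representation.inv_self_apply] at this
  exact this.symm

lemma fixed_ext {n : ℤ} {f f' : fixedHom X Y n}
    (H : ∀ k l h x, ev f k l h x = ev f' k l h x) : f = f' := by
  apply Subtype.ext
  funext ⟨⟨k, l⟩, h⟩
  exact LinearMap.ext (H k l h)

/-- An element of `hom_ℚ(X, Y)^W` from its components. -/
def mkFixed {n : ℤ} (φ : ∀ k l : ℤ, k + n = l → ((X.X k).V →ₗ[ℚ] (Y.X l).V))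
    (hφ : ∀ k l h (g : W) x, φ k l h ((X.X k).ρ g x) = (Y.X l).ρ g (φ k l h x)) :
    fixedHom X Y n :=
  ⟨fun t => φ t.1.1 t.1.2 t.2, fun g t => by
    ext x
    simp only [LinearMap.comp_apply, hφ, Representation.self_inv_apply]⟩

lemma ev_mkFixed {n : ℤ} (φ : ∀ k l : ℤ, k + n = l → ((X.X k).V →ₗ[ℚ] (Y.X l).V)) (hφ)
    (k l : ℤ) (h : k + n = l) : ev (mkFixed φ hφ) k l h = φ k l h := rfl

lemma ev_add {n : ℤ} (f f' : fixedHom X Y n) (k l : ℤ) (h : k + n = l) (x : (X.X k).V) :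
    ev (f + f') k l h x = ev f k l h x + ev f' k l h x := rfl

lemma ev_smul {n : ℤ} (c : ℚ) (f : fixedHom X Y n) (k l : ℤ) (h : k + n = l) (x : (X.X k).V) :
    ev (c • f) k l h x = c • ev f k l h x := rfl

lemma ev_usmul {n : ℤ} (c : ℤˣ) (f : fixedHom X Y n) (k l : ℤ) (h : k + n = l) (x : (X.X k).V) :
    ev (c • f) k l h x = c • ev f k l h x := rfl

/-- The differential of `X` as a linear map. -/
def dV (X : ChRep W) (i j : ℤ) : (X.X i).V →ₗ[ℚ] (X.X j).V := (X.d i j).hom.toLinearMap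

lemma dV_ρ (X : ChRep W) (i j : ℤ) (g : W) (x : (X.X i).V) :
    dV X i j ((X.X i).ρ g x) = (X.X j).ρ g (dV X i j x) :=
  Rep.hom_comm_apply (X.d i j) g x

lemma dV_dV (X : ChRep W) (i j k : ℤ) (x : (X.X i).V) : dV X j k (dV X i j x) = 0 := by
  have := congrArg (fun φ : X.X i ⟶ X.X k => φ.hom x) (X.d_comp_d i j k)
  exact this

lemma dV_shape (X : ChRep W) (i j : ℤ) (h : j + 1 ≠ i) : dV X i j = 0 := by
  have : X.d i j = 0 := X.shape i j h
  simp only [dV, this]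
  rfl

lemma dV_comm {X Y : ChRep W} (u : X ⟶ Y) (i j : ℤ) (x : (X.X i).V) :
    (u.f j).hom (dV X i j x) = dV Y i j ((u.f i).hom x) :=
  (congrArg (fun φ : X.X i ⟶ Y.X j => φ.hom x) (u.comm i j)).symm

/-- `(d f)(x) = d (f x) - (-1)^i f (d x)` for `f` of degree `i`. -/
def homD (X Y : ChRep W) (i j : ℤ) : fixedHom X Y i →ₗ[ℚ] fixedHom X Y j where
  toFun f := mkFixed
    (fun k l _ => dV Y (k + i) l ∘ₗ ev f k (k + i) rfl -
      i.negOnePow • (ev f (l - i) l (by lia) ∘ₗ dV X k (l - i)))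
    (by
      intro k l h g x
      simp only [LinearMap.sub_apply, LinearMap.comp_apply, LinearMap.smul_apply, dV_ρ, ev_ρ,
        map_sub, Units.smul_def, map_zsmul])
  map_add' f f' := by
    apply fixed_ext
    intro k l h x
    simp only [ev_mkFixed, ev_add, LinearMap.sub_apply, LinearMap.comp_apply,
      LinearMap.smul_apply, map_add, smul_add]
    abel
  map_smul' c f := by
    apply fixed_ext
    intro k l h x
    simp only [ev_mkFixed, ev_smul, LinearMap.sub_apply, LinearMap.comp_apply,
      LinearMap.smul_apply, map_smul, smul_sub, RingHom.id_apply]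
    rw [smul_comm]

lemma ev_homD (i j : ℤ) (f : fixedHom X Y i) (k l k' l' : ℤ) (h : k + j = l) (hl : k + i = l')
    (hk : k' + i = l) (x : (X.X k).V) :
    ev (homD X Y i j f) k l h x =
      dV Y l' l (ev f k l' hl x) - i.negOnePow • ev f k' l hk (dV X k k' x) := by
  subst hl
  obtain rfl : k' = l - i := by lia
  rfl

lemma homD_shape (i j : ℤ) (hij : j + 1 ≠ i) : homD X Y i j = 0 := by
  refine LinearMap.ext fun f => fixed_ext fun k l h x => ?_
  rw [ev_homD i j f k l (l - i) (k + i) h rfl (by lia) x, dV_shape Y _ _ (by lia),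
    dV_shape X _ _ (by lia)]
  simp only [LinearMap.zero_apply, map_zero, smul_zero, sub_zero]
  rfl

lemma homD_homD (i j m : ℤ) (hij : j + 1 = i) (hjm : m + 1 = j) (f : fixedHom X Y i) :
    homD X Y j m (homD X Y i j f) = 0 := by
  refine fixed_ext fun k l h x => ?_
  rw [ev_homD j m (homD X Y i j f) k l (k - 1) (l + 1) h (by lia) (by lia) x,
    ev_homD i j f k (l + 1) (k - 1) (l + 2) (by lia) (by lia) (by lia),
    ev_homD i j f (k - 1) l (k - 2) (l + 1) (by lia) (by lia) (by lia),
    dV_dV, map_sub, dV_dV, map_zero]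
  have : i.negOnePow = - j.negOnePow := by rw [← hij, Int.negOnePow_succ]
  simp only [Units.smul_def, this, smul_zero, sub_zero, zero_sub, Units.val_neg,
    neg_smul, neg_neg, map_zsmul, map_neg, sub_self]
  rfl

/-- The chain complex `hom_ℚ(X, Y)^W`. -/
def homComplex (X Y : ChRep W) : ChQ where
  X n := ModuleCat.of ℚ (fixedHom X Y n)
  d i j := ModuleCat.ofHom (homD X Y i j)
  shape i j hij := congrArg ModuleCat.ofHom (homD_shape i j hij)
  d_comp_d' i j m hij hjm :=
    congrArg ModuleCat.ofHom (LinearMap.ext fun f => homD_homD i j m hij hjm f)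

/-- Composition `g ∘ f`. -/
def compFixed (p q r : ℤ) (h : p + q = r) :
    fixedHom Y Z p →ₗ[ℚ] fixedHom X Y q →ₗ[ℚ] fixedHom X Z r :=
  LinearMap.mk₂ ℚ
    (fun g f => mkFixed (fun k l _ => ev g (k + q) l (by lia) ∘ₗ ev f k (k + q) rfl)
      (fun k l _ w x => by simp only [LinearMap.comp_apply, ev_ρ]))
    (fun g g' f => fixed_ext fun k l _ x => rfl)
    (fun c g f => fixed_ext fun k l _ x => rfl)
    (fun g f f' => fixed_ext fun k l _ x => by
      simp only [ev_mkFixed, LinearMap.comp_apply, ev_add, map_add])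
    (fun c g f => fixed_ext fun k l _ x => by
      simp only [ev_mkFixed, LinearMap.comp_apply, ev_smul, map_smul])

lemma ev_compFixed (p q r : ℤ) (h : p + q = r) (g : fixedHom Y Z p) (f : fixedHom X Y q)
    (k m l : ℤ) (hkl : k + r = l) (hm : k + q = m) (x : (X.X k).V) :
    ev (compFixed p q r h g f) k l hkl x = ev g m l (by lia) (ev f k m hm x) := by
  subst hm
  rfl

lemma homD_comp (p q r : ℤ) (h : p + q = r) (g : fixedHom Y Z p) (f : fixedHom X Y q) :
    homD X Z r (r - 1) (compFixed p q r h g f) =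
      compFixed (p - 1) q (r - 1) (by lia) (homD Y Z p (p - 1) g) f +
      p.negOnePow • compFixed p (q - 1) (r - 1) (by lia) g (homD X Y q (q - 1) f) := by
  have hr : r.negOnePow = p.negOnePow * q.negOnePow := by rw [← h, Int.negOnePow_add]
  refine fixed_ext fun k l hkl x => ?_
  rw [ev_homD r (r - 1) (compFixed p q r h g f) k l (k - 1) (l + 1) hkl (by lia) (by lia) x,
    ev_add, ev_usmul,
    ev_compFixed (p - 1) q (r - 1) (by lia) (homD Y Z p (p - 1) g) f k (k + q) l hkl rfl x,
    ev_compFixed p (q - 1) (r - 1) (by lia) g (homD X Y q (q - 1) f) k (k + q - 1) l hkl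
        (by lia) x,
    ev_homD p (p - 1) g (k + q) l (k + q - 1) (l + 1) (by lia) (by lia) (by lia),
    ev_homD q (q - 1) f k (k + q - 1) (k - 1) (k + q) (by lia) (by lia) (by lia),
    ev_compFixed p q r h g f k (k + q) (l + 1) (by lia) rfl,
    ev_compFixed p q r h g f (k - 1) (k + q - 1) l (by lia) (by lia), map_sub,
    smul_sub, hr, mul_smul]
  simp only [Units.smul_def, map_zsmul]
  abel

/-- Composition as a bilinear chain map. -/
def homComp (X Y Z : ChRep W) :
    DGBilin (homComplex Y Z) (homComplex X Y) (homComplex X Z) where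
  app p q r h := compFixed p q r h
  d_app p q r h g f := homD_comp p q r h g f

/-- The identity of `X`. -/
def homOne (X : ChRep W) : fixedHom X X 0 :=
  mkFixed (fun k l h => (X.XIsoOfEq (show k = l by lia)).hom.hom.toLinearMap)
    (fun k l h g x => Rep.hom_comm_apply _ g x)

lemma ev_homOne (k : ℤ) (h : k + 0 = k) (x : (X.X k).V) : ev (homOne X) k k h x = x := by
  simp [homOne, ev_mkFixed]

/-- The `Ch(ℚ)`-category with the objects `c i`, a full subcategory of `Ch(ℚ W)`. -/
def dgFull {I : Type} (c : I → ChRep W) : DGCategory where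
  obj := I
  hom a b := homComplex (c a) (c b)
  one a := homOne (c a)
  comp a b e := homComp (c a) (c b) (c e)
  d_one a := by
    apply fixed_ext
    intro k l h x
    refine (ev_homD 0 (-1) (homOne (c a)) k l l k h (by lia) (by lia) x).trans ?_
    rw [ev_homOne, ev_homOne]
    simp
    rfl
  one_comp a b p f := by
    apply fixed_ext
    intro k l h x
    refine (ev_compFixed 0 p p (by lia) (homOne (c b)) f k l l h h x).trans ?_
    rw [ev_homOne]
  comp_one a b p f := by
    apply fixed_ext
    intro k l h x
    refine (ev_compFixed p 0 p (by lia) f (homOne (c a)) k k l h (by lia) x).trans ?_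
    rw [ev_homOne]
  assoc a b e e' p q r pq qr pqr hpq hqr h f g k := by
    apply fixed_ext
    intro i l hil x
    refine (ev_compFixed pq r pqr (by lia) (compFixed p q pq hpq f g) k i (i + r) l hil rfl
      x).trans ?_
    refine Eq.trans ?_ (ev_compFixed p qr pqr (by lia) f (compFixed q r qr hqr g k) i (i + qr) l
      hil rfl x).symm
    rw [ev_compFixed p q pq hpq f g (i + r) (i + qr) l (by lia) (by lia),
      ev_compFixed q r qr hqr g k i (i + r) (i + qr) (by lia) rfl]

/-- Postcomposition with a chain map. -/
def homPost (X : ChRep W) {Y Z : ChRep W} (u : Y ⟶ Z) : homComplex X Y ⟶ homComplex X Z where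
  f n := ModuleCat.ofHom
    { toFun := fun f => mkFixed (fun k l h => (u.f l).hom.toLinearMap ∘ₗ ev f k l h)
        (fun k l h g x => by
          simp only [LinearMap.comp_apply, ev_ρ]
          exact Rep.hom_comm_apply (u.f l) g _)
      map_add' := fun f f' => fixed_ext fun k l _ x => by
        simp only [ev_mkFixed, LinearMap.comp_apply, ev_add, map_add]
      map_smul' := fun c f => fixed_ext fun k l _ x => by
        simp only [ev_mkFixed, LinearMap.comp_apply, ev_smul, map_smul, RingHom.id_apply] }
  comm' i j hij := by
    replace hij : j + 1 = i := hij
    ext f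
    apply fixed_ext
    intro k l h x
    refine (ev_homD (X := X) (Y := Z) i j _ k l (k - 1) (l + 1) h (by lia) (by lia) x).trans ?_
    refine Eq.trans ?_ (congrArg (u.f l).hom
      (ev_homD i j f k l (k - 1) (l + 1) h (by lia) (by lia) x)).symm
    simp only [map_sub, Units.smul_def, map_zsmul, dV_comm]
    rfl

/-- The functor `X ↦ Hom(c -, X)^W` to right modules. -/
def homFunctor {I : Type} (c : I → ChRep W) : ChRep W ⥤ RightModule (dgFull c) where
  obj X :=
    { obj := fun a => homComplex (c a) X
      act := fun a b => homComp (c a) (c b) X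
      act_one := fun a p f => by
        apply fixed_ext
        intro k l h x
        refine (ev_compFixed p 0 p (by lia) f (homOne (c a)) k k l h (by lia) x).trans ?_
        rw [ev_homOne]
      act_comp := fun a b e p q r pq qr pqr hpq hqr h f g k => by
        apply fixed_ext
        intro i l hil x
        refine (ev_compFixed pq r pqr (by lia) (compFixed p q pq hpq f g) k i (i + r) l hil rfl
          x).trans ?_
        refine Eq.trans ?_ (ev_compFixed p qr pqr (by lia) f (compFixed q r qr hqr g k) i (i + qr)
          l hil rfl x).symm
        rw [ev_compFixed p q pq hpq f g (i + r) (i + qr) l (by lia) (by lia),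
          ev_compFixed q r qr hqr g k i (i + r) (i + qr) (by lia) rfl] }
  map u :=
    { app := fun a => homPost (c a) u
      map_act := fun a b p q r h m f => rfl }
  map_id X := rfl
  map_comp u v := rfl

end HomComplex


/-! ### The category with the objects `ℚ, ℚW, ℚ(W × W), …` -/

section Cells

variable (W : Type) [Group W]

/-- The map `ℚ(W^m) ⟶ ℚ(W^n)` given on the basis by `w ↦ w ∘ σ`. -/
def reindex {m n : ℕ} (σ : Fin n → Fin m) : Rep.diagonal ℚ W m ⟶ Rep.diagonal ℚ W n :=
  Rep.ofHom
    { toLinearMap := MonoidAlgebra.mapDomainLinearMap ℚ ℚ (fun w : Fin m → W => w ∘ σ)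
      isIntertwining' := fun g => by
        ext w
        simp
        rfl }

/-- `ℚ(W^m) ⊗ ℚ(W^n) ≃ ℚ(W^(m+n))`, `v ⊗ w ↦ (v, w)`. -/
def joinEquiv (m n : ℕ) :
    TensorProduct ℚ (MonoidAlgebra ℚ (Fin m → W)) (MonoidAlgebra ℚ (Fin n → W)) ≃ₗ[ℚ]
      MonoidAlgebra ℚ (Fin (m + n) → W) :=
  TensorProduct.congr (MonoidAlgebra.coeffLinearEquiv ℚ) (MonoidAlgebra.coeffLinearEquiv ℚ) ≪≫ₗ
    finsuppTensorFinsupp' ℚ (Fin m → W) (Fin n → W) ≪≫ₗ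
    Finsupp.domLCongr (Fin.appendEquiv m n) ≪≫ₗ (MonoidAlgebra.coeffLinearEquiv ℚ).symm

lemma joinEquiv_single (m n : ℕ) (v : Fin m → W) (w : Fin n → W) :
    joinEquiv W m n (MonoidAlgebra.single v 1 ⊗ₜ[ℚ] MonoidAlgebra.single w 1) =
      MonoidAlgebra.single (Fin.append v w) 1 := by
  simp [joinEquiv]
  rfl

/-- `joinEquiv` as an isomorphism of representations. -/
def joinIso (m n : ℕ) :
    Rep.diagonal ℚ W m ⊗ Rep.diagonal ℚ W n ≅ Rep.diagonal ℚ W (m + n) :=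
  Rep.mkIso <| Representation.Equiv.mk (joinEquiv W m n) (fun g => by
    apply TensorProduct.ext
    apply MonoidAlgebra.lhom_ext'
    intro v
    apply LinearMap.ext_ring
    apply MonoidAlgebra.lhom_ext'
    intro w
    apply LinearMap.ext_ring
    change joinEquiv W m n
        ((Representation.ofMulAction ℚ W (Fin m → W) g (MonoidAlgebra.single v 1)) ⊗ₜ[ℚ]
          (Representation.ofMulAction ℚ W (Fin n → W) g (MonoidAlgebra.single w 1))) =
      Representation.ofMulAction ℚ W (Fin (m + n) → W) g
        (joinEquiv W m n (MonoidAlgebra.single v 1 ⊗ₜ[ℚ] MonoidAlgebra.single w 1))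
    rw [Representation.ofMulAction_single, Representation.ofMulAction_single, joinEquiv_single,
      joinEquiv_single, Representation.ofMulAction_single]
    congr 1
    funext i
    refine Fin.addCases (fun j => ?_) (fun j => ?_) i
    · simp
    · simp)


/-- `ℚ(W × ⋯ × W)` with `n` factors, as a complex concentrated in degree zero. -/
def cell (n : ℕ) : ChRep W :=
  (HomologicalComplex.single (Rep.{0} ℚ W) (ComplexShape.down ℤ) 0).obj (Rep.diagonal ℚ W n)

/-- The inclusion of `ℚ(W^n)` as degree zero of the complex `cell W n`; zero for `k ≠ 0`. -/
def inCell (n : ℕ) (k : ℤ) : Rep.diagonal ℚ W n ⟶ (cell W n).X k :=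
  if h : k = 0 then
    (HomologicalComplex.singleObjXIsoOfEq (ComplexShape.down ℤ) 0 (Rep.diagonal ℚ W n) k h).inv
  else 0

/-- The projection of the complex `cell W n` to its degree zero; zero for `k ≠ 0`. -/
def outCell (n : ℕ) (k : ℤ) : (cell W n).X k ⟶ Rep.diagonal ℚ W n :=
  if h : k = 0 then
    (HomologicalComplex.singleObjXIsoOfEq (ComplexShape.down ℤ) 0 (Rep.diagonal ℚ W n) k h).hom
  else 0

/-- The `Ch(ℚ)`-category with the objects `ℚ, ℚW, ℚ(W × W), …`. -/
abbrev cellCat : DGCategory := dgFull (cell W)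

/-- Right modules over `cellCat W`. -/
abbrev CellMod : Type 1 := RightModule (cellCat W)

variable {W}

/-- The element of degree `r` of `hom(ℚ(W^a), ℚ(W^b))^W` given by a map `ℚ(W^a) ⟶ ℚ(W^b)`;
zero for `r ≠ 0`. -/
def ofBase {a b : ℕ} (r : ℤ) (φ : Rep.diagonal ℚ W a ⟶ Rep.diagonal ℚ W b) :
    fixedHom (cell W a) (cell W b) r :=
  mkFixed (fun k l _ => (outCell W a k ≫ φ ≫ inCell W b l).hom.toLinearMap)
    (fun k l _ g x => Rep.hom_comm_apply (outCell W a k ≫ φ ≫ inCell W b l) g x)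

/-- The degree zero component of an element of `hom(ℚ(W^a), ℚ(W^b))^W`. -/
def toBase {a b : ℕ} {r : ℤ} (f : fixedHom (cell W a) (cell W b) r) :
    Rep.diagonal ℚ W a ⟶ Rep.diagonal ℚ W b :=
  inCell W a 0 ≫
    Rep.ofHom
      { toLinearMap := ev f 0 (0 + r) rfl
        isIntertwining' := fun g => LinearMap.ext fun x => ev_ρ f 0 (0 + r) rfl g x } ≫
    outCell W b (0 + r)

/-- The tensor product `f ⊗ g` of maps, under `ℚ(W^a) ⊗ ℚ(W^b) ≅ ℚ(W^(a+b))`. -/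
def cellTensor {a b c d : ℕ} {p q : ℤ} (r : ℤ) (f : fixedHom (cell W a) (cell W c) p)
    (g : fixedHom (cell W b) (cell W d) q) : fixedHom (cell W (a + b)) (cell W (c + d)) r :=
  ofBase r ((joinIso W a b).inv ≫ (toBase f ⊗ₘ toBase g) ≫ (joinIso W c d).hom)

variable (W)

/-- The associativity isomorphism `(b ⊗ c) ⊗ d ⟶ b ⊗ (c ⊗ d)` of `cellCat W`. -/
def cellAssoc (b c d : ℕ) : fixedHom (cell W (b + c + d)) (cell W (b + (c + d))) 0 :=
  ofBase 0 (reindex W (Fin.cast (Nat.add_assoc b c d).symm))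

/-- The unit isomorphism `ℚ ⊗ c ⟶ c` of `cellCat W`. -/
def cellLeftUnit (c : ℕ) : fixedHom (cell W (0 + c)) (cell W c) 0 :=
  ofBase 0 (reindex W (Fin.cast (Nat.zero_add c).symm))

/-- The unit isomorphism `c ⊗ ℚ ⟶ c` of `cellCat W`. -/
def cellRightUnit (c : ℕ) : fixedHom (cell W (c + 0)) (cell W c) 0 :=
  ofBase 0 (reindex W (Fin.cast (Nat.add_zero c).symm))

/-- The symmetry isomorphism `b ⊗ c ⟶ c ⊗ b` of `cellCat W`. -/
def cellBraid (b c : ℕ) : fixedHom (cell W (b + c)) (cell W (c + b)) 0 :=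
  ofBase 0 (reindex W finAddFlip)

end Cells

/-! ### The box product of right modules -/

section Box

variable (W : Type) [Group W]

variable {W} in
/-- The action `m · f` of a map `f` on an element `m` of a right module. -/
def cellAct (M : CellMod W) (a b : ℕ) (p q r : ℤ) (h : p + q = r) (m : (M.obj b).X p)
    (f : fixedHom (cell W a) (cell W b) q) : (M.obj a).X r :=
  (M.act a b).app p q r h m f

/-- Compatible families of trilinear chain maps `M(b) ⊗ N(c) ⊗ E(a, b ⊗ c) ⟶ T`. -/
structure BoxCowedge (M N : CellMod W) (a : ℕ) (T : ChQ) where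
  map (b c : ℕ) : DGTrilin (M.obj b) (N.obj c) (homComplex (cell W a) (cell W (b + c))) T
  dinatural (b c b' c' : ℕ) (p q s t r ps qt st u : ℤ) (hps : p + s = ps) (hqt : q + t = qt)
    (hst : s + t = st) (hu : st + r = u) (v : ℤ) (hv : ps + qt + r = v)
    (m : (M.obj b').X p) (n : (N.obj c').X q) (f : fixedHom (cell W b) (cell W b') s)
    (g : fixedHom (cell W c) (cell W c') t)
    (e : fixedHom (cell W a) (cell W (b + c)) r) :
    (q * s).negOnePow • (map b c).app ps qt r v hv (cellAct M b b' p s ps hps m f)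
        (cellAct N c c' q t qt hqt n g) e =
      (map b' c').app p q u v (by lia) m n (compFixed st r u hu (cellTensor st f g) e)

/-- A symmetric monoidal structure on right modules is the box product:
`(M ⊗ N)(a)` is the coend of `M(b) ⊗ N(c) ⊗ E(a, b ⊗ c)` over `b` and `c`, the unit is the free
module on the unit object, and the structure isomorphisms are induced by those of `cellCat W`.
The element `mul M N b c m n` is the class of `m ⊗ n ⊗ 1` in `(M ⊗ N)(b ⊗ c)`. -/
structure BoxProduct [MonoidalCategory (CellMod W)] [SymmetricCategory (CellMod W)] where
  mul (M N : CellMod W) (b c : ℕ) : DGBilin (M.obj b) (N.obj c) ((M ⊗ N).obj (b + c))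
  mul_act (M N : CellMod W) (b c b' c' : ℕ) (p q s t pq ps qt st v : ℤ) (hpq : p + q = pq)
    (hps : p + s = ps) (hqt : q + t = qt) (hst : s + t = st) (hv : pq + st = v)
    (m : (M.obj b').X p) (n : (N.obj c').X q) (f : fixedHom (cell W b) (cell W b') s)
    (g : fixedHom (cell W c) (cell W c') t) :
    cellAct (M ⊗ N) (b + c) (b' + c') pq st v hv ((mul M N b' c').app p q pq hpq m n)
        (cellTensor st f g) =
      (q * s).negOnePow • (mul M N b c).app ps qt v (by lia) (cellAct M b b' p s ps hps m f)
        (cellAct N c c' q t qt hqt n g)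
  mul_natural (M N M' N' : CellMod W) (f : M ⟶ M') (g : N ⟶ N') (b c : ℕ) (p q r : ℤ)
    (h : p + q = r) (m : (M.obj b).X p) (n : (N.obj c).X q) :
    (((f ⊗ₘ g).app (b + c)).f r).hom ((mul M N b c).app p q r h m n) =
      (mul M' N' b c).app p q r h (((f.app b).f p).hom m) (((g.app c).f q).hom n)
  universal (M N : CellMod W) (a : ℕ) (T : ChQ) (φ : BoxCowedge W M N a T) :
    ∃! u : (M ⊗ N).obj a ⟶ T, ∀ (b c : ℕ) (p q s pq r : ℤ) (hpq : p + q = pq) (h : pq + s = r)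
      (m : (M.obj b).X p) (n : (N.obj c).X q) (e : fixedHom (cell W a) (cell W (b + c)) s),
      (u.f r).hom (cellAct (M ⊗ N) a (b + c) pq s r h ((mul M N b c).app p q pq hpq m n) e) =
        (φ.map b c).app p q s r (by lia) m n e
  unitIso : RightModule.free (E := cellCat W) (0 : ℕ) ≅ 𝟙_ (CellMod W)
  leftUnitor (N : CellMod W) (c : ℕ) (q : ℤ) (n : (N.obj c).X q) :
    (((λ_ N).hom.app (0 + c)).f q).hom ((mul (𝟙_ (CellMod W)) N 0 c).app 0 q q (zero_add q)
        (((unitIso.hom.app (0 : ℕ)).f 0).hom (homOne (cell W 0))) n) =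
      cellAct N (0 + c) c q 0 q (add_zero q) n (cellLeftUnit W c)
  rightUnitor (M : CellMod W) (b : ℕ) (p : ℤ) (m : (M.obj b).X p) :
    (((ρ_ M).hom.app (b + 0)).f p).hom ((mul M (𝟙_ (CellMod W)) b 0).app p 0 p (add_zero p) m
        (((unitIso.hom.app (0 : ℕ)).f 0).hom (homOne (cell W 0)))) =
      cellAct M (b + 0) b p 0 p (add_zero p) m (cellRightUnit W b)
  associator (M N K : CellMod W) (b c d : ℕ) (p q r pq qr s : ℤ) (hpq : p + q = pq)
    (hqr : q + r = qr) (h : pq + r = s) (m : (M.obj b).X p) (n : (N.obj c).X q)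
    (k : (K.obj d).X r) :
    (((α_ M N K).hom.app (b + c + d)).f s).hom ((mul (M ⊗ N) K (b + c) d).app pq r s h
        ((mul M N b c).app p q pq hpq m n) k) =
      cellAct (M ⊗ (N ⊗ K)) (b + c + d) (b + (c + d)) s 0 s (add_zero s)
        ((mul M (N ⊗ K) b (c + d)).app p qr s (by lia) m ((mul N K c d).app q r qr hqr n k))
        (cellAssoc W b c d)
  braiding (M N : CellMod W) (b c : ℕ) (p q r : ℤ) (h : p + q = r) (m : (M.obj b).X p)
    (n : (N.obj c).X q) :
    (((β_ M N).hom.app (b + c)).f r).hom ((mul M N b c).app p q r h m n) =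
      (p * q).negOnePow • cellAct (N ⊗ M) (b + c) (c + b) r 0 r (add_zero r)
        ((mul N M c b).app q p r (by lia) n m) (cellBraid W b c)

end Box

/-! ### The tensor product of a right module with the objects of a full subcategory -/

section Coend

variable {W : Type} [Group W] {I : Type}

/-- Compatible families of bilinear `W`-equivariant chain maps `M(a) ⊗ c(a) ⟶ T`. -/
structure Cowedge (c : I → ChRep W) (M : RightModule (dgFull c)) (T : ChRep W) where
  map (a : I) (p q r : ℤ) (h : p + q = r) : (M.obj a).X p →ₗ[ℚ] ((c a).X q).V →ₗ[ℚ] (T.X r).V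
  d_map (a : I) (p q r : ℤ) (h : p + q = r) (m : (M.obj a).X p) (x : ((c a).X q).V) :
    dV T r (r - 1) (map a p q r h m x) =
      map a (p - 1) q (r - 1) (by lia) (((M.obj a).d p (p - 1)).hom m) x +
      p.negOnePow • map a p (q - 1) (r - 1) (by lia) m (dV (c a) q (q - 1) x)
  map_ρ (a : I) (p q r : ℤ) (h : p + q = r) (m : (M.obj a).X p) (x : ((c a).X q).V) (g : W) :
    map a p q r h m (((c a).X q).ρ g x) = (T.X r).ρ g (map a p q r h m x)
  dinatural (a b : I) (p s q ps sq r : ℤ) (hps : p + s = ps) (hsq : q + s = sq)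
    (h : p + sq = r) (m : (M.obj b).X p) (f : fixedHom (c a) (c b) s) (x : ((c a).X q).V) :
    map a ps q r (by lia) ((M.act a b).app p s ps hps m f) x =
      map b p sq r h m (ev f q sq hsq x)

/-- The functor `L` is `M ↦ ∫^a M(a) ⊗ c(a)`, with the adjunction to `homFunctor c` given by
`u ↦ (m ↦ (x ↦ u (m ⊗ x)))`; `coproj M` is the universal family `M(a) ⊗ c(a) ⟶ L M`. -/
structure IsTensorCoend (c : I → ChRep W) {L : RightModule (dgFull c) ⥤ ChRep W}
    (adj : L ⊣ homFunctor c) where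
  coproj (M : RightModule (dgFull c)) : Cowedge c M (L.obj M)
  universal (M : RightModule (dgFull c)) (T : ChRep W) (φ : Cowedge c M T) :
    ∃! u : L.obj M ⟶ T, ∀ (a : I) (p q r : ℤ) (h : p + q = r) (m : (M.obj a).X p)
      (x : ((c a).X q).V), (u.f r).hom ((coproj M).map a p q r h m x) = φ.map a p q r h m x
  natural (M N : RightModule (dgFull c)) (f : M ⟶ N) (a : I) (p q r : ℤ) (h : p + q = r)
    (m : (M.obj a).X p) (x : ((c a).X q).V) :
    ((L.map f).f r).hom ((coproj M).map a p q r h m x) =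
      (coproj N).map a p q r h (((f.app a).f p).hom m) x
  homEquiv (M : RightModule (dgFull c)) (X : ChRep W) (u : L.obj M ⟶ X) (a : I) (p q r : ℤ)
    (h : q + p = r) (m : (M.obj a).X p) (x : ((c a).X q).V) :
    ev (((((adj.homEquiv M X) u).app a).f p).hom m : fixedHom (c a) X p) q r h x =
      (u.f r).hom ((coproj M).map a p q r (by lia) m x)

end Coend

/-! ### Model categories -/

section Model

open HomotopicalAlgebra

/-- The projective model structure on complexes of representations. -/
structure IsProjectiveModel (W : Type) [Group W] [ModelCategory (ChRep W)] : Prop where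
  weakEquivalences_iff {X Y : ChRep W} (f : X ⟶ Y) : WeakEquivalence f ↔ QuasiIso f
  fibrations_iff {X Y : ChRep W} (f : X ⟶ Y) :
    Fibration f ↔ ∀ n : ℤ, Function.Surjective (f.f n).hom

/-- Weak equivalences and fibrations of right modules are defined objectwise. -/
structure IsObjectwiseModel (E : DGCategory) [ModelCategory (RightModule E)] : Prop where
  weakEquivalences_iff {M N : RightModule E} (f : M ⟶ N) :
    WeakEquivalence f ↔ ∀ a, QuasiIso (f.app a)
  fibrations_iff {M N : RightModule E} (f : M ⟶ N) :
    Fibration f ↔ ∀ (a : E.obj) (n : ℤ), Function.Surjective ((f.app a).f n).hom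

universe v u

/-- A symmetric monoidal model category: a cofibrantly generated model category with a closed
symmetric monoidal structure and the pushout product axiom. -/
structure IsSymmetricMonoidalModel (C : Type u) [Category.{v} C] [ModelCategory C]
    [MonoidalCategory C] [SymmetricCategory C] : Prop where
  hasLimits : HasLimits C
  hasColimits : HasColimits C
  cofibrantlyGenerated : ∃ I J : MorphismProperty C,
    MorphismProperty.HasSmallObjectArgument.{v} I ∧
    MorphismProperty.HasSmallObjectArgument.{v} J ∧
    trivialFibrations C = I.rlp ∧ fibrations C = J.rlp
  closed : Nonempty (MonoidalClosed C)
  pushoutProduct {A B X Y : C} (f : A ⟶ B) (g : X ⟶ Y) [Cofibration f] [Cofibration g] :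
    Cofibration ((Arrow.pushoutProduct.obj (Arrow.mk f)).obj (Arrow.mk g)).hom
  pushoutProduct_left {A B X Y : C} (f : A ⟶ B) (g : X ⟶ Y) [Cofibration f] [Cofibration g]
    [WeakEquivalence f] :
    WeakEquivalence ((Arrow.pushoutProduct.obj (Arrow.mk f)).obj (Arrow.mk g)).hom
  pushoutProduct_right {A B X Y : C} (f : A ⟶ B) (g : X ⟶ Y) [Cofibration f] [Cofibration g]
    [WeakEquivalence g] :
    WeakEquivalence ((Arrow.pushoutProduct.obj (Arrow.mk f)).obj (Arrow.mk g)).hom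
  unit {X Q : C} (q : Q ⟶ 𝟙_ C) [IsCofibrant X] [IsCofibrant Q] [WeakEquivalence q] :
    WeakEquivalence (X ◁ q)

/-- The maps `Z ⊗ f` for an object `Z` and a trivial cofibration `f`. -/
inductive TensorTrivialCofibration (C : Type u) [Category.{v} C] [ModelCategory C]
    [MonoidalCategory C] : MorphismProperty C
  | mk (Z : C) {A B : C} (f : A ⟶ B) (hf : trivialCofibrations C f) :
      TensorTrivialCofibration C (Z ◁ f)

/-- The monoid axiom. -/
def MonoidAxiom (C : Type u) [Category.{v} C] [ModelCategory C] [MonoidalCategory C] : Prop :=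
  MorphismProperty.transfiniteCompositions.{v}
    (MorphismProperty.pushouts (TensorTrivialCofibration C)) ≤ weakEquivalences C

/-- Quillen equivalences. -/
structure IsQuillenEquivalence {C D : Type u} [Category.{v} C] [Category.{v} D]
    [ModelCategory C] [ModelCategory D] {L : C ⥤ D} {R : D ⥤ C} (adj : L ⊣ R) : Prop where
  map_cofibration {A B : C} (f : A ⟶ B) [Cofibration f] : Cofibration (L.map f)
  map_trivialCofibration {A B : C} (f : A ⟶ B) [Cofibration f] [WeakEquivalence f] :
    WeakEquivalence (L.map f)
  weakEquivalence_iff {A : C} {X : D} [IsCofibrant A] [IsFibrant X] (f : L.obj A ⟶ X) :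
    WeakEquivalence f ↔ WeakEquivalence (adj.homEquiv A X f)

/-- The left adjoint `L` is strong symmetric monoidal, and `L Q ⟶ L 𝟙 ≅ 𝟙` is a weak equivalence
for each cofibrant replacement `Q ⟶ 𝟙` of the unit. -/
def IsStrongSymmetricMonoidal {C D : Type u} [Category.{v} C] [Category.{v} D]
    [ModelCategory C] [ModelCategory D] [MonoidalCategory C] [SymmetricCategory C]
    [MonoidalCategory D] [SymmetricCategory D] (L : C ⥤ D) : Prop :=
  ∃ _ : L.Braided, ∀ (Q : C) (q : Q ⟶ 𝟙_ C) [IsCofibrant Q] [WeakEquivalence q],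
    WeakEquivalence (L.map q ≫ Functor.OplaxMonoidal.η L)

end Model

/-- The Weyl group `N_G(H) / H`. -/
abbrev WeylGroup {G : Type} [Group G] (H : Subgroup G) : Type :=
  Subgroup.normalizer (H : Set G) ⧸ H.subgroupOf (Subgroup.normalizer (H : Set G))

end RatG
end

open CategoryTheory MonoidalCategory HomotopicalAlgebra RatG

/-! Write W for the Weyl group. By Maschke's theorem every rational representation of the finite
group W is both projective and injective. Hence acyclic complexes are contractible, contractible
complexes are projective and injective as objects of the category of complexes, and every
quasi-isomorphism is a homotopy equivalence (`exists_homotopyEquiv_of_quasiIso`). The projective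
model structure therefore has all monomorphisms as cofibrations and all epimorphisms as fibrations,
and its lifting and factorization axioms are direct sum arguments. Monomorphisms split degreewise,
and additive constructions preserve homotopy equivalences, so tensoring with an arbitrary complex
preserves both monomorphisms and quasi-isomorphisms. The pushout product axiom, the unit axiom and
the monoid axiom follow from these two facts (`isSymmetricMonoidalModel`, `monoidAxiom`).

The module side is Morita theory. The category 𝓔 lives in degree zero, with zero differential, and
each ℚ(W^a) is a retract of a finite sum of copies of ℚW: the maps r_w : ℚW → ℚ(W^a) and e_w :
ℚ(W^a) → ℚW satisfy id = |W|⁻¹ ∑ r_w e_w (`homOne_eq_sum`). For a = 0 this is the averaging that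
makes ℚ a summand of ℚW. So a right module M is determined by M(ℚW), on which W acts through the
r_g, and `comparison` is an isomorphism from M to Hom(𝒢, M(ℚW)). Thus Hom(𝒢, -) is an equivalence of
categories, not merely a Quillen equivalence. The model structure and the closed symmetric monoidal
structure are transported along it, after which the Quillen equivalence and strong monoidality are
formal.

What remains is to recognize the transported structures. The model structure is objectwise because
Hom(ℚW, X) is the underlying complex of X and every ℚ(W^a) is projective. The coend formula for the
left adjoint restates the adjunction, since cowedges are module maps into a Hom module
(`isTensorCoend`). For the box product, the class of m ⊗ n is the function (v, w) ↦ m(v) ⊗ n(w)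
(`boxEl`). It is universal because, up to averaging, everything comes from the summand b = c = 1 and
the diagonal ℚW → ℚ(W × W) (`rMap_append`, `boxMul_universal`). -/

noncomputable section

namespace RatG

/-! ### Complexes in a semisimple abelian category -/

namespace Semisimple

variable {A : Type*} [Category* A] [Abelian A]

/-- Chain complexes indexed by `ℤ`. -/
abbrev Ch (A : Type*) [Category* A] [Abelian A] := HomologicalComplex A (ComplexShape.down ℤ)

/-- Degreewise lifts g need not commute with the differentials, but the null-homotopic map built
from h ≫ g is always a chain map. Composed with e it becomes the one built from h ≫ f, which is f
because h contracts the identity. -/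
lemma projective_of_contractible [∀ X : A, Projective X] {K : Ch A} (h : Homotopy (𝟙 K) 0) :
    Projective K where
  factors {E X} f e _ := by
    let g (j : ℤ) : K.X j ⟶ E.X j := Projective.factorThru (f.f j) (e.f j)
    have hg (j : ℤ) : g j ≫ e.f j = f.f j := Projective.factorThru_comp _ _
    have hK : 𝟙 K = Homotopy.nullHomotopicMap h.hom := by
      ext i
      simpa [Homotopy.nullHomotopicMap] using h.comm i
    refine ⟨Homotopy.nullHomotopicMap fun i j => h.hom i j ≫ g j, ?_⟩
    rw [Homotopy.nullHomotopicMap_comp]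
    simp only [Category.assoc, hg]
    rw [← Homotopy.nullHomotopicMap_comp, ← hK, Category.id_comp]

lemma injective_of_contractible [∀ X : A, Injective X] {K : Ch A} (h : Homotopy (𝟙 K) 0) :
    Injective K where
  factors {X Y} f e _ := by
    let g (j : ℤ) : Y.X j ⟶ K.X j := Injective.factorThru (f.f j) (e.f j)
    have hg (j : ℤ) : e.f j ≫ g j = f.f j := Injective.comp_factorThru _ _
    have hK : 𝟙 K = Homotopy.nullHomotopicMap h.hom := by
      ext i
      simpa [Homotopy.nullHomotopicMap] using h.comm i
    refine ⟨Homotopy.nullHomotopicMap fun i j => g i ≫ h.hom i j, ?_⟩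
    rw [Homotopy.comp_nullHomotopicMap]
    simp only [← Category.assoc, hg]
    rw [← Homotopy.comp_nullHomotopicMap, ← hK, Category.comp_id]

/-- Factor f through its image. The mono part has a retraction and the epi part a section; compose
the retraction with the section. -/
lemma exists_regular_inverse [∀ X : A, Projective X] [∀ X : A, Injective X] {X Y : A}
    (f : X ⟶ Y) : ∃ s : Y ⟶ X, f ≫ s ≫ f = f := by
  have key {I : A} (e : X ⟶ I) (m : I ⟶ Y) [Epi e] [Mono m] :
      ∃ s : Y ⟶ X, (e ≫ m) ≫ s ≫ e ≫ m = e ≫ m := by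
    refine ⟨Injective.factorThru (𝟙 _) m ≫ Projective.factorThru (𝟙 _) e, ?_⟩
    have h1 := Injective.comp_factorThru (𝟙 _) m
    have h2 := Projective.factorThru_comp (𝟙 _) e
    simp only [Category.assoc]
    rw [reassoc_of% h1, reassoc_of% h2]
  simpa only [image.fac] using key (factorThruImage f) (image.ι f)

variable [∀ X : A, Projective X] [∀ X : A, Injective X]

/-- With s a regular inverse of each differential, 1 - d s projects onto the cycles. The contraction
is t = (1 - d s) s, reading composites from left to right. Then d t = d s because d d = 0, and t d =
1 - d s because cycles are boundaries and d s d = d. -/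
lemma contractible_of_acyclic {K : Ch A} (hK : K.Acyclic) : Nonempty (Homotopy (𝟙 K) 0) := by
  choose s hs using fun i j : ℤ => exists_regular_inverse (K.d i j)
  let t (i j : ℤ) : K.X i ⟶ K.X j := s j i - K.d i (i - 1) ≫ s i (i - 1) ≫ s j i
  refine ⟨⟨fun i j => if (ComplexShape.down ℤ).Rel j i then t i j else 0,
    fun i j h => if_neg h, fun i => ?_⟩⟩
  have h1 : (ComplexShape.down ℤ).Rel i (i - 1) := by simp
  have h2 : (ComplexShape.down ℤ).Rel (i + 1) i := by simp
  rw [dNext_eq _ h1, prevD_eq _ h2, if_pos h1, if_pos h2]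
  have hex : (K.sc' (i + 1) i (i - 1)).Exact := by
    rw [← K.exactAt_iff' _ _ _ (ComplexShape.prev_eq' _ h2) (ComplexShape.next_eq' _ h1)]
    exact hK i
  have h0 : (𝟙 _ - K.d i (i - 1) ≫ s i (i - 1)) ≫ K.d i (i - 1) = 0 := by
    rw [Preadditive.sub_comp, Category.id_comp, Category.assoc, hs, sub_self]
  obtain ⟨y, hy⟩ : ∃ y : K.X i ⟶ K.X (i + 1),
      y ≫ K.d (i + 1) i = 𝟙 _ - K.d i (i - 1) ≫ s i (i - 1) :=
    ⟨hex.liftFromProjective _ h0, hex.liftFromProjective_comp _ h0⟩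
  have h3 : (𝟙 _ - K.d i (i - 1) ≫ s i (i - 1)) ≫ s (i + 1) i ≫ K.d (i + 1) i =
      𝟙 _ - K.d i (i - 1) ≫ s i (i - 1) := by
    rw [← hy, Category.assoc, hs]
  simp only [t, HomologicalComplex.id_f, HomologicalComplex.zero_f, add_zero,
    Preadditive.comp_sub, K.d_comp_d_assoc, zero_comp, sub_zero]
  simp only [Preadditive.sub_comp, Category.id_comp, Category.assoc] at h3 ⊢
  rw [h3]
  abel

/-! ### Sums of discs: contractible complexes mapping onto, and containing, a given complex. -/

section Disc

omit [∀ X : A, Projective X] [∀ X : A, Injective X]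

variable (V U : ℤ → A) (e : ∀ i j : ℤ, i + 1 = j → (V j ≅ U i))

/-- The sum of the complexes `V j ⟶ U i` for `i + 1 = j`. -/
def disc : Ch A where
  X n := V n ⊞ U n
  d j i := if h : i + 1 = j then biprod.fst ≫ (e i j h).hom ≫ biprod.inr else 0
  shape j i h := dif_neg h
  d_comp_d' i j k h h' := by
    rw [dif_pos (show j + 1 = i from h), dif_pos (show k + 1 = j from h')]
    simp

/-- The projection to the first summand. -/
def discFst (n : ℤ) : (disc V U e).X n ⟶ V n := biprod.fst
/-- The projection to the second summand. -/
def discSnd (n : ℤ) : (disc V U e).X n ⟶ U n := biprod.snd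
/-- The inclusion of the first summand. -/
def discInl (n : ℤ) : V n ⟶ (disc V U e).X n := biprod.inl
/-- The inclusion of the second summand. -/
def discInr (n : ℤ) : U n ⟶ (disc V U e).X n := biprod.inr

@[simp]
lemma discInl_fst (n : ℤ) : discInl V U e n ≫ discFst V U e n = 𝟙 _ := biprod.inl_fst
@[simp]
lemma discInl_snd (n : ℤ) : discInl V U e n ≫ discSnd V U e n = 0 := biprod.inl_snd
@[simp]
lemma discInr_fst (n : ℤ) : discInr V U e n ≫ discFst V U e n = 0 := biprod.inr_fst
@[simp]
lemma discInr_snd (n : ℤ) : discInr V U e n ≫ discSnd V U e n = 𝟙 _ := biprod.inr_snd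
@[simp]
lemma discInl_fst_assoc (n : ℤ) {Z : A} (u : V n ⟶ Z) :
    discInl V U e n ≫ discFst V U e n ≫ u = u := by
  rw [← Category.assoc, discInl_fst]; simp
@[simp]
lemma discInl_snd_assoc (n : ℤ) {Z : A} (u : U n ⟶ Z) :
    discInl V U e n ≫ discSnd V U e n ≫ u = 0 := by
  rw [← Category.assoc, discInl_snd]; simp
@[simp]
lemma discInr_fst_assoc (n : ℤ) {Z : A} (u : V n ⟶ Z) :
    discInr V U e n ≫ discFst V U e n ≫ u = 0 := by
  rw [← Category.assoc, discInr_fst]; simp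
@[simp]
lemma discInr_snd_assoc (n : ℤ) {Z : A} (u : U n ⟶ Z) :
    discInr V U e n ≫ discSnd V U e n ≫ u = u := by
  rw [← Category.assoc, discInr_snd]; simp
lemma disc_total (n : ℤ) :
    discFst V U e n ≫ discInl V U e n + discSnd V U e n ≫ discInr V U e n = 𝟙 _ := biprod.total

lemma disc_d (i j : ℤ) (h : i + 1 = j) :
    (disc V U e).d j i = discFst V U e j ≫ (e i j h).hom ≫ discInr V U e i :=
  dif_pos h

/-- The complex `disc V U e` is contractible. -/
def discHomotopy : Homotopy (𝟙 (disc V U e)) 0 where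
  hom i j := if h : i + 1 = j then
    discSnd V U e i ≫ (e i j h).inv ≫ discInl V U e j else 0
  zero i j h := dif_neg h
  comm i := by
    have h1 : i - 1 + 1 = i := by simp
    have h2 : i + 1 = i + 1 := rfl
    rw [dNext_eq _ (show (ComplexShape.down ℤ).Rel i (i - 1) from h1),
      prevD_eq _ (show (ComplexShape.down ℤ).Rel (i + 1) i from h2), dif_pos h1, dif_pos h2,
      disc_d _ _ _ _ _ h1, disc_d _ _ _ _ _ h2]
    simpa using (disc_total V U e i).symm

variable (K : Ch A)

/-- The contractible complex that maps onto `K`. -/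
abbrev pathComplex : Ch A := disc K.X (fun n => K.X (n + 1)) fun _ _ h => K.XIsoOfEq h.symm

/-- The projection of `pathComplex K` onto `K`. -/
def pathProj : pathComplex K ⟶ K where
  f n := discFst _ _ _ n + discSnd _ _ _ n ≫ K.d (n + 1) n
  comm' i j h := by
    rw [disc_d _ _ _ _ _ h]
    simp

instance : Epi (pathProj K) := by
  have (n : ℤ) : Epi ((pathProj K).f n) :=
    epi_of_epi_fac (show discInl _ _ _ n ≫ (pathProj K).f n = 𝟙 _ by simp [pathProj])
  exact HomologicalComplex.epi_of_epi_f _ this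

/-- The contractible complex that contains `K`. -/
abbrev coneComplex : Ch A := disc (fun n => K.X (n - 1)) K.X fun i j h => K.XIsoOfEq (by lia)

/-- The inclusion of `K` into `coneComplex K`. -/
def coneIncl : K ⟶ coneComplex K where
  f n := K.d n (n - 1) ≫ discInl (fun n => K.X (n - 1)) K.X _ n + discInr _ _ _ n
  comm' i j h := by
    rw [disc_d _ _ _ _ _ h]
    simp

instance : Mono (coneIncl K) := by
  have (n : ℤ) : Mono ((coneIncl K).f n) :=
    mono_of_mono_fac (show (coneIncl K).f n ≫ discSnd _ _ _ n = 𝟙 _ by simp [coneIncl])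
  exact HomologicalComplex.mono_of_mono_f _ this

end Disc

instance enoughProjectives : EnoughProjectives (Ch A) where
  presentation K := ⟨{
    p := pathComplex K
    projective := projective_of_contractible (discHomotopy _ _ _)
    f := pathProj K }⟩

/-! ### The model structure on complexes in a semisimple category. -/

section Model

omit [∀ X : A, Projective X] [∀ X : A, Injective X] in
lemma quasiIso_inl (X : Ch A) {C : Ch A} (h : Homotopy (𝟙 C) 0) :
    QuasiIso (biprod.inl : X ⟶ X ⊞ C) := by
  let e : HomotopyEquiv X (X ⊞ C) :=
    { hom := biprod.inl
      inv := biprod.fst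
      homotopyHomInvId := Homotopy.ofEq (by simp)
      homotopyInvHomId :=
        (((h.symm.compLeft biprod.snd).compRight biprod.inr).add
          (Homotopy.refl (biprod.fst ≫ biprod.inl))).trans
          (Homotopy.ofEq (by simp [add_comm, biprod.total])) |> fun H =>
            (Homotopy.ofEq (by simp)).trans H }
  exact e.quasiIso_hom

omit [∀ X : A, Projective X] [∀ X : A, Injective X] in
lemma quasiIso_fst (X : Ch A) {C : Ch A} (h : Homotopy (𝟙 C) 0) :
    QuasiIso (biprod.fst : X ⊞ C ⟶ X) := by
  have := quasiIso_inl X h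
  have h' : QuasiIso ((biprod.inl : X ⟶ X ⊞ C) ≫ biprod.fst) := by
    rw [biprod.inl_fst]; infer_instance
  exact quasiIso_of_comp_left biprod.inl _

omit [∀ X : A, Projective X] [∀ X : A, Injective X] in
lemma acyclic_cokernel {X Y : Ch A} (i : X ⟶ Y) [Mono i] [QuasiIso i] :
    (cokernel i).Acyclic :=
  have : (ShortComplex.mk _ _ (cokernel.condition i)).ShortExact :=
    { exact := ShortComplex.exact_cokernel i }
  this.acyclic_X₃ ‹_›

omit [∀ X : A, Projective X] [∀ X : A, Injective X] in
lemma acyclic_kernel {X Y : Ch A} (p : X ⟶ Y) [Epi p] [QuasiIso p] :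
    (kernel p).Acyclic :=
  have : (ShortComplex.mk _ _ (kernel.condition p)).ShortExact :=
    { exact := ShortComplex.exact_kernel p }
  this.acyclic_X₁ ‹_›

lemma projective_of_acyclic {K : Ch A} (hK : K.Acyclic) : Projective K :=
  projective_of_contractible (contractible_of_acyclic hK).some

lemma injective_of_acyclic {K : Ch A} (hK : K.Acyclic) : Injective K :=
  injective_of_contractible (contractible_of_acyclic hK).some

/-- The cokernel of i is acyclic, hence projective, so C splits as B plus the cokernel. The lift is
t on B and, on the cokernel, a lift of b through the epimorphism p. -/
lemma hasLift_of_quasiIso_left {B C X Y : Ch A} (i : B ⟶ C) (p : X ⟶ Y) [Mono i] [QuasiIso i]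
    [Epi p] : HasLiftingProperty i p where
  sq_hasLift {t b} sq := by
    have hS : (ShortComplex.mk _ _ (cokernel.condition i)).ShortExact :=
      { exact := ShortComplex.exact_cokernel i }
    have : Projective (cokernel i) := projective_of_acyclic (acyclic_cokernel i)
    let σ := @ShortComplex.ShortExact.splittingOfProjective _ _ _ _ hS this _
    have h1 : i ≫ σ.r = 𝟙 _ := σ.f_r
    have h2 : σ.r ≫ i + cokernel.π i ≫ σ.s = 𝟙 _ := σ.id
    have h3 := Projective.factorThru_comp (σ.s ≫ b) p
    refine ⟨⟨σ.r ≫ t + cokernel.π i ≫ Projective.factorThru (σ.s ≫ b) p, ?_, ?_⟩⟩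
    · rw [Preadditive.comp_add, reassoc_of% h1, cokernel.condition_assoc, zero_comp, add_zero]
    · rw [Preadditive.add_comp, Category.assoc, Category.assoc, h3, sq.w, ← Category.assoc,
        ← Category.assoc, ← Preadditive.add_comp, h2, Category.id_comp]

/-- Dually, the kernel of p is acyclic, hence injective, so X splits as Y plus the kernel. The lift
has component b in Y, and its kernel component extends that of t along i. -/
lemma hasLift_of_quasiIso_right {B C X Y : Ch A} (i : B ⟶ C) (p : X ⟶ Y) [Mono i] [QuasiIso p]
    [Epi p] : HasLiftingProperty i p where
  sq_hasLift {t b} sq := by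
    have hS : (ShortComplex.mk _ _ (kernel.condition p)).ShortExact :=
      { exact := ShortComplex.exact_kernel p }
    have : Injective (kernel p) := injective_of_acyclic (acyclic_kernel p)
    let σ := @ShortComplex.ShortExact.splittingOfInjective _ _ _ _ hS this _
    have h1 : σ.s ≫ p = 𝟙 _ := σ.s_g
    have h2 : σ.r ≫ kernel.ι p + p ≫ σ.s = 𝟙 _ := σ.id
    have h3 := Injective.comp_factorThru (t ≫ σ.r) i
    refine ⟨⟨b ≫ σ.s + Injective.factorThru (t ≫ σ.r) i ≫ kernel.ι p, ?_, ?_⟩⟩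
    · rw [Preadditive.comp_add, reassoc_of% h3, ← reassoc_of% sq.w, ← Preadditive.comp_add,
        add_comm, h2, Category.comp_id]
    · rw [Preadditive.add_comp, Category.assoc, Category.assoc, h1, kernel.condition, comp_zero,
        add_zero, Category.comp_id]

variable (A) in
/-- The model structure on complexes in a semisimple abelian category: the weak equivalences are
the quasi-isomorphisms, the cofibrations are the monomorphisms, the fibrations are the
epimorphisms. -/
@[reducible]
def modelCategory : ModelCategory (Ch A) where
  categoryWithWeakEquivalences := ⟨HomologicalComplex.quasiIso A _⟩
  categoryWithCofibrations := ⟨.monomorphisms _⟩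
  categoryWithFibrations := ⟨.epimorphisms _⟩
  cm2 := (inferInstance : (HomologicalComplex.quasiIso A _).HasTwoOutOfThreeProperty)
  cm3a := (inferInstance : (HomologicalComplex.quasiIso A _).IsStableUnderRetracts)
  cm3b := (inferInstance : (MorphismProperty.epimorphisms _).IsStableUnderRetracts)
  cm3c := (inferInstance : (MorphismProperty.monomorphisms _).IsStableUnderRetracts)
  cm4a i p h1 h2 h3 :=
    @hasLift_of_quasiIso_left _ _ _ _ _ _ _ _ _ i p h1.mem h2.mem h3.mem
  cm4b i p h1 h2 h3 :=
    @hasLift_of_quasiIso_right _ _ _ _ _ _ _ _ _ i p h1.mem h3.mem h2.mem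
  -- Both factorizations add a contractible summand: a disc complex mapping onto Y makes the second
  -- map epi, and one containing X makes the first map mono. The inclusion of X, respectively the
  -- projection to Y, is then a homotopy equivalence.
  cm5a := ⟨fun {X Y} f => ⟨
    { Z := X ⊞ pathComplex Y
      i := biprod.inl
      p := biprod.desc f (pathProj Y)
      fac := biprod.inl_desc _ _
      hi := ⟨(inferInstance : Mono (biprod.inl : X ⟶ X ⊞ pathComplex Y)),
        (quasiIso_inl X (discHomotopy _ _ _) :
          QuasiIso (biprod.inl : X ⟶ X ⊞ pathComplex Y))⟩
      hp := (epi_of_epi_fac (biprod.inr_desc f (pathProj Y)) :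
        Epi (biprod.desc f (pathProj Y))) }⟩⟩
  cm5b := ⟨fun {X Y} f => ⟨
    { Z := Y ⊞ coneComplex X
      i := biprod.lift f (coneIncl X)
      p := biprod.fst
      fac := biprod.lift_fst _ _
      hi := (mono_of_mono_fac (biprod.lift_snd f (coneIncl X)) :
        Mono (biprod.lift f (coneIncl X)))
      hp := ⟨(inferInstance : Epi (biprod.fst : Y ⊞ coneComplex X ⟶ Y)),
        (quasiIso_fst Y (discHomotopy _ _ _) :
          QuasiIso (biprod.fst : Y ⊞ coneComplex X ⟶ Y))⟩ }⟩⟩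

end Model

end Semisimple

end RatG
end


noncomputable section

namespace RatG

/-! ### Model structures with monomorphisms and epimorphisms -/

section Generators

universe v u

open MorphismProperty IsGrothendieckAbelian ZeroObject

variable {C : Type u} [Category.{v} C] [Abelian C] [IsGrothendieckAbelian.{v} C]

/-- The inclusion of the zero object into `P`. -/
abbrev zeroTo (P : C) : MorphismProperty C := .ofHoms fun _ : PUnit.{v + 1} => (0 : 0 ⟶ P)

/-- Only the domain 0 has to be small. Transfinite compositions of cell attachments along 0 → P
consist of monomorphisms, and Hom(0, -) commutes with chains of monomorphisms of length κ once the
regular cardinal κ exceeds the number of subobjects of 0. -/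
instance (P : C) : HasSmallObjectArgument.{v} (zeroTo P) := by
  obtain ⟨κ, hκ', hκ⟩ := HasCardinalLT.exists_regular_cardinal.{v} (Subobject (0 : C))
  have : Fact κ.IsRegular := ⟨hκ'⟩
  have : Nonempty κ.ord.ToType := by simpa using hκ'.ne_zero
  have := WellFoundedLT.toOrderBot κ.ord.ToType
  have : IsSmall.{v} (zeroTo P) := isSmall_ofHoms _
  exact ⟨κ, inferInstance, inferInstance,
    { preservesColimit {A B X Y} i hi f hf := by
        let hf' : (monomorphisms C).TransfiniteCompositionOfShape κ.ord.ToType f :=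
          { toTransfiniteCompositionOfShape := hf.toTransfiniteCompositionOfShape
            map_mem j hj := by
              have := (hf.attachCells j hj).pushouts_coproducts
              simp only [ofHoms_homFamily] at this
              refine (?_ : _ ≤ monomorphisms C) _ this
              simp only [pushouts_le_iff, coproducts_le_iff]
              rintro _ _ _ ⟨_⟩
              exact (inferInstance : Mono (0 : 0 ⟶ P)) }
        have (j j' : κ.ord.ToType) (φ : j ⟶ j') : Mono (hf'.F.map φ) := hf'.mem_map φ
        apply preservesColimit_coyoneda_obj_of_mono (Y := hf'.F) (κ := κ)
        obtain ⟨⟩ := hi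
        exact hκ }⟩

/-- Lifting against 0 → P means that every map from P lifts through f. A separator detects
epimorphisms this way, and projectivity gives the converse. -/
lemma zeroTo_rlp {P : C} [Projective P] (hP : IsSeparator P) :
    (zeroTo P).rlp = epimorphisms C := by
  apply le_antisymm
  · intro X Y f hf
    refine Preadditive.epi_of_cancel_zero f fun {Z} g hg => ?_
    refine (Preadditive.isSeparator_iff P).1 hP g fun t => ?_
    have := hf (0 : 0 ⟶ P) ⟨PUnit.unit⟩
    have sq : CommSq (0 : 0 ⟶ X) (0 : 0 ⟶ P) f t := ⟨by simp⟩
    rw [← sq.fac_right, Category.assoc, hg, comp_zero]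
  · rintro X Y f (hf : Epi f) _ _ _ ⟨_⟩
    exact ⟨fun {t b} sq => ⟨⟨⟨Projective.factorThru b f, (isZero_zero C).eq_of_src _ _,
      Projective.factorThru_comp _ _⟩⟩⟩⟩

/-- A projective object mapping onto a separator is itself a separator. -/
lemma exists_projective_separator [EnoughProjectives C] :
    ∃ P : C, Projective P ∧ IsSeparator P := by
  refine ⟨Projective.over (separator C), inferInstance, ?_⟩
  rw [Preadditive.isSeparator_iff]
  intro X Y f hf
  refine (Preadditive.isSeparator_iff _).1 (isSeparator_separator C) f fun t => ?_
  rw [← cancel_epi (Projective.π (separator C)), comp_zero, ← Category.assoc]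
  exact hf _

/-- The subobject inclusions of a separator generate the monomorphisms, so they detect trivial
fibrations; the single map 0 → P, with P a projective separator, detects fibrations. -/
lemma exists_generators [EnoughProjectives C] [ModelCategory C]
    (hcof : cofibrations C = monomorphisms C) (hfib : fibrations C = epimorphisms C) :
    ∃ I J : MorphismProperty C, HasSmallObjectArgument.{v} I ∧ HasSmallObjectArgument.{v} J ∧
      trivialFibrations C = I.rlp ∧ fibrations C = J.rlp := by
  obtain ⟨P, _, hP⟩ := exists_projective_separator (C := C)
  refine ⟨generatingMonomorphisms (separator C), zeroTo P, inferInstance, inferInstance, ?_, ?_⟩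
  · rw [generatingMonomorphisms_rlp (isSeparator_separator C), ← hcof, cofibrations_rlp]
  · rw [zeroTo_rlp hP, hfib]

end Generators

/-! ### Pushout products of monomorphisms. -/

section PushoutProduct

variable {C : Type*} [Category* C] [Abelian C] [MonoidalCategory C]
  [∀ X : C, (tensorRight X).IsLeftAdjoint]
  (hmono : ∀ (Z : C) {X Y : C} (f : X ⟶ Y) [Mono f], Mono (Z ◁ f))
  (hmono' : ∀ (Z : C) {X Y : C} (f : X ⟶ Y) [Mono f], Mono (f ▷ Z))

include hmono hmono' in
-- The pushout P is an extension of coker f ⊗ X by A ⊗ Y: `inr` is a pushout of the mono f ▷ X, and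
-- tensoring is right exact. The map φ compares it with A ⊗ Y → B ⊗ Y → coker f ⊗ Y, and coker f ◁ g
-- is mono on the quotients. So anything killed by φ dies in the quotient, comes from A ⊗ Y, and
-- vanishes because f ▷ Y is mono.
lemma mono_pushoutProduct {A B X Y P : C} (f : A ⟶ B) (g : X ⟶ Y) [Mono f] [Mono g]
    {inl : B ⊗ X ⟶ P} {inr : A ⊗ Y ⟶ P} (h : IsPushout (f ▷ X) (A ◁ g) inl inr)
    (φ : P ⟶ B ⊗ Y) (h₁ : inl ≫ φ = B ◁ g) (h₂ : inr ≫ φ = f ▷ Y) : Mono φ := by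
  have := hmono' X f
  have := hmono' Y f
  have := hmono (cokernel f) g
  have : Mono inr := MorphismProperty.of_isPushout (P := .monomorphisms C) h.flip
    (inferInstanceAs (Mono (f ▷ X)))
  have hc : f ▷ X ≫ cokernel.π f ▷ X = 0 := by
    rw [← comp_whiskerRight, cokernel.condition]
    exact (tensorRight X).map_zero _ _
  have hc' : f ▷ Y ≫ cokernel.π f ▷ Y = 0 := by
    rw [← comp_whiskerRight, cokernel.condition]
    exact (tensorRight Y).map_zero _ _
  let hcol : IsColimit (CokernelCofork.ofπ (f := f ▷ X) (cokernel.π f ▷ X) hc) :=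
    CokernelCofork.mapIsColimit _ (cokernelIsCokernel f) (tensorRight X)
  let q : P ⟶ cokernel f ⊗ X := h.desc (cokernel.π f ▷ X) 0 (by rw [hc, comp_zero])
  have hq₁ : inl ≫ q = cokernel.π f ▷ X := h.inl_desc _ _ _
  have hq₂ : inr ≫ q = 0 := h.inr_desc _ _ _
  have : Epi (cokernel.π f ▷ X) := (inferInstance : Epi ((tensorRight X).map (cokernel.π f)))
  let hq : IsColimit (CokernelCofork.ofπ (f := inr) q hq₂) :=
    CokernelCofork.IsColimit.ofπ _ _
      (fun {Z} u hu => hcol.desc (CokernelCofork.ofπ (inl ≫ u)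
        (by rw [h.w_assoc, hu, comp_zero])))
      (fun {Z} u hu => h.hom_ext
        (by
          rw [← Category.assoc, hq₁]
          exact hcol.fac _ WalkingParallelPair.one)
        (by rw [← Category.assoc, hq₂, zero_comp, hu]))
      (fun {Z} u hu m hm => by
        rw [← cancel_epi (cokernel.π f ▷ X)]
        refine Eq.trans ?_ (hcol.fac (CokernelCofork.ofπ (inl ≫ u)
          (by rw [h.w_assoc, hu, comp_zero])) WalkingParallelPair.one).symm
        rw [← hq₁, Category.assoc, hm]
        rfl)
  have hk := Abelian.monoIsKernelOfCokernel _ hq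
  have hφ : q ≫ cokernel f ◁ g = φ ≫ cokernel.π f ▷ Y := by
    apply h.hom_ext
    · rw [← Category.assoc, hq₁, ← Category.assoc, h₁, whisker_exchange]
    · rw [← Category.assoc, hq₂, ← Category.assoc, h₂, zero_comp, hc']
  refine Preadditive.mono_of_cancel_zero φ fun {K} k hk0 => ?_
  have hkq : k ≫ q = 0 := by
    rw [← cancel_mono (cokernel f ◁ g), Category.assoc, hφ, ← Category.assoc, hk0, zero_comp,
      zero_comp]
  have hl : hk.lift (KernelFork.ofι k hkq) ≫ inr = k := hk.fac _ WalkingParallelPair.zero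
  rw [← hl, Category.assoc, h₂, ← zero_comp (f := f ▷ Y), cancel_mono] at hk0
  rw [← hl, hk0, zero_comp]

end PushoutProduct

/-! ### Monoidal model axioms when every tensor functor preserves monomorphisms and weak
equivalences. -/

section MonoidalModel

universe v u

variable {C : Type u} [Category.{v} C] [Abelian C] [IsGrothendieckAbelian.{v} C]
  [EnoughProjectives C] [ModelCategory C] [MonoidalCategory C] [SymmetricCategory C]

lemma whiskerRight_eq_braiding (Z : C) {X Y : C} (f : X ⟶ Y) :
    f ▷ Z = (β_ X Z).hom ≫ Z ◁ f ≫ (β_ Z Y).hom := by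
  rw [← Category.assoc, ← BraidedCategory.braiding_naturality_left, Category.assoc,
    SymmetricCategory.symmetry, Category.comp_id]

/-- The maps Z ⊗ f are themselves trivial cofibrations, for arbitrary Z. Trivial cofibrations are
given by a left lifting property, hence are closed under pushouts and transfinite compositions. -/
lemma monoidAxiom
    (hcof : cofibrations C = .monomorphisms C)
    (hmono : ∀ (Z : C) {X Y : C} (f : X ⟶ Y) [Mono f], Mono (Z ◁ f))
    (hweq : ∀ (Z : C) {X Y : C} (f : X ⟶ Y) [WeakEquivalence f], WeakEquivalence (Z ◁ f)) :
    MonoidAxiom C := by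
  have h : TensorTrivialCofibration C ≤ trivialCofibrations C := by
    rintro _ _ _ ⟨Z, f, h₁, h₂⟩
    rw [hcof] at h₁
    have : Mono f := h₁
    have := hmono Z f
    rw [← weakEquivalence_iff] at h₂
    refine ⟨?_, ?_⟩
    · rwa [hcof]
    · exact (hweq Z f).mem
  have h' : (TensorTrivialCofibration C).pushouts ≤ trivialCofibrations C := by
    rwa [MorphismProperty.pushouts_le_iff]
  rw [← fibrations_llp] at h'
  have h'' : MorphismProperty.transfiniteCompositions.{v}
      (MorphismProperty.pushouts (TensorTrivialCofibration C)) ≤ trivialCofibrations C := by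
    rw [← fibrations_llp]
    intro X Y f hf
    have := MorphismProperty.transfiniteCompositions_monotone h' f hf
    exact MorphismProperty.transfiniteCompositions_le _ _ this
  exact h''.trans fun _ _ _ hf => hf.2

lemma isSymmetricMonoidalModel
    (hcof : cofibrations C = .monomorphisms C) (hfib : fibrations C = .epimorphisms C)
    (hclosed : Nonempty (MonoidalClosed C))
    (hmono : ∀ (Z : C) {X Y : C} (f : X ⟶ Y) [Mono f], Mono (Z ◁ f))
    (hweq : ∀ (Z : C) {X Y : C} (f : X ⟶ Y) [WeakEquivalence f], WeakEquivalence (Z ◁ f)) :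
    IsSymmetricMonoidalModel C := by
  obtain ⟨_⟩ := hclosed
  have (X : C) : (tensorRight X).IsLeftAdjoint :=
    Functor.isLeftAdjoint_of_iso (BraidedCategory.tensorLeftIsoTensorRight X)
  have hmono' (Z : C) {X Y : C} (f : X ⟶ Y) [Mono f] : Mono (f ▷ Z) := by
    have := hmono Z f
    rw [whiskerRight_eq_braiding]
    exact inferInstance
  have hweq' (Z : C) {X Y : C} (f : X ⟶ Y) [WeakEquivalence f] : WeakEquivalence (f ▷ Z) := by
    have := hweq Z f
    rw [whiskerRight_eq_braiding]
    infer_instance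
  have hco {X Y : C} (f : X ⟶ Y) : Cofibration f ↔ Mono f := by
    rw [cofibration_iff, hcof, MorphismProperty.monomorphisms.iff]
  have hpp {A B X Y : C} (f : A ⟶ B) (g : X ⟶ Y) :=
    IsPushout.of_hasPushout (f ▷ X) (A ◁ g)
  -- A pushout of the trivial cofibration g is a weak equivalence, so the corner map φ is one by two
  -- out of three. Applied to the pushout square or its flip, this settles both acyclic cases of the
  -- pushout product axiom.
  have hw {R S T P Q : C} {f : R ⟶ S} {g : R ⟶ T} {inl : S ⟶ P} {inr : T ⟶ P}
      (h : IsPushout f g inl inr) (φ : P ⟶ Q) {u : S ⟶ Q} (hu : inl ≫ φ = u) [Cofibration g]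
      [WeakEquivalence g] [WeakEquivalence u] : WeakEquivalence φ := by
    have : WeakEquivalence inl := by
      rw [weakEquivalence_iff]
      exact (MorphismProperty.of_isPushout h (mem_trivialCofibrations g)).2
    exact weakEquivalence_of_precomp_of_fac hu
  have hl {A B X Y : C} (f : A ⟶ B) (g : X ⟶ Y) : pushout.inl (f ▷ X) (A ◁ g) ≫
      ((Arrow.pushoutProduct.obj (Arrow.mk f)).obj (Arrow.mk g)).hom = B ◁ g :=
    pushout.inl_desc _ _ _
  have hr {A B X Y : C} (f : A ⟶ B) (g : X ⟶ Y) : pushout.inr (f ▷ X) (A ◁ g) ≫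
      ((Arrow.pushoutProduct.obj (Arrow.mk f)).obj (Arrow.mk g)).hom = f ▷ Y :=
    pushout.inr_desc _ _ _
  exact
    { hasLimits := inferInstance
      hasColimits := inferInstance
      cofibrantlyGenerated := exists_generators hcof hfib
      closed := ⟨‹_›⟩
      pushoutProduct f g hf hg := by
        rw [hco] at hf hg ⊢
        exact mono_pushoutProduct hmono hmono' f g (hpp f g) _ (hl f g) (hr f g)
      pushoutProduct_left {A B X Y} f g hf hg _ := by
        have h₁ := hweq' X f
        have h₂ := hweq' Y f
        have h₃ : Cofibration (f ▷ X) := by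
          rw [hco] at hf ⊢
          exact hmono' X f
        exact @hw _ _ _ _ _ _ _ _ _ (hpp f g).flip _ (f ▷ Y) (hr f g) h₃ h₁ h₂
      pushoutProduct_right {A B X Y} f g hf hg _ := by
        have h₁ := hweq A g
        have h₂ := hweq B g
        have h₃ : Cofibration (A ◁ g) := by
          rw [hco] at hg ⊢
          exact hmono A g
        exact @hw _ _ _ _ _ _ _ _ _ (hpp f g) _ (B ◁ g) (hl f g) h₃ h₁ h₂
      unit q _ _ _ := hweq _ q }

end MonoidalModel

end RatG
end


noncomputable section

namespace RatG

/-! ### Quasi-isomorphisms are homotopy equivalences. -/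

namespace Semisimple

open ZeroObject

variable {A : Type*} [Category* A] [Abelian A] [∀ X : A, Projective X] [∀ X : A, Injective X]

/-- Lifting against X → 0 gives a retraction r. The map 1 - r ≫ i vanishes on X, so it factors
through the contractible cokernel and is null-homotopic. -/
lemma exists_homotopyInverse_of_mono {X Y : Ch A} (i : X ⟶ Y) [Mono i] [QuasiIso i] :
    ∃ r : Y ⟶ X, i ≫ r = 𝟙 X ∧ Nonempty (Homotopy (r ≫ i) (𝟙 Y)) := by
  have hC := acyclic_cokernel i
  obtain ⟨h⟩ := contractible_of_acyclic hC
  have sq : CommSq (𝟙 X) i (0 : X ⟶ 0) (0 : Y ⟶ 0) := ⟨by simp⟩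
  have := hasLift_of_quasiIso_left i (0 : X ⟶ 0)
  refine ⟨sq.lift, sq.fac_left, ?_⟩
  have hs : i ≫ (𝟙 Y - sq.lift ≫ i) = 0 := by
    rw [Preadditive.comp_sub, ← Category.assoc, sq.fac_left, Category.comp_id, Category.id_comp,
      sub_self]
  have h₁ : Homotopy (𝟙 Y - sq.lift ≫ i) 0 :=
    ((Homotopy.ofEq (by simp)).trans
      ((h.compRight (cokernel.desc i _ hs)).compLeft (cokernel.π i))).trans
      (Homotopy.ofEq (by simp))
  exact ⟨(Homotopy.equivSubZero.symm h₁).symm⟩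

/-- Factor f as a mono into Y ⊞ `coneComplex X` followed by the projection, which discards a
contractible summand. The mono is then a quasi-isomorphism and the previous lemma applies. This
replaces exactness arguments for tensor and Hom functors: additivity suffices. -/
lemma exists_homotopyEquiv_of_quasiIso {X Y : Ch A} (f : X ⟶ Y) [QuasiIso f] :
    ∃ e : HomotopyEquiv X Y, e.hom = f := by
  let i : X ⟶ Y ⊞ coneComplex X := biprod.lift f (coneIncl X)
  have hi : i ≫ biprod.fst = f := biprod.lift_fst _ _
  have : Mono i := by
    have : Mono (i ≫ biprod.snd) := by rw [biprod.lift_snd]; infer_instance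
    exact mono_of_mono i biprod.snd
  have : QuasiIso (biprod.fst : Y ⊞ coneComplex X ⟶ Y) := quasiIso_fst Y (discHomotopy _ _ _)
  have : QuasiIso (i ≫ (biprod.fst : Y ⊞ coneComplex X ⟶ Y)) := by rw [hi]; infer_instance
  have : QuasiIso i := quasiIso_of_comp_right i (biprod.fst : Y ⊞ coneComplex X ⟶ Y)
  obtain ⟨r, hr, ⟨H⟩⟩ := exists_homotopyInverse_of_mono i
  let H' : Homotopy (𝟙 (coneComplex X)) 0 := discHomotopy _ _ _
  let H'' : Homotopy (biprod.fst ≫ biprod.inl) (𝟙 (Y ⊞ coneComplex X)) :=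
    (Homotopy.ofEq (by simp)).trans ((Homotopy.add (Homotopy.refl (biprod.fst ≫ biprod.inl))
      ((H'.compRight biprod.inr).compLeft biprod.snd).symm).trans
        (Homotopy.ofEq (by simp [biprod.total])))
  let e₁ : HomotopyEquiv X (Y ⊞ coneComplex X) :=
    { hom := i, inv := r, homotopyHomInvId := Homotopy.ofEq hr, homotopyInvHomId := H }
  let e₂ : HomotopyEquiv (Y ⊞ coneComplex X) Y :=
    { hom := biprod.fst
      inv := biprod.inl
      homotopyHomInvId := H''
      homotopyInvHomId := Homotopy.ofEq biprod.inl_fst }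
  exact ⟨e₁.trans e₂, hi⟩

end Semisimple

/-! ### The tensor product of complexes of representations and its model structure. -/

section Tensor

variable {W : Type} [Group W]

/-- The inclusion of the summand `X i ⊗ Y j` of `(X ⊗ Y) k`. -/
def tι (X Y : ChRep W) (i j k : ℤ) (h : i + j = k) : X.X i ⊗ Y.X j ⟶ (X ⊗ Y).X k :=
  HomologicalComplex.ιTensorObj X Y i j k h

/-- The map out of `(X ⊗ Y) k` with given restrictions to the summands. -/
def tDesc {X Y : ChRep W} {k : ℤ} {T : Rep.{0} ℚ W}
    (φ : ∀ i j : ℤ, i + j = k → (X.X i ⊗ Y.X j ⟶ T)) : (X ⊗ Y).X k ⟶ T :=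
  HomologicalComplex.mapBifunctorDesc φ

lemma tι_desc {X Y : ChRep W} {k : ℤ} {T : Rep.{0} ℚ W}
    (φ : ∀ i j : ℤ, i + j = k → (X.X i ⊗ Y.X j ⟶ T)) (i j : ℤ) (h : i + j = k) :
    tι X Y i j k h ≫ tDesc φ = φ i j h :=
  HomologicalComplex.ι_mapBifunctorDesc _ _ _ _

lemma tensor_ext {X Y : ChRep W} {k : ℤ} {T : Rep.{0} ℚ W} {f g : (X ⊗ Y).X k ⟶ T}
    (H : ∀ i j h, tι X Y i j k h ≫ f = tι X Y i j k h ≫ g) : f = g :=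
  HomologicalComplex.mapBifunctor.hom_ext H

lemma tι_tensorHom {X X' Y Y' : ChRep W} (f : X ⟶ X') (g : Y ⟶ Y') (i j k : ℤ) (h : i + j = k) :
    tι X Y i j k h ≫ (f ⊗ₘ g).f k = (f.f i ⊗ₘ g.f j) ≫ tι X' Y' i j k h := by
  refine (HomologicalComplex.ι_mapBifunctorMap f g (curriedTensor (Rep.{0} ℚ W))
    (ComplexShape.down ℤ) i j k h).trans ?_
  rw [MonoidalCategory.tensorHom_def, Category.assoc]
  rfl

lemma tι_whiskerLeft (X : ChRep W) {Y Y' : ChRep W} (g : Y ⟶ Y') (i j k : ℤ) (h : i + j = k) :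
    tι X Y i j k h ≫ (X ◁ g).f k = X.X i ◁ g.f j ≫ tι X Y' i j k h := by
  rw [← MonoidalCategory.id_tensorHom, tι_tensorHom, HomologicalComplex.id_f,
    MonoidalCategory.id_tensorHom]

/-- Each f.f n splits because representations are injective. The retractions need not form a chain
map, but tensored summand by summand they retract each degree of Z ◁ f. -/
lemma mono_whiskerLeft [Finite W] (Z : ChRep W) {X Y : ChRep W} (f : X ⟶ Y) [Mono f] :
    Mono (Z ◁ f) := by
  have (n : ℤ) : IsSplitMono (f.f n) :=
    ⟨⟨⟨Injective.factorThru (𝟙 _) (f.f n), Injective.comp_factorThru _ _⟩⟩⟩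
  refine HomologicalComplex.mono_of_mono_f _ fun k => ?_
  have : (Z ◁ f).f k ≫ tDesc (fun i j h => Z.X i ◁ retraction (f.f j) ≫ tι Z X i j k h) =
      𝟙 _ := by
    refine tensor_ext fun i j h => ?_
    rw [← Category.assoc, tι_whiskerLeft, Category.assoc, tι_desc, ← Category.assoc,
      ← MonoidalCategory.whiskerLeft_comp, IsSplitMono.id, MonoidalCategory.whiskerLeft_id,
      Category.id_comp, Category.comp_id]
  exact mono_of_mono_fac this

/-- Tensoring with a complex preserves homotopies. -/
def whiskerLeftHomotopy (Z : ChRep W) {X Y : ChRep W} {f g : X ⟶ Y} (h : Homotopy f g) :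
    Homotopy (Z ◁ f) (Z ◁ g) :=
  HomologicalComplex.mapBifunctorMapHomotopy₂ (𝟙 Z) h (curriedTensor (Rep.{0} ℚ W))
    (ComplexShape.down ℤ)

lemma quasiIso_whiskerLeft [Finite W] (Z : ChRep W) {X Y : ChRep W} (f : X ⟶ Y) [QuasiIso f] :
    QuasiIso (Z ◁ f) := by
  obtain ⟨e, rfl⟩ := Semisimple.exists_homotopyEquiv_of_quasiIso f
  let e' : HomotopyEquiv (Z ⊗ X) (Z ⊗ Y) :=
    { hom := Z ◁ e.hom
      inv := Z ◁ e.inv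
      homotopyHomInvId := ((Homotopy.ofEq (MonoidalCategory.whiskerLeft_comp _ _ _).symm).trans
        (whiskerLeftHomotopy Z e.homotopyHomInvId)).trans
          (Homotopy.ofEq (MonoidalCategory.whiskerLeft_id _ _))
      homotopyInvHomId := ((Homotopy.ofEq (MonoidalCategory.whiskerLeft_comp _ _ _).symm).trans
        (whiskerLeftHomotopy Z e.homotopyInvHomId)).trans
          (Homotopy.ofEq (MonoidalCategory.whiskerLeft_id _ _)) }
  exact e'.quasiIso_hom

/-- Colimits of complexes are detected degreewise, and degree k of Z ⊗ X is the sum of the Z i ⊗ X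
j. Each summand preserves colimits in X, so a cocone descends summand by summand. -/
instance preservesColimits_tensorLeft (Z : ChRep W) : PreservesColimits (tensorLeft Z) where
  preservesColimitsOfShape {J _} := by
    refine HomologicalComplex.preservesColimitsOfShape_of_eval _ fun k => ⟨fun {K} => ⟨fun {c} hc =>
      ⟨?_⟩⟩⟩
    have hc' (i j : ℤ) := isColimitOfPreserves (HomologicalComplex.eval (Rep.{0} ℚ W)
      (ComplexShape.down ℤ) j ⋙ tensorLeft (Z.X i)) hc
    let leg (s : Cocone (K ⋙ tensorLeft Z ⋙ HomologicalComplex.eval (Rep.{0} ℚ W)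
        (ComplexShape.down ℤ) k)) (i j : ℤ) (h : i + j = k) :
        Cocone (K ⋙ HomologicalComplex.eval (Rep.{0} ℚ W) (ComplexShape.down ℤ) j ⋙
          tensorLeft (Z.X i)) :=
      { pt := s.pt
        ι :=
          { app := fun a => tι Z (K.obj a) i j k h ≫ s.ι.app a
            naturality := fun a b u => by
              have := s.w u
              refine Eq.trans ?_ ((congrArg (tι Z (K.obj a) i j k h ≫ ·) this).trans
                (Category.comp_id _).symm)
              refine Eq.trans ?_ (Category.assoc _ _ _)
              exact (Category.assoc _ _ _).symm.trans
                (congrArg (· ≫ s.ι.app b) (tι_whiskerLeft Z (K.map u) i j k h).symm) } }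
    exact
      { desc := fun s => tDesc fun i j h => (hc' i j).desc (leg s i j h)
        fac := fun s a => by
          refine tensor_ext fun i j h => ?_
          refine (Category.assoc _ _ _).symm.trans
            ((congrArg (· ≫ _) (tι_whiskerLeft Z (c.ι.app a) i j k h)).trans ?_)
          refine (Category.assoc _ _ _).trans ((congrArg (Z.X i ◁ (c.ι.app a).f j ≫ ·)
            (tι_desc (fun i j h => (hc' i j).desc (leg s i j h)) i j h)).trans ?_)
          exact (hc' i j).fac (leg s i j h) a
        uniq := fun s m hm => by
          refine tensor_ext fun i j h => ?_
          refine Eq.trans ?_ (tι_desc (fun i j h => (hc' i j).desc (leg s i j h)) i j h).symm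
          refine (hc' i j).uniq (leg s i j h) (tι Z c.pt i j k h ≫ m) fun a => ?_
          refine Eq.trans ?_ (congrArg (tι Z (K.obj a) i j k h ≫ ·) (hm a))
          refine (Category.assoc _ _ _).symm.trans ((congrArg (· ≫ m)
            (tι_whiskerLeft Z (c.ι.app a) i j k h).symm).trans (Category.assoc _ _ _)) }

instance : IsGrothendieckAbelian.{0} (Rep.{0} ℚ W) :=
  IsGrothendieckAbelian.of_equivalence Rep.equivalenceModuleMonoidAlgebra.symm

instance : IsGrothendieckAbelian.{0} (ChRep W) := inferInstance

/-- The internal Hom comes from the adjoint functor theorem: Z ⊗ - preserves colimits and complexes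
have a separator. -/
lemma nonempty_monoidalClosed : Nonempty (MonoidalClosed (ChRep W)) := by
  have (Z : ChRep W) : (tensorLeft Z).IsLeftAdjoint :=
    isLeftAdjoint_of_preservesColimits_of_isSeparating (isSeparator_separator (ChRep W)) _
  exact ⟨⟨fun Z => ⟨(tensorLeft Z).rightAdjoint, Adjunction.ofIsLeftAdjoint _⟩⟩⟩

variable [Finite W]

variable (W) in
/-- The projective model structure on complexes of representations. -/
@[reducible]
def repModel : ModelCategory (ChRep W) := Semisimple.modelCategory (Rep.{0} ℚ W)

variable (W) in
lemma repModel_isProjectiveModel : letI := repModel W; IsProjectiveModel W := by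
  let _ := repModel W
  refine ⟨fun f => ?_, fun f => ?_⟩
  · rw [weakEquivalence_iff]
    rfl
  · rw [fibration_iff]
    change Epi f ↔ _
    simp only [← Rep.epi_iff_surjective]
    exact ⟨fun _ n => inferInstance, fun _ => HomologicalComplex.epi_of_epi_f f inferInstance⟩

variable (W) in
lemma repModel_isSymmetricMonoidalModel :
    letI := repModel W; IsSymmetricMonoidalModel (ChRep W) := by
  let _ := repModel W
  refine isSymmetricMonoidalModel rfl rfl nonempty_monoidalClosed
    (fun Z _ _ f _ => mono_whiskerLeft Z f) fun Z X Y f hf => ?_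
  rw [(repModel_isProjectiveModel W).weakEquivalences_iff] at hf ⊢
  exact quasiIso_whiskerLeft Z f

variable (W) in
lemma repModel_monoidAxiom : letI := repModel W; MonoidAxiom (ChRep W) := by
  let _ := repModel W
  refine monoidAxiom rfl
    (fun Z _ _ f _ => mono_whiskerLeft Z f) fun Z X Y f hf => ?_
  rw [(repModel_isProjectiveModel W).weakEquivalences_iff] at hf ⊢
  exact quasiIso_whiskerLeft Z f

end Tensor

end RatG
end


noncomputable section

namespace RatG

/-! ### Elements of Hom(ℚ(W^a), X) as equivariant functions on W^a, and the maps r_w and e_w. -/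

section Values

variable {W : Type} [Group W]

lemma inCell_outCell (a : ℕ) : inCell W a 0 ≫ outCell W a 0 = 𝟙 _ := by
  simp only [inCell, outCell]
  exact Iso.inv_hom_id _

lemma outCell_inCell (a : ℕ) : outCell W a 0 ≫ inCell W a 0 = 𝟙 _ := by
  simp only [inCell, outCell]
  exact Iso.hom_inv_id _

/-- The basis element of `ℚ(W^a)` given by `w`. -/
def δ {a : ℕ} (w : Fin a → W) : ((cell W a).X 0).V :=
  (inCell W a 0).hom (MonoidAlgebra.single w (1 : ℚ) : MonoidAlgebra ℚ (Fin a → W))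

lemma outCell_δ {a : ℕ} (w : Fin a → W) :
    (outCell W a 0).hom (δ w) = (MonoidAlgebra.single w (1 : ℚ) : MonoidAlgebra ℚ (Fin a → W)) :=
  congrArg (fun f : Rep.diagonal ℚ W a ⟶ Rep.diagonal ℚ W a =>
    f.hom (MonoidAlgebra.single w (1 : ℚ) : MonoidAlgebra ℚ (Fin a → W))) (inCell_outCell a)

lemma inCell_out {a : ℕ} (x : ((cell W a).X 0).V) :
    (inCell W a 0).hom ((outCell W a 0).hom x) = x :=
  congrArg (fun f : (cell W a).X 0 ⟶ (cell W a).X 0 => f.hom x) (outCell_inCell a)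

lemma ρ_δ {a : ℕ} (g : W) (w : Fin a → W) : ((cell W a).X 0).ρ g (δ w) = δ (g • w) := by
  have := (Rep.hom_comm_apply (inCell W a 0) g
    (MonoidAlgebra.single w (1 : ℚ) : MonoidAlgebra ℚ (Fin a → W))).symm
  refine this.trans (congrArg (inCell W a 0).hom ?_)
  exact Representation.ofMulAction_single _ _ _

/-- Linear maps out of `ℚ(W^a)` are determined on the basis. -/
lemma cell_lhom_ext {a : ℕ} {V : Type} [AddCommGroup V] [Module ℚ V]
    {f g : ((cell W a).X 0).V →ₗ[ℚ] V} (H : ∀ w, f (δ w) = g (δ w)) : f = g := by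
  have : f ∘ₗ (inCell W a 0).hom.toLinearMap = g ∘ₗ (inCell W a 0).hom.toLinearMap := by
    apply MonoidAlgebra.lhom_ext'
    intro w
    apply LinearMap.ext_ring
    exact H w
  refine LinearMap.ext fun x => ?_
  rw [← inCell_out x]
  exact LinearMap.congr_fun this _

lemma cell_subsingleton (a : ℕ) (k : ℤ) (hk : k ≠ 0) : Subsingleton ((cell W a).X k).V :=
  (Rep.isZero_iff ℚ W _).1 (HomologicalComplex.isZero_single_obj_X (ComplexShape.down ℤ) 0
    (Rep.diagonal ℚ W a) k hk)

variable {X Y : ChRep W}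

/-- The value at a basis element of a map out of `ℚ(W^a)`. -/
def val {a : ℕ} {n : ℤ} (f : fixedHom (cell W a) X n) (w : Fin a → W) : (X.X n).V :=
  ev f 0 n (zero_add n) (δ w)

lemma val_add {a : ℕ} {n : ℤ} (f f' : fixedHom (cell W a) X n) (w : Fin a → W) :
    val (f + f') w = val f w + val f' w := rfl

lemma val_smul {a : ℕ} {n : ℤ} (c : ℚ) (f : fixedHom (cell W a) X n) (w : Fin a → W) :
    val (c • f) w = c • val f w := rfl

variable (X) in
/-- `val` as a linear map. -/
def valₗ {a : ℕ} (n : ℤ) (w : Fin a → W) : fixedHom (cell W a) X n →ₗ[ℚ] (X.X n).V where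
  toFun f := val f w
  map_add' _ _ := rfl
  map_smul' _ _ := rfl

lemma val_sum {a : ℕ} {n : ℤ} {ι : Type*} (s : Finset ι) (f : ι → fixedHom (cell W a) X n)
    (w : Fin a → W) : val (∑ i ∈ s, f i) w = ∑ i ∈ s, val (f i) w :=
  map_sum (valₗ X n w) f s

lemma val_ρ {a : ℕ} {n : ℤ} (f : fixedHom (cell W a) X n) (g : W) (w : Fin a → W) :
    val f (g • w) = (X.X n).ρ g (val f w) := by
  rw [val, ← ρ_δ, ev_ρ]
  rfl

/-- The source complex is concentrated in degree zero, where W^a is a basis. Identities in the Hom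
complexes are checked on these values from here on. -/
lemma val_ext {a : ℕ} {n : ℤ} {f f' : fixedHom (cell W a) X n} (H : ∀ w, val f w = val f' w) :
    f = f' := by
  refine fixed_ext fun k l h x => ?_
  by_cases hk : k = 0
  · subst hk
    obtain rfl : n = l := by lia
    exact LinearMap.congr_fun (cell_lhom_ext H) x
  · have := cell_subsingleton (W := W) a k hk
    rw [Subsingleton.elim x 0, map_zero, map_zero]

variable (X) in
/-- The identification of `X n` with `X l` if `n = l`; zero otherwise. -/
def xcast (n l : ℤ) : X.X n ⟶ X.X l :=
  if h : n = l then (X.XIsoOfEq h).hom else 0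

lemma xcast_self (n : ℤ) : xcast X n n = 𝟙 _ := by simp [xcast]

/-- A map out of the representation `ℚ(W^a)` with given values on the basis. -/
def liftBase {a : ℕ} {V : Rep.{0} ℚ W} (v : (Fin a → W) → V.V)
    (hv : ∀ g w, v (g • w) = V.ρ g (v w)) : Rep.diagonal ℚ W a ⟶ V :=
  Rep.ofHom
    { toLinearMap := Finsupp.linearCombination ℚ v ∘ₗ
        (MonoidAlgebra.coeffLinearEquiv ℚ).toLinearMap
      isIntertwining' := fun g => by
        apply MonoidAlgebra.lhom_ext'
        intro w
        apply LinearMap.ext_ring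
        change Finsupp.linearCombination ℚ v ((MonoidAlgebra.coeffLinearEquiv ℚ)
          (Representation.ofMulAction ℚ W (Fin a → W) g (MonoidAlgebra.single w (1 : ℚ)))) =
          V.ρ g (Finsupp.linearCombination ℚ v (MonoidAlgebra.coeffLinearEquiv ℚ
            (MonoidAlgebra.single w (1 : ℚ))))
        rw [Representation.ofMulAction_single]
        simp [hv] }

lemma liftBase_single {a : ℕ} {V : Rep.{0} ℚ W} (v : (Fin a → W) → V.V)
    (hv : ∀ g w, v (g • w) = V.ρ g (v w)) (w : Fin a → W) :
    (liftBase v hv).hom (MonoidAlgebra.single w (1 : ℚ) : MonoidAlgebra ℚ (Fin a → W)) = v w := by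
  change Finsupp.linearCombination ℚ v (MonoidAlgebra.coeffLinearEquiv ℚ
    (MonoidAlgebra.single w (1 : ℚ))) = v w
  simp

/-- A map out of `ℚ(W^a)` with given values on the basis. -/
def mkVal {a : ℕ} {n : ℤ} (v : (Fin a → W) → (X.X n).V)
    (hv : ∀ g w, v (g • w) = (X.X n).ρ g (v w)) : fixedHom (cell W a) X n :=
  mkFixed (fun k l _ => (outCell W a k ≫ liftBase v hv ≫ xcast X n l).hom.toLinearMap)
    (fun k l _ g x => Rep.hom_comm_apply (outCell W a k ≫ liftBase v hv ≫ xcast X n l) g x)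

lemma val_mkVal {a : ℕ} {n : ℤ} (v : (Fin a → W) → (X.X n).V)
    (hv : ∀ g w, v (g • w) = (X.X n).ρ g (v w)) (w : Fin a → W) : val (mkVal v hv) w = v w := by
  change (xcast X n n).hom ((liftBase v hv).hom ((outCell W a 0).hom (δ w))) = v w
  rw [xcast_self, outCell_δ, liftBase_single]
  rfl

lemma dV_δ (a : ℕ) (k : ℤ) (x : ((cell W a).X 0).V) : dV (cell W a) 0 k x = 0 := by
  by_cases hk : k = 0
  · rw [dV_shape _ _ _ (by lia)]
    rfl
  · have := cell_subsingleton (W := W) a k hk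
    exact Subsingleton.elim _ _

/-- The source has zero differential, so the signed term of the Hom differential drops out. -/
lemma val_homD {a : ℕ} (i j : ℤ) (f : fixedHom (cell W a) X i) (w : Fin a → W) :
    val (homD (cell W a) X i j f) w = dV X i j (val f w) := by
  rw [val, ev_homD i j f 0 j (j - i) i (zero_add j) (zero_add i) (by lia), dV_δ, map_zero,
    smul_zero, sub_zero]
  rfl

lemma val_comp {a : ℕ} {n : ℤ} (z : fixedHom Y X n) (f : fixedHom (cell W a) Y 0)
    (w : Fin a → W) : val (compFixed n 0 n (add_zero n) z f) w = ev z 0 n (zero_add n) (val f w) :=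
  ev_compFixed n 0 n (add_zero n) z f 0 0 n _ (zero_add 0) (δ w)

lemma val_homOne (a : ℕ) (w : Fin a → W) : val (homOne (cell W a)) w = δ w :=
  ev_homOne 0 _ (δ w)

lemma val_homPost {a : ℕ} (u : X ⟶ Y) (n : ℤ) (f : fixedHom (cell W a) X n) (w : Fin a → W) :
    val (((homPost (cell W a) u).f n).hom f : fixedHom (cell W a) Y n) w =
      (u.f n).hom (val f w) := rfl

/-- Source and target both sit in degree zero. Hence 𝓔 is a category of rational vector spaces in
degree zero, and all its Koszul signs are trivial. -/
lemma cell_hom_eq_zero {a b : ℕ} {r : ℤ} (hr : r ≠ 0) (f : fixedHom (cell W a) (cell W b) r) :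
    f = 0 := by
  refine val_ext fun w => ?_
  have := cell_subsingleton (W := W) b r hr
  exact Subsingleton.elim _ _

/-- The map `ℚW ⟶ ℚ(W^a)`, `u ↦ u w`. -/
def rMap {a : ℕ} (w : Fin a → W) : fixedHom (cell W 1) (cell W a) 0 :=
  mkVal (fun u => δ (u 0 • w)) (fun g u => by rw [ρ_δ, smul_smul]; rfl)

lemma val_rMap {a : ℕ} (w : Fin a → W) (u : Fin 1 → W) : val (rMap w) u = δ (u 0 • w) :=
  val_mkVal _ _ _

/-- For a = 1 this makes g ↦ r_g reverse products, so a contravariant functor turns it into a left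
action of W on M(ℚW). -/
lemma rMap_comp_rMap {a : ℕ} (w : Fin a → W) (g : W) :
    compFixed 0 0 0 (add_zero 0) (rMap w) (rMap (fun _ : Fin 1 => g)) = rMap (g • w) := by
  refine val_ext fun u => ?_
  rw [val_comp, val_rMap, val_rMap]
  refine (val_rMap w _).trans ?_
  rw [smul_smul]
  rfl

lemma rMap_one : rMap (fun _ : Fin 1 => (1 : W)) = homOne (cell W 1) := by
  refine val_ext fun u => ?_
  rw [val_homOne, val_rMap]
  congr 1
  funext i
  obtain rfl := Subsingleton.elim i 0
  simp

lemma const_smul_zero {a : ℕ} (k : W) (w : Fin a → W) : (fun _ : Fin 1 => k) 0 • w = k • w := rfl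

variable (W) in
lemma card_ne_zero [Fintype W] : (Fintype.card W : ℚ) ≠ 0 :=
  Nat.cast_ne_zero.2 Fintype.card_ne_zero

open Classical in
/-- The map `ℚ(W^a) ⟶ ℚW` taking `v` to the sum of the `k` with `k w = v`. -/
def eMap [Finite W] {a : ℕ} (w : Fin a → W) : fixedHom (cell W a) (cell W 1) 0 :=
  letI := Fintype.ofFinite W
  mkVal (fun v => ∑ k : W, if k • w = v then δ (fun _ : Fin 1 => k) else 0) (fun g v => by
    rw [map_sum, ← Equiv.sum_comp (Equiv.mulLeft g)]
    refine Finset.sum_congr rfl fun k _ => ?_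
    rw [Equiv.coe_mulLeft, mul_smul]
    by_cases h : k • w = v
    · rw [if_pos h, if_pos (by rw [h]), ρ_δ]
      rfl
    · rw [if_neg h, if_neg (by rwa [smul_left_cancel_iff]), map_zero])

open Classical in
lemma val_eMap [Fintype W] {a : ℕ} (w v : Fin a → W) :
    val (eMap w) v = ∑ k : W, if k • w = v then δ (fun _ : Fin 1 => k) else 0 := by
  refine (val_mkVal _ _ _).trans ?_
  congr!

open Classical in
/-- Averaging over pairs `(w, k)` with `k w = v`. -/
lemma sum_smul_eq [Fintype W] {a : ℕ} {V : Type*} [AddCommGroup V] [Module ℚ V] (x : V)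
    (v : Fin a → W) :
    (Fintype.card W : ℚ)⁻¹ • ∑ w : Fin a → W, ∑ k : W, (if k • w = v then x else 0) = x := by
  rw [Finset.sum_comm]
  have (k : W) : ∑ w : Fin a → W, (if k • w = v then x else 0) = x := by
    rw [Finset.sum_eq_single (k⁻¹ • v)]
    · rw [smul_inv_smul, if_pos rfl]
    · intro w _ hw
      rw [if_neg]
      rintro rfl
      exact hw (inv_smul_smul k w).symm
    · simp
  simp only [this, Finset.sum_const, Finset.card_univ, ← Nat.cast_smul_eq_nsmul ℚ, smul_smul,
    inv_mul_cancel₀ (card_ne_zero W), one_smul]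

/-- The identity of `ℚ(W^a)` factors through a power of `ℚW`. -/
lemma homOne_eq_sum [Fintype W] (a : ℕ) : homOne (cell W a) =
    (Fintype.card W : ℚ)⁻¹ • ∑ w : Fin a → W, compFixed 0 0 0 (add_zero 0) (rMap w) (eMap w) := by
  classical
  refine val_ext fun v => ?_
  rw [val_homOne, val_smul, val_sum]
  refine (sum_smul_eq (δ v) v).symm.trans (congrArg _ (Finset.sum_congr rfl fun w _ => ?_))
  rw [val_comp, val_eMap, map_sum]
  refine Finset.sum_congr rfl fun k _ => ?_
  split_ifs with h
  · refine Eq.trans ?_ (val_rMap w (fun _ => k)).symm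
    rw [const_smul_zero, h]
  · rw [map_zero]

open Classical in
-- At u both sides sum the elements k with k w = u v, after the substitution k ↦ u k. The action on
-- W^a is free for a > 0, so at most one term survives; for a = 0 all of them do.
lemma eMap_comp_rMap [Fintype W] {a : ℕ} (w v : Fin a → W) :
    compFixed 0 0 0 (add_zero 0) (eMap w) (rMap v) =
      ∑ k : W, if k • w = v then rMap (fun _ : Fin 1 => k) else 0 := by
  refine val_ext fun u => ?_
  rw [val_comp, val_rMap, val_sum]
  refine (val_eMap w (u 0 • v)).trans ?_
  rw [← Equiv.sum_comp (Equiv.mulLeft (u 0))]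
  refine Finset.sum_congr rfl fun k _ => ?_
  rw [Equiv.coe_mulLeft, mul_smul]
  by_cases h : k • w = v
  · rw [if_pos h, if_pos (by rw [h]), val_rMap]
    rfl
  · rw [if_neg h, if_neg (by rwa [smul_left_cancel_iff])]
    rfl

end Values

end RatG
end


noncomputable section

namespace RatG

/-! ### Equality and isomorphism of right modules, elementwise. -/

section ModuleIso

variable {E : DGCategory}

lemma RightModule.hom_ext {M N : RightModule E} {f g : M ⟶ N}
    (H : ∀ a n x, ((f.app a).f n).hom x = ((g.app a).f n).hom x) : f = g := by
  refine RightModule.Hom.ext (funext fun a => ?_)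
  ext1 n
  ext1
  exact LinearMap.ext (H a n)

lemma RightModule.isIso_of_bijective {M N : RightModule E} (f : M ⟶ N)
    (hf : ∀ a n, Function.Bijective ((f.app a).f n).hom) : IsIso f := by
  have h₁ (a n) : IsIso ((f.app a).f n) := (ConcreteCategory.isIso_iff_bijective _).2 (hf a n)
  have h₂ (a) : IsIso (f.app a) := HomologicalComplex.Hom.isIso_of_components _
  have h₃ (a : E.obj) (n : ℤ) (x : (N.obj a).X n) :
      ((f.app a).f n).hom (((inv (f.app a)).f n).hom x) = x :=
    congrArg (fun φ : N.obj a ⟶ N.obj a => (φ.f n).hom x) (IsIso.inv_hom_id (f.app a))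
  let g : N ⟶ M :=
    { app := fun a => inv (f.app a)
      map_act := fun a b p q r h m e => by
        refine (hf a r).1 ?_
        rw [h₃, f.map_act]
        exact congrArg (fun y => (N.act a b).app p q r h y e) (h₃ b p m).symm }
  exact ⟨g, RightModule.Hom.ext (funext fun a => IsIso.hom_inv_id (f.app a)),
    RightModule.Hom.ext (funext fun a => IsIso.inv_hom_id (f.app a))⟩

end ModuleIso

/-! ### The Morita equivalence X ↦ Hom(𝒢, X). -/

section Action

variable {W : Type} [Group W]

/-- The action of maps of degree zero on a right module. -/
def mact (M : CellMod W) {a b : ℕ} (p : ℤ) :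
    fixedHom (cell W a) (cell W b) 0 →ₗ[ℚ] (M.obj b).X p →ₗ[ℚ] (M.obj a).X p :=
  ((M.act a b).app p 0 p (add_zero p)).flip

variable (M N : CellMod W)

lemma mact_one (a : ℕ) (p : ℤ) (m : (M.obj a).X p) : mact M p (homOne (cell W a)) m = m :=
  M.act_one a p m

lemma mact_mact {a b c : ℕ} (p : ℤ) (f : fixedHom (cell W b) (cell W c) 0)
    (g : fixedHom (cell W a) (cell W b) 0) (m : (M.obj c).X p) :
    mact M p g (mact M p f m) = mact M p (compFixed 0 0 0 (add_zero 0) f g) m :=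
  M.act_comp a b c p 0 0 p 0 p (add_zero p) (add_zero 0) (by lia) m f g

lemma homD_cell {a b : ℕ} (f : fixedHom (cell W a) (cell W b) 0) (j : ℤ) :
    homD (cell W a) (cell W b) 0 j f = 0 := by
  by_cases h : j = 0
  · rw [homD_shape 0 j (by lia)]
    rfl
  · exact cell_hom_eq_zero h _

/-- Morphisms of 𝓔 are cycles, so the Leibniz rule reduces to commutation of the action with the
differential. -/
lemma d_mact {a b : ℕ} (p q : ℤ) (f : fixedHom (cell W a) (cell W b) 0) (m : (M.obj b).X p) :
    ((M.obj a).d p q).hom (mact M p f m) = mact M q f (((M.obj b).d p q).hom m) := by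
  by_cases h : q + 1 = p
  · obtain rfl : q = p - 1 := by lia
    refine ((M.act a b).d_app p 0 p (add_zero p) m f).trans ?_
    have : ((cellCat W).hom a b |>.d 0 (0 - 1)).hom f = 0 := homD_cell f _
    rw [this, map_zero, smul_zero, add_zero]
    rfl
  · rw [(M.obj a).shape p q h, (M.obj b).shape p q h]
    exact (map_zero _).symm

lemma hom_mact {M N : CellMod W} (α : M ⟶ N) {a b : ℕ} (p : ℤ)
    (f : fixedHom (cell W a) (cell W b) 0) (m : (M.obj b).X p) :
    ((α.app a).f p).hom (mact M p f m) = mact N p f (((α.app b).f p).hom m) :=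
  α.map_act a b p 0 p (add_zero p) m f

lemma cellAct_eq_zero {a b : ℕ} (p q r : ℤ) (h : p + q = r) (hq : q ≠ 0) (m : (M.obj b).X p)
    (f : fixedHom (cell W a) (cell W b) q) : cellAct M a b p q r h m f = 0 := by
  rw [cell_hom_eq_zero hq f]
  exact map_zero _

/-- Every element is a combination of elements that come from `M (ℚW)`. -/
lemma eq_sum_mact [Fintype W] {a : ℕ} (p : ℤ) (m : (M.obj a).X p) :
    m = (Fintype.card W : ℚ)⁻¹ • ∑ w : Fin a → W, mact M p (eMap w) (mact M p (rMap w) m) := by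
  refine (mact_one M a p m).symm.trans ?_
  rw [homOne_eq_sum, map_smul, map_sum]
  simp only [LinearMap.smul_apply, LinearMap.sum_apply, mact_mact]

lemma mact_ext [Finite W] {a : ℕ} (p : ℤ) {m m' : (M.obj a).X p}
    (H : ∀ w : Fin a → W, mact M p (rMap w) m = mact M p (rMap w) m') : m = m' := by
  have := Fintype.ofFinite W
  rw [eq_sum_mact M p m, eq_sum_mact M p m']
  simp only [H]

variable (W) in
/-- The functor `X ↦ Hom(𝒢, X)`. -/
abbrev cellF : ChRep W ⥤ CellMod W := homFunctor (cell W)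

lemma val_mact (X : ChRep W) {a b : ℕ} (p : ℤ) (f : fixedHom (cell W a) (cell W b) 0)
    (z : fixedHom (cell W b) X p) (w : Fin a → W) :
    val (mact ((cellF W).obj X) p f z : fixedHom (cell W a) X p) w =
      ev z 0 p (zero_add p) (val f w) :=
  val_comp z f w

lemma val_mact_rMap (X : ChRep W) {a : ℕ} (p : ℤ) (w : Fin a → W)
    (z : fixedHom (cell W a) X p) (u : Fin 1 → W) :
    val (mact ((cellF W).obj X) p (rMap w) z : fixedHom (cell W 1) X p) u = val z (u 0 • w) := by
  rw [val_mact, val_rMap]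
  rfl

/-- The map `ℚW ⟶ X`, `u ↦ u x`. -/
def point {X : ChRep W} {n : ℤ} (x : (X.X n).V) : fixedHom (cell W 1) X n :=
  mkVal (fun u => (X.X n).ρ (u 0) x) (fun g u => by
    change (X.X n).ρ (g * u 0) x = _
    rw [map_mul]
    rfl)

lemma val_point {X : ChRep W} {n : ℤ} (x : (X.X n).V) (u : Fin 1 → W) :
    val (point x) u = (X.X n).ρ (u 0) x := val_mkVal _ _ _

lemma val_point_one {X : ChRep W} {n : ℤ} (x : (X.X n).V) :
    val (point x) (fun _ : Fin 1 => (1 : W)) = x := by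
  rw [val_point, map_one]
  rfl

lemma fin_one_eq_smul (u : Fin 1 → W) : u = u 0 • (fun _ : Fin 1 => (1 : W)) := by
  funext i
  obtain rfl := Subsingleton.elim i 0
  simp

lemma val_one_ext {X : ChRep W} {n : ℤ} {f f' : fixedHom (cell W 1) X n}
    (H : val f (fun _ => 1) = val f' (fun _ => 1)) : f = f' := by
  refine val_ext fun u => ?_
  rw [fin_one_eq_smul u, val_ρ, val_ρ, H]

lemma eq_point {X : ChRep W} {n : ℤ} (f : fixedHom (cell W 1) X n) :
    f = point (val f (fun _ => 1)) :=
  val_one_ext (val_point_one _).symm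

/-- Restriction along r_w is evaluation at w. This is how the value of a module at ℚW controls its
value at every ℚ(W^a). -/
lemma val_one_rMap {X : ChRep W} {a : ℕ} {p : ℤ} (w : Fin a → W) (z : fixedHom (cell W a) X p) :
    mact ((cellF W).obj X) p (rMap w) z = (point (val z w) : fixedHom (cell W 1) X p) := by
  refine val_one_ext ?_
  rw [val_point_one, val_mact_rMap, one_smul]

/-- Evaluating Hom(ℚW, X) at the basis element 1 recovers X. -/
instance cellF_faithful : (cellF W).Faithful where
  map_injective {X Y u u'} h := by
    ext1 n
    refine Rep.hom_ext (Representation.IntertwiningMap.ext (LinearMap.ext fun x => ?_))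
    have := congrArg (fun α : (cellF W).obj X ⟶ (cellF W).obj Y =>
      val (((α.app (1 : ℕ)).f n).hom (point x) : fixedHom (cell W 1) Y n) (fun _ => 1)) h
    refine Eq.trans ?_ (this.trans ?_)
    · exact (congrArg (u.f n).hom (val_point_one x)).symm
    · exact congrArg (u'.f n).hom (val_point_one x)

/-- The components of a map of modules `Hom(𝒢, X) ⟶ Hom(𝒢, Y)`. -/
def fapp {X Y : ChRep W} (α : (cellF W).obj X ⟶ (cellF W).obj Y) (a : ℕ) (n : ℤ) :
    fixedHom (cell W a) X n →ₗ[ℚ] fixedHom (cell W a) Y n :=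
  ((α.app a).f n).hom

lemma fapp_mact {X Y : ChRep W} (α : (cellF W).obj X ⟶ (cellF W).obj Y) {a b : ℕ} (n : ℤ)
    (f : fixedHom (cell W a) (cell W b) 0) (z : fixedHom (cell W b) X n) :
    fapp α a n (mact ((cellF W).obj X) n f z) = mact ((cellF W).obj Y) n f (fapp α b n z) :=
  hom_mact α n f z

lemma fapp_homD {X Y : ChRep W} (α : (cellF W).obj X ⟶ (cellF W).obj Y) (a : ℕ) (i j : ℤ)
    (z : fixedHom (cell W a) X i) :
    homD (cell W a) Y i j (fapp α a i z) = fapp α a j (homD (cell W a) X i j z) :=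
  congrArg (fun φ : (homComplex (cell W a) X).X i ⟶ (homComplex (cell W a) Y).X j => φ.hom z)
    ((α.app a).comm i j)

/-- The map of complexes inducing a given map of modules. -/
def preimageF {X Y : ChRep W} (α : (cellF W).obj X ⟶ (cellF W).obj Y) : X ⟶ Y where
  f n := Rep.ofHom
    { toFun := fun x => val (fapp α 1 n (point x)) (fun _ => 1)
      map_add' := fun x y => by
        have : (point (x + y) : fixedHom (cell W 1) X n) = point x + point y :=
          val_one_ext (by rw [val_add, val_point_one, val_point_one, val_point_one])
        rw [this, map_add, val_add]
      map_smul' := fun c x => by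
        have : (point (c • x) : fixedHom (cell W 1) X n) = c • point x :=
          val_one_ext (by rw [val_smul, val_point_one, val_point_one])
        rw [this, map_smul, val_smul, RingHom.id_apply]
      isIntertwining' := fun g => LinearMap.ext fun x => by
        have h₁ : (point ((X.X n).ρ g x) : fixedHom (cell W 1) X n) =
            mact ((cellF W).obj X) n (rMap (fun _ : Fin 1 => g)) (point x) := by
          rw [val_one_rMap, val_point]
        change val (fapp α 1 n (point ((X.X n).ρ g x))) (fun _ => 1) =
          (Y.X n).ρ g (val (fapp α 1 n (point x)) (fun _ => 1))
        rw [h₁, fapp_mact]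
        refine (val_mact_rMap Y n (fun _ : Fin 1 => g) _ _).trans ?_
        rw [one_smul, ← val_ρ]
        congr 1
        funext i
        simp }
  comm' i j hij := by
    refine Rep.hom_ext (Representation.IntertwiningMap.ext (LinearMap.ext fun x => ?_))
    have h₁ : (point (dV X i j x) : fixedHom (cell W 1) X j) =
        homD (cell W 1) X i j (point x) :=
      val_one_ext (by rw [val_homD, val_point_one, val_point_one])
    change dV Y i j (val (fapp α 1 i (point x)) (fun _ => 1)) =
      val (fapp α 1 j (point (dV X i j x))) (fun _ => 1)
    rw [h₁, ← val_homD, fapp_homD]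

lemma preimageF_apply {X Y : ChRep W} (α : (cellF W).obj X ⟶ (cellF W).obj Y) (n : ℤ)
    (x : (X.X n).V) : ((preimageF α).f n).hom x = val (fapp α 1 n (point x)) (fun _ => 1) := rfl

/-- A module map commutes with restriction along every r_w, so all its values are read off from its
component at ℚW; that component defines the preimage. -/
instance cellF_full : (cellF W).Full where
  map_surjective {X Y} α := by
    refine ⟨preimageF α, RightModule.hom_ext fun (a : ℕ) n (z : fixedHom (cell W a) X n) => ?_⟩
    refine val_ext (X := Y) fun w => ?_
    refine (preimageF_apply α n (val z w)).trans ?_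
    change _ = val (fapp α a n z) w
    rw [← val_one_rMap, fapp_mact, val_mact_rMap, one_smul]

/-- The complex of representations `M (ℚW)`. -/
def underlying (M : CellMod W) : ChRep W where
  X n := Rep.of (X := (M.obj (1 : ℕ)).X n)
    { toFun := fun g => mact M n (rMap (fun _ : Fin 1 => g))
      map_one' := by
        rw [rMap_one]
        exact LinearMap.ext fun m => mact_one M 1 n m
      map_mul' := fun g h => LinearMap.ext fun m => by
        refine Eq.trans ?_ (mact_mact M n (rMap (fun _ : Fin 1 => h))
          (rMap (fun _ : Fin 1 => g)) m).symm
        rw [rMap_comp_rMap]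
        rfl }
  d i j := Rep.ofHom
    { toLinearMap := ((M.obj (1 : ℕ)).d i j).hom
      isIntertwining' := fun g => LinearMap.ext fun m => d_mact M i j _ m }
  shape i j h := by
    refine Rep.hom_ext (Representation.IntertwiningMap.ext (LinearMap.ext fun x => ?_))
    exact congrArg (fun φ : (M.obj (1 : ℕ)).X i ⟶ (M.obj (1 : ℕ)).X j => φ.hom x)
      ((M.obj (1 : ℕ)).shape i j h)
  d_comp_d' i j k _ _ := by
    refine Rep.hom_ext (Representation.IntertwiningMap.ext (LinearMap.ext fun x => ?_))
    exact congrArg (fun φ : (M.obj (1 : ℕ)).X i ⟶ (M.obj (1 : ℕ)).X k => φ.hom x)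
      ((M.obj (1 : ℕ)).d_comp_d i j k)

/-- `m ↦ (w ↦ m r_w)`. -/
def compareFun (M : CellMod W) (a : ℕ) (n : ℤ) (m : (M.obj a).X n) :
    fixedHom (cell W a) (underlying M) n :=
  mkVal (X := underlying M) (fun w => (mact M n (rMap w) m : (M.obj (1 : ℕ)).X n)) (fun g w => by
    refine Eq.trans ?_ (mact_mact M n (rMap w) (rMap (fun _ : Fin 1 => g)) m).symm
    rw [rMap_comp_rMap])

lemma val_compareFun (M : CellMod W) (a : ℕ) (n : ℤ) (m : (M.obj a).X n) (w : Fin a → W) :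
    val (compareFun M a n m) w = (mact M n (rMap w) m : (M.obj (1 : ℕ)).X n) := val_mkVal _ _ _

/-- `compareFun` as a linear map. -/
def compareₗ (M : CellMod W) (a : ℕ) (n : ℤ) :
    (M.obj a).X n →ₗ[ℚ] fixedHom (cell W a) (underlying M) n where
  toFun := compareFun M a n
  map_add' m m' := val_ext fun w => by
    rw [val_add, val_compareFun, val_compareFun, val_compareFun, map_add]
    rfl
  map_smul' c m := val_ext fun w => by
    rw [RingHom.id_apply, val_smul, val_compareFun, val_compareFun, map_smul]
    rfl

/-- Evaluation of `m` at linear combinations of basis elements. -/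
def pointAct (M : CellMod W) {b : ℕ} (p : ℤ) (m : (M.obj b).X p) :
    ((cell W b).X 0).V →ₗ[ℚ] (M.obj (1 : ℕ)).X p :=
  (mact M p).flip m ∘ₗ
    { toFun := fun x => (point x : fixedHom (cell W 1) (cell W b) 0)
      map_add' := fun x y =>
        val_one_ext (by rw [val_add, val_point_one, val_point_one, val_point_one])
      map_smul' := fun c x =>
        val_one_ext (by rw [RingHom.id_apply, val_smul, val_point_one, val_point_one]) }

lemma point_δ {b : ℕ} (y : Fin b → W) :
    (point (δ y) : fixedHom (cell W 1) (cell W b) 0) = rMap y :=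
  val_one_ext (by rw [val_point_one, val_rMap, one_smul])

lemma pointAct_δ (M : CellMod W) {b : ℕ} (p : ℤ) (m : (M.obj b).X p) (y : Fin b → W) :
    pointAct M p m (δ y) = mact M p (rMap y) m :=
  congrArg (fun f => mact M p f m) (point_δ y)

/-- Both sides are linear in x and agree for x in the basis W^b. -/
lemma pointAct_eq (M : CellMod W) {b : ℕ} (p : ℤ) (m : (M.obj b).X p) (x : ((cell W b).X 0).V) :
    (pointAct M p m x : (M.obj (1 : ℕ)).X p) = ev (compareFun M b p m) 0 p (zero_add p) x := by
  refine LinearMap.congr_fun (g := (ev (compareFun M b p m) 0 p (zero_add p) :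
    ((cell W b).X 0).V →ₗ[ℚ] (M.obj (1 : ℕ)).X p)) (cell_lhom_ext fun y => ?_) x
  exact (pointAct_δ M p m y).trans (val_compareFun M b p m y).symm

/-- The composite f r_w is a linear combination of maps r_y, not a single one. This is why the
action of r_y has to be extended linearly in y, as in `pointAct`. -/
lemma compareFun_mact (M : CellMod W) {a b : ℕ} (p : ℤ) (f : fixedHom (cell W a) (cell W b) 0)
    (m : (M.obj b).X p) : compareFun M a p (mact M p f m) =
      mact ((cellF W).obj (underlying M)) p f (compareFun M b p m) := by
  refine val_ext fun w => ?_
  have h₁ : compFixed 0 0 0 (add_zero 0) f (rMap w) = point (val f w) :=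
    val_one_rMap (X := cell W b) w f
  rw [val_compareFun, mact_mact, val_mact, h₁]
  exact pointAct_eq M p m (val f w)

/-- The comparison map `M ⟶ Hom(𝒢, M (ℚW))`. -/
def comparison (M : CellMod W) : M ⟶ (cellF W).obj (underlying M) where
  app (a : ℕ) :=
    { f := fun n => ModuleCat.ofHom (compareₗ M a n)
      comm' := fun i j _ => by
        ext m
        refine val_ext (X := underlying M) fun w => ?_
        refine (val_homD i j (compareFun M a i m) w).trans ?_
        rw [val_compareFun]
        exact (d_mact M i j (rMap w) m).trans (val_compareFun M a j _ w).symm }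
  map_act (a b : ℕ) p q r h m f := by
    -- All maps in 𝓔 of nonzero degree vanish, and with them both sides.
    by_cases hq : q = 0
    · subst hq
      obtain rfl : p = r := by lia
      exact compareFun_mact M p f m
    · have h₁ : (M.act a b).app p q r h m f = 0 := cellAct_eq_zero M p q r h hq m f
      rw [h₁]
      refine (map_zero (compareₗ M a r)).trans ?_
      exact (cellAct_eq_zero ((cellF W).obj (underlying M)) p q r h hq _ f).symm

/-- Since id = |W|⁻¹ ∑ r_w e_w, the restrictions along the r_w determine m, and |W|⁻¹ ∑ z(w) · e_w
is a preimage of z. Its value at v follows from the formula for e_w r_v and the equivariance of z.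
-/
lemma compare_bijective [Finite W] (M : CellMod W) (a : ℕ) (n : ℤ) :
    Function.Bijective (compareFun M a n) := by
  classical
  have := Fintype.ofFinite W
  refine ⟨fun m m' h => mact_ext M n fun w => ?_, fun z => ?_⟩
  · rw [← val_compareFun, ← val_compareFun, h]
  · let z' (w : Fin a → W) : (M.obj (1 : ℕ)).X n := val z w
    refine ⟨(Fintype.card W : ℚ)⁻¹ • ∑ w : Fin a → W, mact M n (eMap w) (z' w), ?_⟩
    refine val_ext fun v => ?_
    rw [val_compareFun, map_smul, map_sum]
    refine Eq.trans ?_ (sum_smul_eq (z' v) v)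
    refine congrArg _ (Finset.sum_congr rfl fun w _ => ?_)
    rw [mact_mact, eMap_comp_rMap, map_sum, LinearMap.sum_apply]
    refine Finset.sum_congr rfl fun k _ => ?_
    split_ifs with h
    · subst h
      exact (val_ρ z k w).symm
    · rw [map_zero]
      rfl

/-- Every M is isomorphic to Hom(𝒢, M(ℚW)) through `comparison`. -/
instance cellF_essSurj [Finite W] : (cellF W).EssSurj where
  mem_essImage M := by
    have := RightModule.isIso_of_bijective (comparison M) fun (a : ℕ) n => compare_bijective M a n
    exact ⟨underlying M, ⟨(asIso (comparison M)).symm⟩⟩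

instance cellF_isEquivalence [Finite W] : (cellF W).IsEquivalence where

end Action

end RatG
end


noncomputable section

namespace RatG

/-! ### The objectwise model structure on right modules. -/

section ObjectwiseModel

open Opposite

variable {W : Type} [Group W]

/-- `Hom(ℚ(W^a), V)` for representations `V`. -/
abbrev evalFunctor (a : ℕ) : Rep.{0} ℚ W ⥤ ModuleCat.{0} ℚ :=
  (linearCoyoneda ℚ (Rep.{0} ℚ W)).obj (op (Rep.diagonal ℚ W a))

lemma equivariant_single {a : ℕ} {V : Rep.{0} ℚ W} (φ : Rep.diagonal ℚ W a ⟶ V) (g : W)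
    (w : Fin a → W) :
    φ.hom (MonoidAlgebra.single (g • w) (1 : ℚ) : MonoidAlgebra ℚ (Fin a → W)) =
      V.ρ g (φ.hom (MonoidAlgebra.single w (1 : ℚ) : MonoidAlgebra ℚ (Fin a → W))) := by
  rw [← Rep.hom_comm_apply]
  exact congrArg φ.hom (Representation.ofMulAction_single _ _ _).symm

lemma base_ext {a : ℕ} {V : Rep.{0} ℚ W} {φ ψ : Rep.diagonal ℚ W a ⟶ V}
    (H : ∀ w, φ.hom (MonoidAlgebra.single w (1 : ℚ) : MonoidAlgebra ℚ (Fin a → W)) =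
      ψ.hom (MonoidAlgebra.single w (1 : ℚ) : MonoidAlgebra ℚ (Fin a → W))) : φ = ψ := by
  refine Rep.hom_ext (Representation.IntertwiningMap.ext ?_)
  apply MonoidAlgebra.lhom_ext'
  intro w
  apply LinearMap.ext_ring
  exact H w

/-- Elements of degree `n` of `Hom(ℚ(W^a), X)` are maps `ℚ(W^a) ⟶ X n`. -/
def evalEquiv (X : ChRep W) (a : ℕ) (n : ℤ) :
    (Rep.diagonal ℚ W a ⟶ X.X n) ≃ₗ[ℚ] fixedHom (cell W a) X n where
  toFun φ := mkVal (fun w => φ.hom (MonoidAlgebra.single w (1 : ℚ) : MonoidAlgebra ℚ (Fin a → W)))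
    (fun g w => equivariant_single φ g w)
  invFun f := liftBase (val f) (val_ρ f)
  map_add' φ ψ := val_ext fun w => by
    rw [val_add, val_mkVal, val_mkVal, val_mkVal]
    rfl
  map_smul' c φ := val_ext fun w => by
    rw [val_smul, val_mkVal, val_mkVal]
    rfl
  left_inv φ := base_ext fun w => by rw [liftBase_single, val_mkVal]
  right_inv f := val_ext fun w => by rw [val_mkVal, liftBase_single]

lemma val_evalEquiv {X : ChRep W} {a : ℕ} {n : ℤ} (φ : Rep.diagonal ℚ W a ⟶ X.X n)
    (w : Fin a → W) : val (evalEquiv X a n φ) w =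
      φ.hom (MonoidAlgebra.single w (1 : ℚ) : MonoidAlgebra ℚ (Fin a → W)) := val_mkVal _ _ _

/-- `Hom(ℚ(W^a), X)` as the image of `X` under an additive functor. -/
def evalIso (X : ChRep W) (a : ℕ) :
    ((evalFunctor a).mapHomologicalComplex (ComplexShape.down ℤ)).obj X ≅
      homComplex (cell W a) X :=
  HomologicalComplex.Hom.isoOfComponents (fun n => (evalEquiv X a n).toModuleIso) (fun i j _ => by
    refine ModuleCat.hom_ext (LinearMap.ext fun (φ : Rep.diagonal ℚ W a ⟶ X.X i) => ?_)
    refine val_ext (X := X) fun w => ?_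
    refine (val_homD i j (evalEquiv X a i φ) w).trans ?_
    exact (congrArg (dV X i j) (val_evalEquiv φ w)).trans (val_evalEquiv (φ ≫ X.d i j) w).symm)

lemma evalIso_naturality {X Y : ChRep W} (u : X ⟶ Y) (a : ℕ) :
    ((evalFunctor a).mapHomologicalComplex (ComplexShape.down ℤ)).map u ≫ (evalIso Y a).hom =
      (evalIso X a).hom ≫ homPost (cell W a) u := by
  ext1 n
  refine ModuleCat.hom_ext (LinearMap.ext fun (φ : Rep.diagonal ℚ W a ⟶ X.X n) => ?_)
  refine val_ext (X := Y) fun w => ?_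
  refine (val_evalEquiv (φ ≫ u.f n) w).trans ?_
  refine Eq.trans ?_ (val_homPost u n (evalEquiv X a n φ) w).symm
  exact congrArg (u.f n).hom (val_evalEquiv φ w).symm

/-- `point` as a linear equivalence. -/
def pointEquiv (X : ChRep W) (n : ℤ) : (X.X n).V ≃ₗ[ℚ] fixedHom (cell W 1) X n where
  toFun x := point x
  invFun f := val f (fun _ => 1)
  map_add' x y := val_one_ext (by rw [val_add, val_point_one, val_point_one, val_point_one])
  map_smul' c x := val_one_ext (by rw [RingHom.id_apply, val_smul, val_point_one, val_point_one])
  left_inv x := val_point_one x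
  right_inv f := (eq_point f).symm

/-- `Hom(ℚW, X)` is the underlying complex of `X`. -/
def pointIso (X : ChRep W) :
    ((forget₂ (Rep.{0} ℚ W) (ModuleCat ℚ)).mapHomologicalComplex (ComplexShape.down ℤ)).obj X ≅
      homComplex (cell W 1) X :=
  HomologicalComplex.Hom.isoOfComponents (fun n => (pointEquiv X n).toModuleIso) (fun i j _ => by
    refine ModuleCat.hom_ext (LinearMap.ext fun (x : (X.X i).V) => ?_)
    refine val_one_ext (X := X) ?_
    refine (val_homD i j (point x) _).trans ?_
    exact (congrArg (dV X i j) (val_point_one x)).trans (val_point_one (dV X i j x)).symm)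

lemma pointIso_naturality {X Y : ChRep W} (u : X ⟶ Y) :
    ((forget₂ (Rep.{0} ℚ W) (ModuleCat ℚ)).mapHomologicalComplex (ComplexShape.down ℤ)).map u ≫
      (pointIso Y).hom = (pointIso X).hom ≫ homPost (cell W 1) u := by
  ext1 n
  refine ModuleCat.hom_ext (LinearMap.ext fun (x : (X.X n).V) => ?_)
  refine val_one_ext (X := Y) ?_
  refine (val_point_one ((u.f n).hom x)).trans ?_
  refine Eq.trans ?_ (val_homPost u n (point x) _).symm
  exact congrArg (u.f n).hom (val_point_one x).symm

variable [Finite W]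

instance : (forget₂ (Rep.{0} ℚ W) (ModuleCat ℚ)).PreservesHomology :=
  Functor.preservesHomologyOfExact _

/-- The case a = 1 is the forgetful functor, which is exact and reflects quasi-isomorphisms.
Conversely, u is a homotopy equivalence, and Hom(ℚ(W^a), -) is an additive functor applied
degreewise. -/
lemma quasiIso_homPost_iff {X Y : ChRep W} (u : X ⟶ Y) :
    (∀ a, QuasiIso (homPost (cell W a) u)) ↔ QuasiIso u := by
  have key {K L K' L' : ChQ} (f : K ⟶ L) (g : K' ⟶ L') (i : K ≅ K') (j : L ≅ L')
      (h : f ≫ j.hom = i.hom ≫ g) : QuasiIso f ↔ QuasiIso g :=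
    (HomologicalComplex.quasiIso (ModuleCat ℚ) (ComplexShape.down ℤ)).arrow_mk_iso_iff
      (Arrow.isoMk i j h.symm)
  refine ⟨fun h => ?_, fun _ a => ?_⟩
  · have := (key _ _ _ _ (pointIso_naturality u)).2 (h 1)
    rwa [HomologicalComplex.quasiIso_map_iff_of_preservesHomology] at this
  · obtain ⟨e, rfl⟩ := Semisimple.exists_homotopyEquiv_of_quasiIso u
    refine (key _ _ _ _ (evalIso_naturality e.hom a)).1 ?_
    exact ((evalFunctor a).mapHomotopyEquiv e).quasiIso_hom

/-- At a = 1 the map is u itself; conversely, ℚ(W^a) is projective. -/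
lemma surjective_homPost_iff {X Y : ChRep W} (u : X ⟶ Y) :
    (∀ (a : ℕ) (n : ℤ), Function.Surjective ((homPost (cell W a) u).f n).hom) ↔ Epi u := by
  refine ⟨fun h => ?_, fun _ a n (z : fixedHom (cell W a) Y n) => ?_⟩
  · have (n : ℤ) : Epi (u.f n) := by
      rw [Rep.epi_iff_surjective]
      intro y
      obtain ⟨z, hz⟩ := h 1 n (point y)
      refine ⟨val z (fun _ => 1), ?_⟩
      refine (val_homPost u n (z : fixedHom (cell W 1) X n) _).symm.trans ?_
      exact (congrArg (fun f : fixedHom (cell W 1) Y n => val f (fun _ => 1)) hz).trans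
        (val_point_one y)
    exact HomologicalComplex.epi_of_epi_f u this
  · refine ⟨evalEquiv X a n (Projective.factorThru ((evalEquiv Y a n).symm z) (u.f n)), ?_⟩
    refine val_ext fun w => ?_
    refine (val_homPost u n (evalEquiv X a n _) w).trans ?_
    rw [val_evalEquiv]
    refine (congrArg (fun φ : Rep.diagonal ℚ W a ⟶ Y.X n => φ.hom
      (MonoidAlgebra.single w (1 : ℚ) : MonoidAlgebra ℚ (Fin a → W)))
      (Projective.factorThru_comp ((evalEquiv Y a n).symm z) (u.f n))).trans ?_
    rw [← val_evalEquiv, LinearEquiv.apply_symm_apply]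

variable (W) in
/-- The Morita equivalence. -/
abbrev cellEquiv : ChRep W ≌ CellMod W := (cellF W).asEquivalence

variable (W) in
/-- The inverse of `X ↦ Hom(𝒢, X)`. -/
abbrev cellL : CellMod W ⥤ ChRep W := (cellEquiv W).inverse

instance : Preadditive (CellMod W) := Preadditive.ofFullyFaithful (.ofFullyFaithful (cellL W))

instance : HasFiniteProducts (CellMod W) :=
  ⟨fun _ => Adjunction.hasLimitsOfShape_of_equivalence (cellL W)⟩

instance : Abelian (CellMod W) := abelianOfEquivalence (cellL W)

instance : IsGrothendieckAbelian.{0} (CellMod W) := .of_equivalence (cellEquiv W)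

instance : EnoughProjectives (CellMod W) := (cellEquiv W).enoughProjectives_iff.1 inferInstance

variable (W)

/-- The objectwise model structure on right modules. -/
@[reducible]
def cellModel : ModelCategory (CellMod W) :=
  letI := repModel W
  letI : CategoryWithCofibrations (CellMod W) := ⟨(cofibrations (ChRep W)).inverseImage (cellL W)⟩
  letI : CategoryWithFibrations (CellMod W) := ⟨(fibrations (ChRep W)).inverseImage (cellL W)⟩
  letI : CategoryWithWeakEquivalences (CellMod W) :=
    ⟨(weakEquivalences (ChRep W)).inverseImage (cellL W)⟩
  ModelCategory.transport (cellEquiv W).symm rfl rfl rfl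

lemma cellModel_cofibrations :
    letI := cellModel W; cofibrations (CellMod W) = .monomorphisms (CellMod W) := by
  ext X Y f
  change Mono ((cellL W).map f) ↔ Mono f
  exact (cellL W).mono_map_iff_mono f

lemma cellModel_fibrations :
    letI := cellModel W; fibrations (CellMod W) = .epimorphisms (CellMod W) := by
  ext X Y f
  change Epi ((cellL W).map f) ↔ Epi f
  exact (cellL W).epi_map_iff_epi f

lemma cellModel_weakEquivalence {X Y : CellMod W} (f : X ⟶ Y) :
    letI := cellModel W; WeakEquivalence f ↔ QuasiIso ((cellL W).map f) := by
  let _ := cellModel W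
  rw [weakEquivalence_iff]
  rfl

lemma cellModel_isObjectwiseModel :
    letI := cellModel W; IsObjectwiseModel (cellCat W) := by
  let _ := cellModel W
  -- The counit of the equivalence identifies f with Hom(𝒢, L f), so the objectwise conditions on f
  -- become the conditions on L f that define the transported structure.
  have key {M N : CellMod W} (f : M ⟶ N) (a : ℕ) :
      Arrow.mk (f.app a) ≅ Arrow.mk (homPost (cell W a) ((cellL W).map f)) := by
    let app (a : ℕ) : CellMod W ⥤ ChQ :=
      { obj := fun M => M.obj a, map := fun f => f.app a }
    exact (app a).mapArrow.mapIso (Arrow.isoMk (f := Arrow.mk f)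
      (g := Arrow.mk ((cellF W).map ((cellL W).map f))) ((cellEquiv W).counitIso.symm.app M)
      ((cellEquiv W).counitIso.symm.app N) ((cellEquiv W).counitIso.inv.naturality f).symm)
  refine ⟨fun {M N} f => ?_, fun {M N} f => ?_⟩
  · rw [cellModel_weakEquivalence, ← quasiIso_homPost_iff]
    exact forall_congr' fun a =>
      ((HomologicalComplex.quasiIso (ModuleCat ℚ) (ComplexShape.down ℤ)).arrow_mk_iso_iff
        (key f a)).symm
  · have : Fibration f ↔ Epi ((cellL W).map f) := by rw [fibration_iff]; rfl
    rw [this, ← surjective_homPost_iff]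
    refine forall_congr' fun a => forall_congr' fun n => ?_
    simp only [← ModuleCat.epi_iff_surjective]
    exact ((MorphismProperty.epimorphisms (ModuleCat ℚ)).arrow_mk_iso_iff
      ((HomologicalComplex.eval _ _ n).mapArrow.mapIso (key f a))).symm

end ObjectwiseModel

end RatG
end


noncomputable section

namespace RatG

/-! ### The transported monoidal structure and the Quillen equivalence. -/

section CellMonoidal

variable {W : Type} [Group W] [Finite W]

/-- Transport makes M ⊗ N equal to Hom(𝒢, L M ⊗ L N). That this is the box product is a separate
statement, `boxProduct`. -/
instance cellMonoidal : MonoidalCategory (CellMod W) :=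
  inferInstanceAs (MonoidalCategory (Monoidal.Transported (cellEquiv W)))

instance cellBraided : BraidedCategory (CellMod W) :=
  inferInstanceAs (BraidedCategory (Monoidal.Transported (cellEquiv W)))

instance cellSymmetric : SymmetricCategory (CellMod W) :=
  inferInstanceAs (SymmetricCategory (Monoidal.Transported (cellEquiv W)))

instance cellLBraided : (cellL W).Braided :=
  inferInstanceAs (Monoidal.equivalenceTransported (cellEquiv W)).inverse.Braided

variable (W)

lemma cell_nonempty_monoidalClosed : Nonempty (MonoidalClosed (CellMod W)) := by
  obtain ⟨_⟩ := nonempty_monoidalClosed (W := W)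
  exact ⟨MonoidalClosed.ofEquiv (cellL W) (cellEquiv W).symm.toAdjunction⟩

variable {W} in
lemma cell_mono_whiskerLeft (Z : CellMod W) {M N : CellMod W} (f : M ⟶ N) [Mono f] :
    Mono (Z ◁ f) := by
  have := mono_whiskerLeft ((cellL W).obj Z) ((cellL W).map f)
  exact ((cellF W).mono_map_iff_mono ((cellL W).obj Z ◁ (cellL W).map f)).2 this

variable {W} in
lemma cellModel_weakEquivalence_map {X Y : ChRep W} (f : X ⟶ Y) :
    letI := cellModel W; WeakEquivalence ((cellF W).map f) ↔ QuasiIso f := by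
  rw [cellModel_weakEquivalence]
  exact ((HomologicalComplex.quasiIso (Rep.{0} ℚ W) (ComplexShape.down ℤ)).arrow_mk_iso_iff
    (Arrow.isoMk (f := Arrow.mk f) (g := Arrow.mk ((cellL W).map ((cellF W).map f)))
      ((cellEquiv W).unitIso.app X) ((cellEquiv W).unitIso.app Y)
      ((cellEquiv W).unitIso.hom.naturality f).symm)).symm

variable {W} in
lemma cell_weakEquivalence_whiskerLeft (Z : CellMod W) {M N : CellMod W} (f : M ⟶ N) :
    letI := cellModel W; ∀ [WeakEquivalence f], WeakEquivalence (Z ◁ f) := by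
  intro hf
  rw [cellModel_weakEquivalence] at hf
  exact (cellModel_weakEquivalence_map ((cellL W).obj Z ◁ (cellL W).map f)).2
    (quasiIso_whiskerLeft _ _)

lemma cellModel_isSymmetricMonoidalModel :
    letI := cellModel W; IsSymmetricMonoidalModel (CellMod W) := by
  let _ := cellModel W
  exact isSymmetricMonoidalModel (cellModel_cofibrations W) (cellModel_fibrations W)
    (cell_nonempty_monoidalClosed W) (fun Z _ _ f _ => cell_mono_whiskerLeft Z f)
    (fun Z _ _ f _ => cell_weakEquivalence_whiskerLeft Z f)

lemma cellModel_monoidAxiom : letI := cellModel W; MonoidAxiom (CellMod W) := by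
  let _ := cellModel W
  exact monoidAxiom (cellModel_cofibrations W) (fun Z _ _ f _ => cell_mono_whiskerLeft Z f)
    (fun Z _ _ f _ => cell_weakEquivalence_whiskerLeft Z f)

/-- The adjunction between the tensor product with the objects `ℚ(W^a)` and `X ↦ Hom(𝒢, X)`. -/
abbrev cellAdj : cellL W ⊣ cellF W := (cellEquiv W).symm.toAdjunction

/-- Cofibrations and weak equivalences of modules are preimages under L. The unit of the adjunction
is invertible, so passing to adjuncts amounts to applying Hom(𝒢, -), which preserves and detects
weak equivalences. -/
lemma cellAdj_isQuillenEquivalence :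
    letI := repModel W; letI := cellModel W; IsQuillenEquivalence (cellAdj W) := by
  let _ := repModel W
  let _ := cellModel W
  refine ⟨fun f hf => ?_, fun f _ hf => ?_, fun {A X} _ _ f => ?_⟩
  · rw [cofibration_iff] at hf ⊢
    exact hf
  · rw [weakEquivalence_iff] at hf ⊢
    exact hf
  · rw [Adjunction.homEquiv_unit, weakEquivalence_precomp_iff, cellModel_weakEquivalence_map,
      (repModel_isProjectiveModel W).weakEquivalences_iff]

lemma cellL_isStrongSymmetricMonoidal :
    letI := repModel W; letI := cellModel W; IsStrongSymmetricMonoidal (cellL W) := by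
  let _ := repModel W
  let _ := cellModel W
  refine ⟨inferInstance, fun Q q _ hq => ?_⟩
  rw [weakEquivalence_postcomp_iff]
  rw [weakEquivalence_iff] at hq ⊢
  exact hq

end CellMonoidal

/-! ### The left adjoint as a coend. -/

section TensorCoend

variable {W : Type} [Group W] {I : Type} {c : I → ChRep W} {L : RightModule (dgFull c) ⥤ ChRep W}
  (adj : L ⊣ homFunctor c)

/-- The component of a module map into `Hom(c -, T)`. -/
def homApp {M : RightModule (dgFull c)} {T : ChRep W} (f : M ⟶ (homFunctor c).obj T) (a : I)
    (p : ℤ) : (M.obj a).X p →ₗ[ℚ] fixedHom (c a) T p :=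
  ((f.app a).f p).hom

/-- The linear map `f ↦ ev f`. -/
def evₗ {X T : ChRep W} {n : ℤ} (k l : ℤ) (h : k + n = l) :
    fixedHom X T n →ₗ[ℚ] (X.X k).V →ₗ[ℚ] (T.X l).V where
  toFun f := ev f k l h
  map_add' _ _ := rfl
  map_smul' _ _ := rfl

lemma homApp_d {M : RightModule (dgFull c)} {T : ChRep W} (f : M ⟶ (homFunctor c).obj T) (a : I)
    (p q : ℤ) (m : (M.obj a).X p) :
    homApp f a q (((M.obj a).d p q).hom m) = homD (c a) T p q (homApp f a p m) :=
  (congrArg (fun φ : (M.obj a).X p ⟶ (homComplex (c a) T).X q => φ.hom m)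
    ((f.app a).comm p q)).symm

/-- Module maps into `Hom(c -, T)` are cowedges. -/
def cowedgeOfHom {M : RightModule (dgFull c)} {T : ChRep W} (f : M ⟶ (homFunctor c).obj T) :
    Cowedge c M T where
  map a p q r h := evₗ q r (by lia) ∘ₗ homApp f a p
  -- The Leibniz rule for evaluation is the formula for d(f) in the Hom complex, with its signed
  -- term moved to the other side.
  d_map a p q r h m x := by
    change _ = ev (homApp f a (p - 1) (((M.obj a).d p (p - 1)).hom m)) q (r - 1) _ x +
      p.negOnePow • ev (homApp f a p m) (q - 1) (r - 1) _ (dV (c a) q (q - 1) x)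
    rw [homApp_d, ev_homD p (p - 1) (homApp f a p m) q (r - 1) (q - 1) r (by lia) (by lia)
      (by lia), sub_add_cancel]
    rfl
  map_ρ a p q r h m x g := ev_ρ (homApp f a p m) q r (by lia) g x
  dinatural a b p s q ps sq r hps hsq h m e x := by
    change ev (homApp f a ps ((M.act a b).app p s ps hps m e)) q r _ x =
      ev (homApp f b p m) sq r _ (ev e q sq hsq x)
    have : homApp f a ps ((M.act a b).app p s ps hps m e) =
        compFixed p s ps hps (homApp f b p m) e := f.map_act a b p s ps hps m e
    rw [this, ev_compFixed p s ps hps (homApp f b p m) e q sq r (by lia) hsq]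

lemma Cowedge.d_map' {M : RightModule (dgFull c)} {T : ChRep W} (φ : Cowedge c M T) (a : I)
    (p q r r' : ℤ) (h : p + q = r) (hr : r' + 1 = r) (m : (M.obj a).X p) (x : ((c a).X q).V) :
    dV T r r' (φ.map a p q r h m x) =
      φ.map a (p - 1) q r' (by lia) (((M.obj a).d p (p - 1)).hom m) x +
      p.negOnePow • φ.map a p (q - 1) r' (by lia) m (dV (c a) q (q - 1) x) := by
  obtain rfl : r' = r - 1 := by lia
  exact φ.d_map a p q r h m x

/-- The map `x ↦ φ m x` for a cowedge `φ`. -/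
def Cowedge.toFixed {M : RightModule (dgFull c)} {T : ChRep W} (φ : Cowedge c M T) (a : I)
    (p : ℤ) : (M.obj a).X p →ₗ[ℚ] fixedHom (c a) T p where
  toFun m := mkFixed (fun k l h => φ.map a p k l (by lia) m)
    (fun k l h g x => φ.map_ρ a p k l (by lia) m x g)
  map_add' m m' := fixed_ext fun k l h x => by
    rw [ev_add, ev_mkFixed, ev_mkFixed, ev_mkFixed, map_add]
    rfl
  map_smul' s m := fixed_ext fun k l h x => by
    rw [RingHom.id_apply, ev_smul, ev_mkFixed, ev_mkFixed, map_smul]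
    rfl

/-- Cowedges are module maps into `Hom(c -, T)`. -/
def homOfCowedge {M : RightModule (dgFull c)} {T : ChRep W} (φ : Cowedge c M T) :
    M ⟶ (homFunctor c).obj T where
  app a :=
    { f := fun p => ModuleCat.ofHom (φ.toFixed a p)
      comm' := fun i j hij => by
        replace hij : j + 1 = i := hij
        obtain rfl : j = i - 1 := by lia
        refine ModuleCat.hom_ext (LinearMap.ext fun m => fixed_ext (X := c a) (Y := T)
          fun k l h x => ?_)
        refine (ev_homD i (i - 1) (φ.toFixed a i m) k l (k - 1) (l + 1) h (by lia) (by lia)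
          x).trans ?_
        exact sub_eq_of_eq_add (φ.d_map' a i k (l + 1) l (by lia) (by lia) m x) }
  map_act a b p q r h m f := fixed_ext (X := c a) (Y := T) fun k l hkl x => by
    refine (φ.dinatural a b p q k r (k + q) l h rfl (by lia) m f x).trans ?_
    exact (ev_compFixed p q r h (φ.toFixed b p m) f k (k + q) l hkl rfl x).symm

lemma ev_homEquiv (M : RightModule (dgFull c)) (X : ChRep W) (u : L.obj M ⟶ X) (a : I)
    (p q r : ℤ) (h : q + p = r) (m : (M.obj a).X p) (x : ((c a).X q).V) :
    ev (homApp (adj.homEquiv M X u) a p m) q r h x =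
      (u.f r).hom (ev (homApp (adj.unit.app M) a p m) q r h x) := by
  rw [Adjunction.homEquiv_unit]
  rfl

/-- A left adjoint of `X ↦ Hom(c -, X)` is given by a coend. -/
def isTensorCoend : IsTensorCoend c adj where
  coproj M := cowedgeOfHom (adj.unit.app M)
  -- Cowedges to T correspond to module maps into Hom(c -, T), hence by adjunction to maps L M → T.
  -- The universal cowedge is the one of the unit.
  universal M T φ := by
    refine ⟨(adj.homEquiv M T).symm (homOfCowedge φ), fun a p q r h m x => ?_, fun u hu => ?_⟩
    · refine (ev_homEquiv adj M T _ a p q r (by lia) m x).symm.trans ?_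
      rw [Equiv.apply_symm_apply]
      rfl
    · rw [Equiv.eq_symm_apply]
      refine RightModule.hom_ext fun a p m => fixed_ext (X := c a) (Y := T) fun k l h x => ?_
      refine (ev_homEquiv adj M T u a p k l h m x).trans ?_
      exact hu a p k l (by lia) m x
  natural M N f a p q r h m x := by
    have := adj.unit.naturality f
    exact (congrArg (fun g : M ⟶ (homFunctor c).obj (L.obj N) =>
      ev (homApp g a p m) q r (by lia) x) this).symm
  homEquiv M X u a p q r h m x := ev_homEquiv adj M X u a p q r h m x

end TensorCoend

end RatG
end


noncomputable section

namespace RatG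

/-! ### Elements x ⊗ y of a tensor product of complexes. -/

section TensorElements

variable {W : Type} [Group W]

/-- The element `x ⊗ y` of `(X ⊗ Y) k`. -/
def tmul (X Y : ChRep W) (i j k : ℤ) (h : i + j = k) :
    (X.X i).V →ₗ[ℚ] (Y.X j).V →ₗ[ℚ] ((X ⊗ Y).X k).V :=
  (TensorProduct.mk ℚ (X.X i).V (Y.X j).V).compr₂ (tι X Y i j k h).hom.toLinearMap

variable {X Y Z : ChRep W}

lemma ρ_tmul (i j k : ℤ) (h : i + j = k) (g : W) (x : (X.X i).V) (y : (Y.X j).V) :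
    ((X ⊗ Y).X k).ρ g (tmul X Y i j k h x y) =
      tmul X Y i j k h ((X.X i).ρ g x) ((Y.X j).ρ g y) :=
  (Rep.hom_comm_apply (tι X Y i j k h) g (x ⊗ₜ[ℚ] y : TensorProduct ℚ _ _)).symm

lemma units_smul_hom {V V' : Rep.{0} ℚ W} (s : ℤˣ) (f : V ⟶ V') (x : V.V) :
    (s • f).hom x = s • f.hom x := by
  rcases Int.units_eq_one_or s with rfl | rfl
  · simp
  · simp only [Units.neg_smul, one_smul]
    rfl

lemma dV_tmul (i j k i' j' k' : ℤ) (h : i + j = k) (hi : i' + 1 = i) (hj : j' + 1 = j)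
    (hk : k' + 1 = k) (x : (X.X i).V) (y : (Y.X j).V) :
    dV (X ⊗ Y) k k' (tmul X Y i j k h x y) =
      tmul X Y i' j k' (by lia) (dV X i i' x) y +
      i.negOnePow • tmul X Y i j' k' (by lia) x (dV Y j j' y) := by
  have h₁ := congrArg (fun f : X.X i ⊗ Y.X j ⟶ (X ⊗ Y).X k' =>
    f.hom (x ⊗ₜ[ℚ] y : TensorProduct ℚ _ _)) (ι_tensor_d X Y i j k i' j' k' h hi hj hk)
  refine h₁.trans ?_
  rw [Rep.add_hom]
  refine congrArg (tmul X Y i' j k' (by lia) (dV X i i' x) y + ·) ?_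
  exact units_smul_hom _ _ _

lemma tensorHom_tmul {X' Y' : ChRep W} (f : X ⟶ X') (g : Y ⟶ Y') (i j k : ℤ) (h : i + j = k)
    (x : (X.X i).V) (y : (Y.X j).V) : ((f ⊗ₘ g).f k).hom (tmul X Y i j k h x y) =
      tmul X' Y' i j k h ((f.f i).hom x) ((g.f j).hom y) :=
  congrArg (fun f : X.X i ⊗ Y.X j ⟶ (X' ⊗ Y').X k => f.hom (x ⊗ₜ[ℚ] y : TensorProduct ℚ _ _))
    (tι_tensorHom f g i j k h)

lemma whiskerLeft_tmul {Y' : ChRep W} (g : Y ⟶ Y') (i j k : ℤ) (h : i + j = k)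
    (x : (X.X i).V) (y : (Y.X j).V) : ((X ◁ g).f k).hom (tmul X Y i j k h x y) =
      tmul X Y' i j k h x ((g.f j).hom y) := by
  rw [← MonoidalCategory.id_tensorHom, tensorHom_tmul]
  rfl

lemma whiskerRight_tmul {X' : ChRep W} (f : X ⟶ X') (i j k : ℤ) (h : i + j = k)
    (x : (X.X i).V) (y : (Y.X j).V) : ((f ▷ Y).f k).hom (tmul X Y i j k h x y) =
      tmul X' Y i j k h ((f.f i).hom x) y := by
  rw [← MonoidalCategory.tensorHom_id, tensorHom_tmul]
  rfl

lemma braiding_tmul (i j k : ℤ) (h : i + j = k) (x : (X.X i).V) (y : (Y.X j).V) :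
    ((β_ X Y).hom.f k).hom (tmul X Y i j k h x y) =
      (i * j).negOnePow • tmul Y X j i k (by lia) y x := by
  have h₁ : tι X Y i j k h ≫ (β_ X Y).hom.f k =
      bSign i j • ((β_ (X.X i) (Y.X j)).hom ≫ tι Y X j i k (by lia)) :=
    tι_desc (fun i j h => bSign i j • ((β_ (X.X i) (Y.X j)).hom ≫ tι Y X j i k (by lia))) i j h
  refine (congrArg (fun f : X.X i ⊗ Y.X j ⟶ (Y ⊗ X).X k =>
    f.hom (x ⊗ₜ[ℚ] y : TensorProduct ℚ _ _)) h₁).trans ?_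
  exact units_smul_hom _ _ _

lemma associator_tmul (i j l ij jl k : ℤ) (hij : i + j = ij) (hjl : j + l = jl) (h : ij + l = k)
    (x : (X.X i).V) (y : (Y.X j).V) (z : (Z.X l).V) :
    ((α_ X Y Z).hom.f k).hom (tmul (X ⊗ Y) Z ij l k h (tmul X Y i j ij hij x y) z) =
      tmul X (Y ⊗ Z) i jl k (by lia) x (tmul Y Z j l jl hjl y z) := by
  have h₁ : (tι X Y i j ij hij ▷ Z.X l ≫ tι (X ⊗ Y) Z ij l k h) ≫ (α_ X Y Z).hom.f k =
      (α_ (X.X i) (Y.X j) (Z.X l)).hom ≫ X.X i ◁ tι Y Z j l jl hjl ≫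
        tι X (Y ⊗ Z) i jl k (by lia) := by
    have h₂ := GradedObject.Monoidal.ιTensorObj₃'_associator_hom (C := Rep.{0} ℚ W)
      X.X Y.X Z.X i j l k (by lia)
    rw [GradedObject.Monoidal.ιTensorObj₃'_eq (C := Rep.{0} ℚ W) X.X Y.X Z.X i j l k (by lia) ij
      hij, GradedObject.Monoidal.ιTensorObj₃_eq (C := Rep.{0} ℚ W) X.X Y.X Z.X i j l k (by lia) jl
      hjl] at h₂
    exact h₂
  exact congrArg (fun f : (X.X i ⊗ Y.X j) ⊗ Z.X l ⟶ (X ⊗ (Y ⊗ Z)).X k =>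
    f.hom ((x ⊗ₜ[ℚ] y : TensorProduct ℚ (X.X i).V (Y.X j).V) ⊗ₜ[ℚ] z : TensorProduct ℚ
      (TensorProduct ℚ (X.X i).V (Y.X j).V) (Z.X l).V)) h₁

variable (W) in
/-- The unit element of `ℚ`, in degree zero. -/
def unitEl : ((𝟙_ (ChRep W)).X 0).V :=
  (HomologicalComplex.singleObjXSelf (ComplexShape.down ℤ) 0 (𝟙_ (Rep.{0} ℚ W))).inv.hom (1 : ℚ)

/-- The explicit formula available is for the inverse unitor, x ↦ 1 ⊗ x; it is then inverted. -/
lemma leftUnitor_tmul (k : ℤ) (x : (X.X k).V) :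
    ((λ_ X).hom.f k).hom (tmul (𝟙_ (ChRep W)) X 0 k k (zero_add k) (unitEl W) x) = x := by
  have h₁ : (λ_ X).inv.f k = (λ_ (X.X k)).inv ≫
      (HomologicalComplex.singleObjXSelf (ComplexShape.down ℤ) 0 (𝟙_ (Rep.{0} ℚ W))).inv ▷ X.X k ≫
        tι (𝟙_ (ChRep W)) X 0 k k (zero_add k) :=
    HomologicalComplex.leftUnitor'_inv X k
  have h₂ : ((λ_ X).inv.f k).hom x =
      tmul (𝟙_ (ChRep W)) X 0 k k (zero_add k) (unitEl W) x := by
    rw [h₁]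
    rfl
  rw [← h₂]
  exact congrArg (fun f : X ⟶ X => (f.f k).hom x) (λ_ X).inv_hom_id

lemma rightUnitor_tmul (k : ℤ) (x : (X.X k).V) :
    ((ρ_ X).hom.f k).hom (tmul X (𝟙_ (ChRep W)) k 0 k (add_zero k) x (unitEl W)) = x := by
  have h₁ : (ρ_ X).inv.f k = (ρ_ (X.X k)).inv ≫
      X.X k ◁ (HomologicalComplex.singleObjXSelf (ComplexShape.down ℤ) 0
        (𝟙_ (Rep.{0} ℚ W))).inv ≫ tι X (𝟙_ (ChRep W)) k 0 k (add_zero k) :=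
    HomologicalComplex.rightUnitor'_inv X k
  have h₂ : ((ρ_ X).inv.f k).hom x =
      tmul X (𝟙_ (ChRep W)) k 0 k (add_zero k) x (unitEl W) := by
    rw [h₁]
    rfl
  rw [← h₂]
  exact congrArg (fun f : X ⟶ X => (f.f k).hom x) (ρ_ X).inv_hom_id

variable (W) in
/-- Functions `W → V`, with the right translation action. -/
def funRep (V : Type) [AddCommGroup V] [Module ℚ V] : Rep.{0} ℚ W :=
  Rep.of (X := W → V)
    { toFun := fun g => LinearMap.funLeft ℚ V (fun h => h * g)
      map_one' := by
        ext f h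
        simp [LinearMap.funLeft]
      map_mul' := fun g g' => by
        ext f h
        simp [LinearMap.funLeft, mul_assoc] }

/-- Linear maps to `V` correspond to equivariant maps to `W → V`. -/
def toFunRep {U : Rep.{0} ℚ W} {V : Type} [AddCommGroup V] [Module ℚ V] (f : U.V →ₗ[ℚ] V) :
    U ⟶ funRep W V :=
  Rep.ofHom
    { toLinearMap := LinearMap.pi fun g => f ∘ₗ U.ρ g
      isIntertwining' := fun g => LinearMap.ext fun x => funext fun h => by
        change f (U.ρ h (U.ρ g x)) = f (U.ρ (h * g) x)
        rw [map_mul]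
        rfl }

lemma toFunRep_apply {U : Rep.{0} ℚ W} {V : Type} [AddCommGroup V] [Module ℚ V]
    (f : U.V →ₗ[ℚ] V) (x : U.V) (g : W) : ((toFunRep f).hom x : W → V) g = f (U.ρ g x) := rfl

variable {V : Type} [AddCommGroup V] [Module ℚ V]

/-- The universal property of X ⊗ Y concerns equivariant maps only. Passing to the coinduced
representation W → V turns linear maps into equivariant ones, and evaluation at 1 recovers them. -/
lemma tensor_lhom_ext {k : ℤ} {f g : ((X ⊗ Y).X k).V →ₗ[ℚ] V}
    (H : ∀ i j h x y, f (tmul X Y i j k h x y) = g (tmul X Y i j k h x y)) : f = g := by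
  have h₁ : toFunRep f = toFunRep g := by
    refine tensor_ext fun i j h => Rep.hom_ext (Representation.IntertwiningMap.ext ?_)
    refine TensorProduct.ext' fun x y => funext fun w => ?_
    change f (((X ⊗ Y).X k).ρ w (tmul X Y i j k h x y)) =
      g (((X ⊗ Y).X k).ρ w (tmul X Y i j k h x y))
    rw [ρ_tmul, H]
  refine LinearMap.ext fun x => ?_
  have h₂ := congrArg (fun φ : (X ⊗ Y).X k ⟶ funRep W V => (φ.hom x : W → V) 1) h₁
  have h₃ : ((X ⊗ Y).X k).ρ 1 x = x := by rw [map_one]; rfl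
  change f (((X ⊗ Y).X k).ρ 1 x) = g (((X ⊗ Y).X k).ρ 1 x) at h₂
  rwa [h₃] at h₂

/-- The linear map out of `(X ⊗ Y) k` with given values on the elements `x ⊗ y`. -/
def tLift {k : ℤ} (B : ∀ i j : ℤ, i + j = k → ((X.X i).V →ₗ[ℚ] (Y.X j).V →ₗ[ℚ] V)) :
    ((X ⊗ Y).X k).V →ₗ[ℚ] V :=
  (LinearMap.proj (R := ℚ) (φ := fun _ : W => V) 1) ∘ₗ
    (tDesc fun i j h => toFunRep (U := X.X i ⊗ Y.X j) (TensorProduct.lift (B i j h))).hom.toLinearMap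

lemma tLift_tmul {k : ℤ} (B : ∀ i j : ℤ, i + j = k → ((X.X i).V →ₗ[ℚ] (Y.X j).V →ₗ[ℚ] V))
    (i j : ℤ) (h : i + j = k) (x : (X.X i).V) (y : (Y.X j).V) :
    tLift B (tmul X Y i j k h x y) = B i j h x y := by
  have h₁ := congrArg (fun φ : X.X i ⊗ Y.X j ⟶ funRep W V =>
    (φ.hom (x ⊗ₜ[ℚ] y : TensorProduct ℚ _ _) : W → V) 1)
    (tι_desc (fun i j h => toFunRep (U := X.X i ⊗ Y.X j) (TensorProduct.lift (B i j h))) i j h)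
  refine h₁.trans ?_
  refine (toFunRep_apply (U := X.X i ⊗ Y.X j) (TensorProduct.lift (B i j h)) _ 1).trans ?_
  rw [map_one]
  exact TensorProduct.lift.tmul x y

end TensorElements

end RatG
end


noncomputable section

namespace RatG

/-! ### External products of functions on W^b and W^c. -/

section Join

variable {W : Type} [Group W] {b c : ℕ}

/-- The first `b` entries. -/
def firstPart (v : Fin (b + c) → W) : Fin b → W := fun i => v (Fin.castAdd c i)

/-- The last `c` entries. -/
def lastPart (v : Fin (b + c) → W) : Fin c → W := fun i => v (Fin.natAdd b i)

lemma append_parts (v : Fin (b + c) → W) : Fin.append (firstPart v) (lastPart v) = v := by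
  funext i
  refine Fin.addCases (fun j => ?_) (fun j => ?_) i
  · rw [Fin.append_left]
    rfl
  · rw [Fin.append_right]
    rfl

lemma firstPart_append (v : Fin b → W) (w : Fin c → W) : firstPart (Fin.append v w) = v :=
  funext fun i => Fin.append_left v w i

lemma lastPart_append (v : Fin b → W) (w : Fin c → W) : lastPart (Fin.append v w) = w :=
  funext fun i => Fin.append_right v w i

/-- The product `ℚ(W^b) × ℚ(W^c) → ℚ(W^(b+c))`. -/
def join (b c : ℕ) : ((cell W b).X 0).V →ₗ[ℚ] ((cell W c).X 0).V →ₗ[ℚ]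
    ((cell W (b + c)).X 0).V :=
  (((TensorProduct.mk ℚ _ _).compr₂ ((inCell W (b + c) 0).hom.toLinearMap ∘ₗ
    (joinEquiv W b c).toLinearMap)).compl₁₂ (outCell W b 0).hom.toLinearMap
      (outCell W c 0).hom.toLinearMap)

lemma join_apply (x : ((cell W b).X 0).V) (y : ((cell W c).X 0).V) :
    join b c x y = (inCell W (b + c) 0).hom (joinEquiv W b c
      ((outCell W b 0).hom x ⊗ₜ[ℚ] (outCell W c 0).hom y)) := rfl

lemma join_δ (v : Fin b → W) (w : Fin c → W) : join b c (δ v) (δ w) = δ (Fin.append v w) := by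
  rw [join_apply, outCell_δ, outCell_δ, joinEquiv_single]
  rfl

lemma joinIso_inv_single (v : Fin (b + c) → W) : (joinIso W b c).inv.hom
    (MonoidAlgebra.single v (1 : ℚ) : MonoidAlgebra ℚ (Fin (b + c) → W)) =
      (MonoidAlgebra.single (firstPart v) (1 : ℚ) ⊗ₜ[ℚ] MonoidAlgebra.single (lastPart v) (1 : ℚ) :
        TensorProduct ℚ (MonoidAlgebra ℚ (Fin b → W)) (MonoidAlgebra ℚ (Fin c → W))) := by
  refine (joinEquiv W b c).symm_apply_eq.2 ?_
  rw [joinEquiv_single, append_parts]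

lemma val_ofBase {a b : ℕ} (φ : Rep.diagonal ℚ W a ⟶ Rep.diagonal ℚ W b) (v : Fin a → W) :
    val (ofBase 0 φ) v = (inCell W b 0).hom (φ.hom
      (MonoidAlgebra.single v (1 : ℚ) : MonoidAlgebra ℚ (Fin a → W))) := by
  change (inCell W b 0).hom (φ.hom ((outCell W a 0).hom (δ v))) = _
  rw [outCell_δ]

lemma val_cellTensor {b' c' : ℕ} (f : fixedHom (cell W b) (cell W b') 0)
    (g : fixedHom (cell W c) (cell W c') 0) (v : Fin (b + c) → W) :
    val (cellTensor 0 f g) v = join b' c' (val f (firstPart v)) (val g (lastPart v)) := by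
  refine (val_ofBase _ v).trans ?_
  refine (congrArg (fun x => (inCell W (b' + c') 0).hom ((joinIso W b' c').hom.hom
    ((toBase f ⊗ₘ toBase g).hom x))) (joinIso_inv_single v)).trans ?_
  rfl

lemma val_reindex {m n : ℕ} (σ : Fin n → Fin m) (v : Fin m → W) :
    val (ofBase 0 (reindex W σ)) v = δ (v ∘ σ) := by
  rw [val_ofBase]
  refine congrArg (inCell W n 0).hom ?_
  change MonoidAlgebra.mapDomainLinearMap ℚ ℚ (fun w : Fin m → W => w ∘ σ)
    (MonoidAlgebra.single v (1 : ℚ)) = _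
  simp

lemma toBase_zero {a b : ℕ} {r : ℤ} : toBase (0 : fixedHom (cell W a) (cell W b) r) = 0 := by
  refine base_ext fun w => ?_
  exact map_zero (outCell W b (0 + r)).hom

lemma ofBase_zero {a b : ℕ} (r : ℤ) :
    ofBase r (0 : Rep.diagonal ℚ W a ⟶ Rep.diagonal ℚ W b) = 0 := by
  refine fixed_ext fun k l h x => ?_
  exact map_zero (inCell W b l).hom

lemma cellTensor_zero_left {b' c' : ℕ} {p q r : ℤ} (g : fixedHom (cell W c) (cell W c') q) :
    cellTensor r (0 : fixedHom (cell W b) (cell W b') p) g = 0 := by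
  rw [cellTensor, toBase_zero, MonoidalCategory.tensorHom_def,
    MonoidalPreadditive.zero_whiskerRight, zero_comp, zero_comp, comp_zero]
  exact ofBase_zero r

lemma cellTensor_zero_right {b' c' : ℕ} {p q r : ℤ} (f : fixedHom (cell W b) (cell W b') p) :
    cellTensor r f (0 : fixedHom (cell W c) (cell W c') q) = 0 := by
  rw [cellTensor, toBase_zero, MonoidalCategory.tensorHom_def,
    MonoidalPreadditive.whiskerLeft_zero, comp_zero, zero_comp, comp_zero]
  exact ofBase_zero r

/-- The product of two maps, as a function. -/
def homMulFun (X Y : ChRep W) (b c : ℕ) (p q r : ℤ) (h : p + q = r)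
    (f : fixedHom (cell W b) X p) (g : fixedHom (cell W c) Y q) :
    fixedHom (cell W (b + c)) (X ⊗ Y) r :=
  mkVal (X := X ⊗ Y) (fun v => tmul X Y p q r h (val f (firstPart v)) (val g (lastPart v)))
    (fun w v => by
      have h₁ : val f (firstPart (w • v)) = (X.X p).ρ w (val f (firstPart v)) :=
        val_ρ f w (firstPart v)
      have h₂ : val g (lastPart (w • v)) = (Y.X q).ρ w (val g (lastPart v)) :=
        val_ρ g w (lastPart v)
      rw [h₁, h₂]
      exact (ρ_tmul p q r h w _ _).symm)

lemma val_homMulFun (X Y : ChRep W) (b c : ℕ) (p q r : ℤ) (h : p + q = r)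
    (f : fixedHom (cell W b) X p) (g : fixedHom (cell W c) Y q) (v : Fin (b + c) → W) :
    val (homMulFun X Y b c p q r h f g) v =
      tmul X Y p q r h (val f (firstPart v)) (val g (lastPart v)) := val_mkVal _ _ _

lemma homMulFun_add_left (X Y : ChRep W) (b c : ℕ) (p q r : ℤ) (h : p + q = r)
    (f f' : fixedHom (cell W b) X p) (g : fixedHom (cell W c) Y q) :
    homMulFun X Y b c p q r h (f + f') g =
      homMulFun X Y b c p q r h f g + homMulFun X Y b c p q r h f' g := by
  refine val_ext fun v => (val_homMulFun X Y b c p q r h _ _ v).trans ?_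
  refine Eq.trans ?_ (congrArg₂ (· + ·) (val_homMulFun X Y b c p q r h f g v)
    (val_homMulFun X Y b c p q r h f' g v)).symm
  exact LinearMap.map_add₂ (tmul X Y p q r h) _ _ _

lemma homMulFun_smul_left (X Y : ChRep W) (b c : ℕ) (p q r : ℤ) (h : p + q = r) (s : ℚ)
    (f : fixedHom (cell W b) X p) (g : fixedHom (cell W c) Y q) :
    homMulFun X Y b c p q r h (s • f) g = s • homMulFun X Y b c p q r h f g := by
  refine val_ext fun v => (val_homMulFun X Y b c p q r h _ _ v).trans ?_
  refine Eq.trans ?_ (congrArg (s • ·) (val_homMulFun X Y b c p q r h f g v)).symm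
  exact LinearMap.map_smul₂ (tmul X Y p q r h) _ _ _

lemma homMulFun_add_right (X Y : ChRep W) (b c : ℕ) (p q r : ℤ) (h : p + q = r)
    (f : fixedHom (cell W b) X p) (g g' : fixedHom (cell W c) Y q) :
    homMulFun X Y b c p q r h f (g + g') =
      homMulFun X Y b c p q r h f g + homMulFun X Y b c p q r h f g' := by
  refine val_ext fun v => (val_homMulFun X Y b c p q r h _ _ v).trans ?_
  refine Eq.trans ?_ (congrArg₂ (· + ·) (val_homMulFun X Y b c p q r h f g v)
    (val_homMulFun X Y b c p q r h f g' v)).symm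
  exact map_add (tmul X Y p q r h _) _ _

lemma homMulFun_smul_right (X Y : ChRep W) (b c : ℕ) (p q r : ℤ) (h : p + q = r) (s : ℚ)
    (f : fixedHom (cell W b) X p) (g : fixedHom (cell W c) Y q) :
    homMulFun X Y b c p q r h f (s • g) = s • homMulFun X Y b c p q r h f g := by
  refine val_ext fun v => (val_homMulFun X Y b c p q r h _ _ v).trans ?_
  refine Eq.trans ?_ (congrArg (s • ·) (val_homMulFun X Y b c p q r h f g v)).symm
  exact map_smul (tmul X Y p q r h _) _ _

/-- The product `Hom(ℚ(W^b), X) × Hom(ℚ(W^c), Y) → Hom(ℚ(W^(b+c)), X ⊗ Y)`. -/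
def homMul (X Y : ChRep W) (b c : ℕ) (p q r : ℤ) (h : p + q = r) :
    fixedHom (cell W b) X p →ₗ[ℚ] fixedHom (cell W c) Y q →ₗ[ℚ]
      fixedHom (cell W (b + c)) (X ⊗ Y) r :=
  LinearMap.mk₂ ℚ (homMulFun X Y b c p q r h) (homMulFun_add_left X Y b c p q r h)
    (homMulFun_smul_left X Y b c p q r h) (homMulFun_add_right X Y b c p q r h)
    (homMulFun_smul_right X Y b c p q r h)

variable {X Y : ChRep W}

lemma val_homMul (p q r : ℤ) (h : p + q = r) (f : fixedHom (cell W b) X p)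
    (g : fixedHom (cell W c) Y q) (v : Fin (b + c) → W) :
    val (homMul X Y b c p q r h f g) v =
      tmul X Y p q r h (val f (firstPart v)) (val g (lastPart v)) :=
  val_homMulFun X Y b c p q r h f g v

/-- Linear maps out of `ℚ(W^b) ⊗ ℚ(W^c)` are determined on the basis. -/
lemma cell_bilin_ext {V : Type} [AddCommGroup V] [Module ℚ V]
    {f g : ((cell W b).X 0).V →ₗ[ℚ] ((cell W c).X 0).V →ₗ[ℚ] V}
    (H : ∀ v w, f (δ v) (δ w) = g (δ v) (δ w)) : f = g :=
  cell_lhom_ext fun v => cell_lhom_ext fun w => H v w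

/-- The product is defined on basis elements; this is its bilinear extension. It is needed for
composites, since maps in 𝓔 send basis elements to linear combinations. -/
lemma ev_homMul_join (p q r : ℤ) (h : p + q = r) (f : fixedHom (cell W b) X p)
    (g : fixedHom (cell W c) Y q) (x : ((cell W b).X 0).V) (y : ((cell W c).X 0).V) :
    ev (homMul X Y b c p q r h f g) 0 r (zero_add r) (join b c x y) =
      tmul X Y p q r h (ev f 0 p (zero_add p) x) (ev g 0 q (zero_add q) y) := by
  have := cell_bilin_ext
    (f := (join b c).compr₂ (ev (homMul X Y b c p q r h f g) 0 r (zero_add r)))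
    (g := (tmul X Y p q r h).compl₁₂ (ev f 0 p (zero_add p)) (ev g 0 q (zero_add q)))
    (fun v w => by
      refine (congrArg (ev (homMul X Y b c p q r h f g) 0 r (zero_add r)) (join_δ v w)).trans ?_
      refine (val_homMul p q r h f g (Fin.append v w)).trans ?_
      rw [firstPart_append, lastPart_append]
      rfl)
  exact LinearMap.congr_fun (LinearMap.congr_fun this x) y

lemma homD_homMul (p q r : ℤ) (h : p + q = r) (f : fixedHom (cell W b) X p)
    (g : fixedHom (cell W c) Y q) :
    homD (cell W (b + c)) (X ⊗ Y) r (r - 1) (homMul X Y b c p q r h f g) =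
      homMul X Y b c (p - 1) q (r - 1) (by lia) (homD (cell W b) X p (p - 1) f) g +
      p.negOnePow • homMul X Y b c p (q - 1) (r - 1) (by lia) f
        (homD (cell W c) Y q (q - 1) g) := by
  refine val_ext fun v => ?_
  refine (val_homD r (r - 1) (homMul X Y b c p q r h f g) v).trans ?_
  refine (congrArg (dV (X ⊗ Y) r (r - 1)) (val_homMul p q r h f g v)).trans ?_
  refine (dV_tmul p q r (p - 1) (q - 1) (r - 1) h (by lia) (by lia) (by lia) _ _).trans ?_
  refine Eq.symm (congrArg₂ (· + ·)
    ((val_homMul (p - 1) q (r - 1) (by lia) (homD (cell W b) X p (p - 1) f) g v).trans ?_)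
    (congrArg (p.negOnePow • ·) ((val_homMul p (q - 1) (r - 1) (by lia) f
      (homD (cell W c) Y q (q - 1) g) v).trans ?_)))
  · rw [val_homD]
  · rw [val_homD]

lemma homMul_compFixed {b' c' : ℕ} (p q r : ℤ) (h : p + q = r) (m : fixedHom (cell W b') X p)
    (n : fixedHom (cell W c') Y q) (f : fixedHom (cell W b) (cell W b') 0)
    (g : fixedHom (cell W c) (cell W c') 0) :
    compFixed r 0 r (add_zero r) (homMul X Y b' c' p q r h m n) (cellTensor 0 f g) =
      homMul X Y b c p q r h (compFixed p 0 p (add_zero p) m f)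
        (compFixed q 0 q (add_zero q) n g) := by
  refine val_ext fun v => ?_
  refine (val_comp (homMul X Y b' c' p q r h m n) (cellTensor 0 f g) v).trans ?_
  refine (congrArg (ev (homMul X Y b' c' p q r h m n) 0 r (zero_add r))
    (val_cellTensor f g v)).trans ?_
  refine (ev_homMul_join p q r h m n _ _).trans ?_
  refine Eq.trans ?_ (val_homMul p q r h (compFixed p 0 p (add_zero p) m f)
    (compFixed q 0 q (add_zero q) n g) v).symm
  rw [val_comp, val_comp]

end Join

/-! ### The isomorphism M ≅ Hom(𝒢, L M) in terms of elements. -/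

section Unit

variable {W : Type} [Group W] [Finite W]

/-- The isomorphism `M ≅ Hom(𝒢, L M)` in degree `p`. -/
def η (M : CellMod W) (a : ℕ) (p : ℤ) :
    (M.obj a).X p →ₗ[ℚ] fixedHom (cell W a) ((cellL W).obj M) p :=
  homApp ((cellEquiv W).counitIso.inv.app M) a p

/-- The components of a map of modules. -/
def mapp {M N : CellMod W} (f : M ⟶ N) (a : ℕ) (p : ℤ) : (M.obj a).X p →ₗ[ℚ] (N.obj a).X p :=
  ((f.app a).f p).hom

variable (M N : CellMod W)

/-- The inverse of `η`. -/
def ηInv (a : ℕ) (p : ℤ) : fixedHom (cell W a) ((cellL W).obj M) p →ₗ[ℚ] (M.obj a).X p :=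
  mapp ((cellEquiv W).counitIso.hom.app M) a p

lemma η_ηInv (a : ℕ) (p : ℤ) (z : fixedHom (cell W a) ((cellL W).obj M) p) :
    η M a p (ηInv M a p z) = z :=
  congrArg (fun f : (cellF W).obj ((cellL W).obj M) ⟶ (cellF W).obj ((cellL W).obj M) =>
    homApp f a p z) ((cellEquiv W).counitIso.hom_inv_id_app M)

lemma ηInv_η (a : ℕ) (p : ℤ) (m : (M.obj a).X p) : ηInv M a p (η M a p m) = m :=
  congrArg (fun f : M ⟶ M => mapp f a p m) ((cellEquiv W).counitIso.inv_hom_id_app M)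

lemma η_injective (a : ℕ) (p : ℤ) : Function.Injective (η M a p) :=
  Function.LeftInverse.injective (ηInv_η M a p)

variable {M N}

lemma η_mact {a b : ℕ} (p : ℤ) (f : fixedHom (cell W a) (cell W b) 0) (m : (M.obj b).X p) :
    η M a p (mact M p f m) = compFixed p 0 p (add_zero p) (η M b p m) f :=
  hom_mact ((cellEquiv W).counitIso.inv.app M) p f m

lemma η_d (a : ℕ) (p q : ℤ) (m : (M.obj a).X p) :
    η M a q (((M.obj a).d p q).hom m) = homD (cell W a) _ p q (η M a p m) :=
  homApp_d ((cellEquiv W).counitIso.inv.app M) a p q m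

lemma val_η_mapp (f : M ⟶ N) (a : ℕ) (p : ℤ) (m : (M.obj a).X p) (w : Fin a → W) :
    val (η N a p (mapp f a p m)) w = (((cellL W).map f).f p).hom (val (η M a p m) w) :=
  congrArg (fun g : M ⟶ (cellF W).obj ((cellL W).obj N) => val (homApp g a p m) w)
    ((cellEquiv W).counitIso.inv.naturality f)

/-- On modules Hom(𝒢, X) the triangle identity expresses the inverse counit through the unit of the
equivalence. -/
lemma val_η_F (X : ChRep W) (a : ℕ) (p : ℤ) (z : fixedHom (cell W a) X p) (w : Fin a → W) :
    val (η ((cellF W).obj X) a p z) w =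
      (((cellEquiv W).unitIso.hom.app X).f p).hom (val z w) := by
  have h₁ : (cellEquiv W).counitIso.inv.app ((cellF W).obj X) =
      (cellF W).map ((cellEquiv W).unitIso.hom.app X) :=
    (cellEquiv W).counitInv_app_functor X
  exact congrArg (fun g : (cellF W).obj X ⟶ (cellF W).obj ((cellL W).obj ((cellF W).obj X)) =>
    val (homApp g a p z) w) h₁

end Unit

end RatG
end


noncomputable section

namespace RatG

/-! ### The product m ⊗ n and its compatibility with the structure maps. -/

section BoxStructure

variable {W : Type} [Group W] [Finite W] (M N K : CellMod W)

/-- The product of elements of right modules. -/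
def boxEl (b c : ℕ) (p q r : ℤ) (h : p + q = r) : (M.obj b).X p →ₗ[ℚ] (N.obj c).X q →ₗ[ℚ]
    fixedHom (cell W (b + c)) ((cellL W).obj M ⊗ (cellL W).obj N) r :=
  (homMul ((cellL W).obj M) ((cellL W).obj N) b c p q r h).compl₁₂ (η M b p) (η N c q)

variable {M N K}

lemma val_boxEl (b c : ℕ) (p q r : ℤ) (h : p + q = r) (m : (M.obj b).X p)
    (n : (N.obj c).X q) (v : Fin (b + c) → W) : val (boxEl M N b c p q r h m n) v =
      tmul ((cellL W).obj M) ((cellL W).obj N) p q r h (val (η M b p m) (firstPart v))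
        (val (η N c q n) (lastPart v)) :=
  val_homMul p q r h (η M b p m) (η N c q n) v

lemma boxEl_d (b c : ℕ) (p q r : ℤ) (h : p + q = r) (m : (M.obj b).X p) (n : (N.obj c).X q) :
    homD (cell W (b + c)) ((cellL W).obj M ⊗ (cellL W).obj N) r (r - 1)
        (boxEl M N b c p q r h m n) =
      boxEl M N b c (p - 1) q (r - 1) (by lia) (((M.obj b).d p (p - 1)).hom m) n +
      p.negOnePow • boxEl M N b c p (q - 1) (r - 1) (by lia) m
        (((N.obj c).d q (q - 1)).hom n) := by
  refine (homD_homMul p q r h (η M b p m) (η N c q n)).trans ?_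
  exact congrArg₂ (fun x y => x + p.negOnePow • y)
    (congrArg (fun x => homMul ((cellL W).obj M) ((cellL W).obj N) b c (p - 1) q (r - 1) (by lia) x
      (η N c q n)) (η_d b p (p - 1) m).symm)
    (congrArg (homMul ((cellL W).obj M) ((cellL W).obj N) b c p (q - 1) (r - 1) (by lia)
      (η M b p m)) (η_d c q (q - 1) n).symm)

variable (M N) in
/-- The product as a bilinear chain map. -/
def boxMul (b c : ℕ) : DGBilin (M.obj b) (N.obj c) ((M ⊗ N).obj (b + c)) where
  app p q r h := boxEl M N b c p q r h
  d_app p q r h m n := boxEl_d b c p q r h m n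

lemma boxEl_mact (b c b' c' : ℕ) (p q r : ℤ) (h : p + q = r) (m : (M.obj b').X p)
    (n : (N.obj c').X q) (f : fixedHom (cell W b) (cell W b') 0)
    (g : fixedHom (cell W c) (cell W c') 0) :
    compFixed r 0 r (add_zero r) (boxEl M N b' c' p q r h m n) (cellTensor 0 f g) =
      boxEl M N b c p q r h (mact M p f m) (mact N q g n) := by
  refine (homMul_compFixed p q r h (η M b' p m) (η N c' q n) f g).trans ?_
  exact congrArg₂ (fun x y => homMul ((cellL W).obj M) ((cellL W).obj N) b c p q r h x y)
    (η_mact p f m).symm (η_mact q g n).symm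

lemma cellAct_zero_right {a b : ℕ} (p q r : ℤ) (h : p + q = r) (m : (M.obj b).X p) :
    cellAct M a b p q r h m (0 : fixedHom (cell W a) (cell W b) q) = 0 :=
  map_zero ((M.act a b).app p q r h m)

/-- Both sides vanish unless s = t = 0, where the sign is trivial and naturality of the external
product applies. -/
lemma boxMul_act (b c b' c' : ℕ) (p q s t pq ps qt st v : ℤ) (hpq : p + q = pq)
    (hps : p + s = ps) (hqt : q + t = qt) (hst : s + t = st) (hv : pq + st = v)
    (m : (M.obj b').X p) (n : (N.obj c').X q) (f : fixedHom (cell W b) (cell W b') s)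
    (g : fixedHom (cell W c) (cell W c') t) :
    cellAct (M ⊗ N) (b + c) (b' + c') pq st v hv ((boxMul M N b' c').app p q pq hpq m n)
        (cellTensor st f g) =
      (q * s).negOnePow • (boxMul M N b c).app ps qt v (by lia) (cellAct M b b' p s ps hps m f)
        (cellAct N c c' q t qt hqt n g) := by
  by_cases hs : s = 0
  · by_cases ht : t = 0
    · subst hs ht
      obtain rfl : p = ps := by lia
      obtain rfl : q = qt := by lia
      obtain rfl : st = 0 := by lia
      obtain rfl : pq = v := by lia
      rw [mul_zero, Int.negOnePow_zero, one_smul]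
      exact boxEl_mact b c b' c' p q pq hpq m n f g
    · obtain rfl := cell_hom_eq_zero ht g
      rw [cellTensor_zero_right, cellAct_zero_right, cellAct_zero_right, map_zero, smul_zero]
  · obtain rfl := cell_hom_eq_zero hs f
    rw [cellTensor_zero_left, cellAct_zero_right, cellAct_zero_right, map_zero,
      LinearMap.zero_apply, smul_zero]

lemma boxMul_natural {M' N' : CellMod W} (f : M ⟶ M') (g : N ⟶ N') (b c : ℕ) (p q r : ℤ)
    (h : p + q = r) (m : (M.obj b).X p) (n : (N.obj c).X q) :
    mapp (f ⊗ₘ g) (b + c) r (boxEl M N b c p q r h m n) =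
      boxEl M' N' b c p q r h (mapp f b p m) (mapp g c q n) := by
  refine val_ext (X := (cellL W).obj M' ⊗ (cellL W).obj N') fun v => ?_
  refine (congrArg ((((cellL W).map f ⊗ₘ (cellL W).map g).f r).hom)
    (val_boxEl b c p q r h m n v)).trans ?_
  refine (tensorHom_tmul _ _ p q r h _ _).trans ?_
  refine Eq.trans ?_ (val_boxEl b c p q r h (mapp f b p m) (mapp g c q n) v).symm
  rw [val_η_mapp, val_η_mapp]

lemma boxMul_braiding (b c : ℕ) (p q r : ℤ) (h : p + q = r) (m : (M.obj b).X p)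
    (n : (N.obj c).X q) :
    mapp (β_ M N).hom (b + c) r (boxEl M N b c p q r h m n) =
      (p * q).negOnePow • mact (N ⊗ M) r (cellBraid W b c)
        (boxEl N M c b q p r (by lia) n m) := by
  refine val_ext (X := (cellL W).obj N ⊗ (cellL W).obj M) fun v => ?_
  refine (congrArg (((β_ ((cellL W).obj M) ((cellL W).obj N)).hom.f r).hom)
    (val_boxEl b c p q r h m n v)).trans ?_
  refine (braiding_tmul p q r h _ _).trans ?_
  refine congrArg ((p * q).negOnePow • ·) (Eq.symm ?_)
  refine (val_mact _ r (cellBraid W b c) (boxEl N M c b q p r (by lia) n m) v).trans ?_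
  refine (congrArg (ev (boxEl N M c b q p r (by lia) n m) 0 r (zero_add r))
    (val_reindex finAddFlip v)).trans ?_
  refine (val_boxEl c b q p r (by lia) n m (v ∘ finAddFlip)).trans ?_
  -- The flip exchanges the two blocks: the first part of the flipped word is the last part of v,
  -- and conversely.
  refine congrArg₂ (fun x y => tmul _ _ q p r (by lia) (val (η N c q n) x) (val (η M b p m) y))
    (funext fun i => ?_) (funext fun i => ?_)
  · exact congrArg v (finAddFlip_apply_castAdd i b)
  · exact congrArg v (finAddFlip_apply_natAdd i c)

/-- M ⊗ N is already of the form Hom(𝒢, X), so applying η to it inserts the unit isomorphism at X =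
L M ⊗ L N. -/
lemma val_η_boxMul (b c : ℕ) (p q r : ℤ) (h : p + q = r) (m : (M.obj b).X p)
    (n : (N.obj c).X q) (w : Fin (b + c) → W) :
    val (η (M ⊗ N) (b + c) r ((boxMul M N b c).app p q r h m n)) w =
      (((cellEquiv W).unitIso.hom.app ((cellL W).obj M ⊗ (cellL W).obj N)).f r).hom
        (tmul _ _ p q r h (val (η M b p m) (firstPart w)) (val (η N c q n) (lastPart w))) :=
  (val_η_F _ (b + c) r (boxEl M N b c p q r h m n) w).trans
    (congrArg (((cellEquiv W).unitIso.hom.app ((cellL W).obj M ⊗ (cellL W).obj N)).f r).hom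
      (val_boxEl b c p q r h m n w))

lemma unit_inv_hom (X : ChRep W) (r : ℤ) (x : (X.X r).V) :
    (((cellEquiv W).unitIso.inv.app X).f r).hom
      ((((cellEquiv W).unitIso.hom.app X).f r).hom x) = x :=
  congrArg (fun φ : X ⟶ X => (φ.f r).hom x) ((cellEquiv W).unitIso.hom_inv_id_app X)

-- The transported associator is that of complexes, conjugated by unit isomorphisms on the inner
-- tensor products. Here x and y stand for m ⊗ n and n ⊗ k; only their values, up to these
-- isomorphisms, enter. Both bracketings cut a word of W^(b+c+d) into the same three blocks.
set_option maxHeartbeats 1600000 in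
lemma boxEl_associator (b c d : ℕ) (p q r pq qr s : ℤ) (hpq : p + q = pq)
    (hqr : q + r = qr) (h : pq + r = s) (m : (M.obj b).X p) (n : (N.obj c).X q)
    (k : (K.obj d).X r) (x : ((M ⊗ N).obj (b + c)).X pq) (y : ((N ⊗ K).obj (c + d)).X qr)
    (hx : ∀ w, (((cellEquiv W).unitIso.inv.app
      ((cellL W).obj M ⊗ (cellL W).obj N)).f pq).hom (val (η (M ⊗ N) (b + c) pq x) w) =
        tmul _ _ p q pq hpq (val (η M b p m) (firstPart w)) (val (η N c q n) (lastPart w)))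
    (hy : ∀ w, val (η (N ⊗ K) (c + d) qr y) w =
      (((cellEquiv W).unitIso.hom.app ((cellL W).obj N ⊗ (cellL W).obj K)).f qr).hom
        (tmul _ _ q r qr hqr (val (η N c q n) (firstPart w)) (val (η K d r k) (lastPart w)))) :
    mapp (α_ M N K).hom (b + c + d) s (boxEl (M ⊗ N) K (b + c) d pq r s h x k) =
      mact (M ⊗ (N ⊗ K)) s (cellAssoc W b c d)
        (boxEl M (N ⊗ K) b (c + d) p qr s (by lia) m y) := by
  refine val_ext (X := (cellL W).obj M ⊗ (cellL W).obj (N ⊗ K)) fun v => ?_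
  refine Eq.trans ?_ (val_mact _ s (cellAssoc W b c d)
    (boxEl M (N ⊗ K) b (c + d) p qr s (by lia) m y) v).symm
  refine Eq.trans ?_ (congrArg (ev (boxEl M (N ⊗ K) b (c + d) p qr s (by lia) m y) 0 s
    (zero_add s)) (val_reindex _ v)).symm
  refine Eq.trans ?_ (val_boxEl (M := M) (N := N ⊗ K) b (c + d) p qr s (by lia) m y _).symm
  refine (congrArg (((((cellEquiv W).unitIso.inv.app ((cellL W).obj M ⊗ (cellL W).obj N) ▷
      (cellL W).obj K ≫ (α_ ((cellL W).obj M) ((cellL W).obj N) ((cellL W).obj K)).hom ≫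
        (cellL W).obj M ◁ (cellEquiv W).unitIso.hom.app ((cellL W).obj N ⊗ (cellL W).obj K))).f
          s).hom) (val_boxEl (M := M ⊗ N) (N := K) (b + c) d pq r s h x k v)).trans ?_
  refine (congrArg (fun z => (((cellL W).obj M ◁ (cellEquiv W).unitIso.hom.app
    ((cellL W).obj N ⊗ (cellL W).obj K)).f s).hom
      (((α_ ((cellL W).obj M) ((cellL W).obj N) ((cellL W).obj K)).hom.f s).hom z))
        ((whiskerRight_tmul ((cellEquiv W).unitIso.inv.app
          ((cellL W).obj M ⊗ (cellL W).obj N)) pq r s h _ _).trans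
            (congrArg (fun z => tmul _ _ pq r s h z (val (η K d r k) (lastPart v)))
              (hx (firstPart v))))).trans ?_
  refine (congrArg (((cellL W).obj M ◁ (cellEquiv W).unitIso.hom.app
    ((cellL W).obj N ⊗ (cellL W).obj K)).f s).hom
      (associator_tmul p q r pq qr s hpq hqr h _ _ _)).trans ?_
  refine (whiskerLeft_tmul _ p qr s (by lia) _ _).trans ?_
  refine congrArg (tmul ((cellL W).obj M) ((cellL W).obj (N ⊗ K)) p qr s (by lia)
    (val (η M b p m) (firstPart (firstPart v)))) ?_
  refine Eq.trans ?_ (hy (lastPart (v ∘ Fin.cast (Nat.add_assoc b c d).symm))).symm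
  have h₁ : lastPart (firstPart v) =
      firstPart (lastPart (v ∘ Fin.cast (Nat.add_assoc b c d).symm)) :=
    funext fun i => congrArg v (Fin.ext rfl)
  have h₂ : lastPart v = lastPart (lastPart (v ∘ Fin.cast (Nat.add_assoc b c d).symm)) :=
    funext fun i => congrArg v (Fin.ext (by simp [Nat.add_assoc]))
  have h₃ : tmul ((cellL W).obj N) ((cellL W).obj K) q r qr hqr
      (val (η N c q n) (lastPart (firstPart v))) (val (η K d r k) (lastPart v)) =
      tmul ((cellL W).obj N) ((cellL W).obj K) q r qr hqr
        (val (η N c q n) (firstPart (lastPart (v ∘ Fin.cast (Nat.add_assoc b c d).symm))))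
        (val (η K d r k) (lastPart (lastPart (v ∘ Fin.cast (Nat.add_assoc b c d).symm)))) := by
    rw [← h₁, ← h₂]
  exact congrArg (fun z => (((cellEquiv W).unitIso.hom.app
    ((cellL W).obj N ⊗ (cellL W).obj K)).f qr).hom z) h₃

lemma boxMul_associator (b c d : ℕ) (p q r pq qr s : ℤ) (hpq : p + q = pq)
    (hqr : q + r = qr) (h : pq + r = s) (m : (M.obj b).X p) (n : (N.obj c).X q)
    (k : (K.obj d).X r) :
    mapp (α_ M N K).hom (b + c + d) s (boxEl (M ⊗ N) K (b + c) d pq r s h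
        ((boxMul M N b c).app p q pq hpq m n) k) =
      mact (M ⊗ (N ⊗ K)) s (cellAssoc W b c d) (boxEl M (N ⊗ K) b (c + d) p qr s (by lia) m
        ((boxMul N K c d).app q r qr hqr n k)) :=
  boxEl_associator b c d p q r pq qr s hpq hqr h m n k _ _
    (fun w => (congrArg (((cellEquiv W).unitIso.inv.app
      ((cellL W).obj M ⊗ (cellL W).obj N)).f pq).hom (val_η_boxMul b c p q pq hpq m n w)).trans
        (unit_inv_hom _ pq _))
    (fun w => val_η_boxMul c d q r qr hqr n k w)

end BoxStructure

end RatG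
end


noncomputable section

namespace RatG

/-! ### The unit of the box product. -/

section BoxUnit

variable {W : Type} [Group W]

variable (W) in
/-- `ℚ(W^0) ≃ ℚ`. -/
def diagonalZeroEquiv : MonoidAlgebra ℚ (Fin 0 → W) ≃ₗ[ℚ] ℚ :=
  MonoidAlgebra.coeffLinearEquiv ℚ ≪≫ₗ Finsupp.uniqueLinearEquiv ℚ ℚ (default : Fin 0 → W)

lemma diagonalZeroEquiv_single (v : Fin 0 → W) :
    diagonalZeroEquiv W (MonoidAlgebra.single v 1) = 1 := by
  obtain rfl := Subsingleton.elim v default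
  simp [diagonalZeroEquiv, Finsupp.uniqueLinearEquiv]

variable (W) in
/-- `ℚ(W^0) ≅ ℚ` as representations. -/
def diagonalZeroIso : Rep.diagonal ℚ W 0 ≅ 𝟙_ (Rep.{0} ℚ W) :=
  Rep.mkIso <| Representation.Equiv.mk (diagonalZeroEquiv W) (fun g => by
    apply MonoidAlgebra.lhom_ext'
    intro v
    apply LinearMap.ext_ring
    change diagonalZeroEquiv W
      (Representation.ofMulAction ℚ W (Fin 0 → W) g (MonoidAlgebra.single v 1)) =
        diagonalZeroEquiv W (MonoidAlgebra.single v 1)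
    rw [Representation.ofMulAction_single, diagonalZeroEquiv_single, diagonalZeroEquiv_single])

variable (W) in
/-- `ℚ(W^0) ≅ ℚ` as complexes. -/
def cellZeroIso : cell W 0 ≅ 𝟙_ (ChRep W) :=
  (HomologicalComplex.single (Rep.{0} ℚ W) (ComplexShape.down ℤ) 0).mapIso (diagonalZeroIso W)

lemma cellZeroIso_δ (v : Fin 0 → W) : ((cellZeroIso W).hom.f 0).hom (δ v) = unitEl W := by
  have h₁ : (cellZeroIso W).hom.f 0 =
      (HomologicalComplex.singleObjXSelf (ComplexShape.down ℤ) 0 (Rep.diagonal ℚ W 0)).hom ≫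
        (diagonalZeroIso W).hom ≫ (HomologicalComplex.singleObjXSelf
          (ComplexShape.down ℤ) 0 (𝟙_ (Rep.{0} ℚ W))).inv :=
    HomologicalComplex.single_map_f_self _ _ _
  rw [h₁]
  refine congrArg (HomologicalComplex.singleObjXSelf
    (ComplexShape.down ℤ) 0 (𝟙_ (Rep.{0} ℚ W))).inv.hom ?_
  refine Eq.trans ?_ (diagonalZeroEquiv_single v)
  exact congrArg (diagonalZeroEquiv W) (outCell_δ v)

variable [Finite W]

variable (W) in
/-- The free module on `ℚ` is the unit. -/
def boxUnitIso : RightModule.free (E := cellCat W) (0 : ℕ) ≅ 𝟙_ (CellMod W) :=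
  (cellF W).mapIso (cellZeroIso W)

variable (W) in
/-- The unit element. -/
def boxUnitEl : ((𝟙_ (CellMod W)).obj (0 : ℕ)).X 0 :=
  (((boxUnitIso W).hom.app (0 : ℕ)).f 0).hom (homOne (cell W 0))

lemma val_η_boxUnitEl (v : Fin 0 → W) : val (η (𝟙_ (CellMod W)) 0 0 (boxUnitEl W)) v =
    (((cellEquiv W).unitIso.hom.app (𝟙_ (ChRep W))).f 0).hom (unitEl W) := by
  refine (val_η_F (𝟙_ (ChRep W)) 0 0 _ v).trans ?_
  refine congrArg (((cellEquiv W).unitIso.hom.app (𝟙_ (ChRep W))).f 0).hom ?_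
  refine (val_homPost (cellZeroIso W).hom 0 (homOne (cell W 0)) v).trans ?_
  rw [val_homOne, cellZeroIso_δ]

variable {M : CellMod W}

lemma val_η_mact {a b : ℕ} (p : ℤ) (σ : Fin a → Fin b) (m : (M.obj a).X p) (v : Fin b → W) :
    val (η M b p (mact M p (ofBase 0 (reindex W σ)) m)) v = val (η M a p m) (v ∘ σ) := by
  rw [η_mact, val_comp, val_reindex]
  rfl

lemma boxMul_leftUnitor (c : ℕ) (q : ℤ) (n : (M.obj c).X q) :
    mapp (λ_ M).hom (0 + c) q (boxEl (𝟙_ (CellMod W)) M 0 c 0 q q (zero_add q) (boxUnitEl W) n) =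
      mact M q (cellLeftUnit W c) n := by
  -- The transported unitor ends with the counit, which η cancels, leaving the unitor of complexes.
  refine η_injective M (0 + c) q (val_ext fun v => ?_)
  refine Eq.trans ?_ (val_η_mact q (Fin.cast (Nat.zero_add c).symm) n v).symm
  refine (congrArg (fun z => val z v) (η_ηInv M (0 + c) q _)).trans ?_
  refine (congrArg ((((cellEquiv W).unitIso.inv.app (𝟙_ (ChRep W)) ▷ (cellL W).obj M ≫
      (λ_ ((cellL W).obj M)).hom).f q).hom) (val_boxEl (M := 𝟙_ (CellMod W)) (N := M) 0 c 0 q q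
        (zero_add q) (boxUnitEl W) n v)).trans ?_
  refine (congrArg ((λ_ ((cellL W).obj M)).hom.f q).hom ((whiskerRight_tmul
    ((cellEquiv W).unitIso.inv.app (𝟙_ (ChRep W))) 0 q q (zero_add q) _ _).trans
      (congrArg (fun z => tmul (𝟙_ (ChRep W)) ((cellL W).obj M) 0 q q (zero_add q) z
        (val (η M c q n) (lastPart v))) ((congrArg
          (((cellEquiv W).unitIso.inv.app (𝟙_ (ChRep W))).f 0).hom
            (val_η_boxUnitEl (firstPart v))).trans (unit_inv_hom _ 0 _))))).trans ?_
  refine (leftUnitor_tmul q _).trans ?_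
  exact congrArg (val (η M c q n)) (funext fun i => congrArg v (Fin.ext (by simp)))

lemma boxMul_rightUnitor (b : ℕ) (p : ℤ) (m : (M.obj b).X p) :
    mapp (ρ_ M).hom (b + 0) p (boxEl M (𝟙_ (CellMod W)) b 0 p 0 p (add_zero p) m (boxUnitEl W)) =
      mact M p (cellRightUnit W b) m := by
  refine η_injective M (b + 0) p (val_ext fun v => ?_)
  refine Eq.trans ?_ (val_η_mact p (Fin.cast (Nat.add_zero b).symm) m v).symm
  refine (congrArg (fun z => val z v) (η_ηInv M (b + 0) p _)).trans ?_
  refine (congrArg ((((cellL W).obj M ◁ (cellEquiv W).unitIso.inv.app (𝟙_ (ChRep W)) ≫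
      (ρ_ ((cellL W).obj M)).hom).f p).hom) (val_boxEl (M := M) (N := 𝟙_ (CellMod W)) b 0 p 0 p
        (add_zero p) m (boxUnitEl W) v)).trans ?_
  refine (congrArg ((ρ_ ((cellL W).obj M)).hom.f p).hom ((whiskerLeft_tmul
    ((cellEquiv W).unitIso.inv.app (𝟙_ (ChRep W))) p 0 p (add_zero p) _ _).trans
      (congrArg (tmul ((cellL W).obj M) (𝟙_ (ChRep W)) p 0 p (add_zero p)
        (val (η M b p m) (firstPart v))) ((congrArg
          (((cellEquiv W).unitIso.inv.app (𝟙_ (ChRep W))).f 0).hom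
            (val_η_boxUnitEl (lastPart v))).trans (unit_inv_hom _ 0 _))))).trans ?_
  refine (rightUnitor_tmul p _).trans ?_
  exact congrArg (val (η M b p m)) (funext fun i => congrArg v (Fin.ext rfl))

end BoxUnit

end RatG
end


noncomputable section

namespace RatG

/-! ### Reduction of the box product to b = c = 1. -/

section Orbit

variable {W : Type} [Group W]

lemma map_smul_sum {V V' ι : Type*} [AddCommGroup V] [Module ℚ V] [AddCommGroup V'] [Module ℚ V']
    (f : V →ₗ[ℚ] V') (c : ℚ) (s : Finset ι) (g : ι → V) :
    f (c • ∑ i ∈ s, g i) = c • ∑ i ∈ s, f (g i) := by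
  rw [map_smul, map_sum]

lemma compFixed_assoc {X Y : ChRep W} {a b : ℕ} {n : ℤ} (z : fixedHom Y X n)
    (f : fixedHom (cell W b) Y 0) (g : fixedHom (cell W a) (cell W b) 0) :
    compFixed n 0 n (add_zero n) (compFixed n 0 n (add_zero n) z f) g =
      compFixed n 0 n (add_zero n) z (compFixed 0 0 0 (add_zero 0) f g) := by
  refine val_ext fun w => ?_
  rw [val_comp, val_comp, val_comp]
  exact ev_compFixed n 0 n (add_zero n) z f 0 0 n (zero_add n) (add_zero 0) (val g w)

/-- Every r_y with y in W^(b+c) is the diagonal ℚW → ℚ(W × W) followed by r_{y'} ⊗ r_{y''}, with y'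
and y'' the two parts of y. By dinaturality a cowedge is then determined by its component at b = c =
1. -/
lemma rMap_append (b c : ℕ) (y : Fin (b + c) → W) :
    compFixed 0 0 0 (add_zero 0) (cellTensor 0 (rMap (firstPart y)) (rMap (lastPart y)))
      (rMap (fun _ : Fin (1 + 1) => (1 : W))) = rMap y := by
  refine val_ext fun u => ?_
  rw [val_comp, val_rMap, val_rMap]
  refine (val_cellTensor (rMap (firstPart y)) (rMap (lastPart y)) _).trans ?_
  rw [val_rMap, val_rMap, join_δ]
  refine congrArg δ (Eq.trans ?_ (append_parts (u 0 • y)))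
  refine congrArg₂ Fin.append (funext fun i => ?_) (funext fun i => ?_)
  · exact congrArg (· * y (Fin.castAdd c i)) (mul_one (u 0))
  · exact congrArg (· * y (Fin.natAdd b i)) (mul_one (u 0))

lemma point_δ_eq {a : ℕ} (y : Fin a → W) : point (δ y) = rMap y := by
  refine val_one_ext ?_
  rw [val_point_one, val_rMap, one_smul]

variable [Finite W]

/-- The map `ℚ(W^a) ⟶ ℚW ⟶ X` given by `eMap w` and an element of `X`. -/
def orbitMap (X : ChRep W) (n : ℤ) {a : ℕ} (w : Fin a → W) :
    (X.X n).V →ₗ[ℚ] fixedHom (cell W a) X n :=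
  (compFixed n 0 n (add_zero n)).flip (eMap w) ∘ₗ (pointEquiv X n).toLinearMap

lemma orbitMap_apply (X : ChRep W) (n : ℤ) {a : ℕ} (w : Fin a → W) (x : (X.X n).V) :
    orbitMap X n w x = compFixed n 0 n (add_zero n) (point x) (eMap w) := rfl

lemma eq_sum_orbitMap [Fintype W] (X : ChRep W) (n : ℤ) {a : ℕ} (z : fixedHom (cell W a) X n) :
    z = (Fintype.card W : ℚ)⁻¹ • ∑ w : Fin a → W, orbitMap X n w (val z w) := by
  refine (eq_sum_mact ((cellF W).obj X) n z).trans ?_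
  refine congrArg ((Fintype.card W : ℚ)⁻¹ • ·) (Finset.sum_congr rfl fun w _ => ?_)
  exact congrArg (mact ((cellF W).obj X) n (eMap w)) (val_one_rMap w z)

/-- The identification of `L M` with `M(ℚW)`. -/
def θ (M : CellMod W) (p : ℤ) : (((cellL W).obj M).X p).V →ₗ[ℚ] (M.obj (1 : ℕ)).X p :=
  ηInv M 1 p ∘ₗ (pointEquiv ((cellL W).obj M) p).toLinearMap

variable {M : CellMod W}

lemma η_θ (p : ℤ) (x : (((cellL W).obj M).X p).V) : η M 1 p (θ M p x) = point x :=
  η_ηInv M 1 p (point x)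

/-- Under L M ≅ M(ℚW), the value of m at β is the restriction m · r_β. -/
lemma θ_val {b : ℕ} (p : ℤ) (m : (M.obj b).X p) (β : Fin b → W) :
    θ M p (val (η M b p m) β) = mact M p (rMap β) m := by
  refine η_injective M 1 p ?_
  rw [η_θ, η_mact]
  exact (val_one_rMap β (η M b p m)).symm

lemma θ_dV (p q : ℤ) (x : (((cellL W).obj M).X p).V) :
    θ M q (dV ((cellL W).obj M) p q x) = ((M.obj (1 : ℕ)).d p q).hom (θ M p x) := by
  refine η_injective M 1 q ?_
  rw [η_θ, η_d, η_θ]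
  refine val_one_ext ?_
  rw [val_point_one, val_homD, val_point_one]

end Orbit

/-! ### The universal property of the box product. -/

section BoxUniversal

variable {W : Type} [Group W] [Finite W] {M N : CellMod W} {a : ℕ} {T : ChQ}
  (φ : BoxCowedge W M N a T)

/-- The element of `E(a, 1 ⊗ 1)` given by `eMap w` and the diagonal. -/
def diagEl (w : Fin a → W) : fixedHom (cell W a) (cell W (1 + 1)) 0 :=
  compFixed 0 0 0 (add_zero 0) (rMap (fun _ : Fin (1 + 1) => (1 : W))) (eMap w)

/-- The components of a cowedge. -/
def BoxCowedge.mapₗ (b c : ℕ) (p q s r : ℤ) (h : p + q + s = r) : (M.obj b).X p →ₗ[ℚ]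
    (N.obj c).X q →ₗ[ℚ] fixedHom (cell W a) (cell W (b + c)) s →ₗ[ℚ] T.X r :=
  (φ.map b c).app p q s r h

lemma BoxCowedge.d_mapₗ (b c : ℕ) (p q r : ℤ) (h : p + q + 0 = r) (m : (M.obj b).X p)
    (n : (N.obj c).X q) (e : fixedHom (cell W a) (cell W (b + c)) 0) :
    (T.d r (r - 1)).hom (φ.mapₗ b c p q 0 r h m n e) =
      φ.mapₗ b c (p - 1) q 0 (r - 1) (by lia) (((M.obj b).d p (p - 1)).hom m) n e +
      p.negOnePow • φ.mapₗ b c p (q - 1) 0 (r - 1) (by lia) m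
        (((N.obj c).d q (q - 1)).hom n) e := by
  refine ((φ.map b c).d_app p q 0 r h m n e).trans ?_
  have h₁ : ((homComplex (cell W a) (cell W (b + c))).d 0 (0 - 1)).hom e = 0 := homD_cell e _
  rw [h₁, map_zero, smul_zero, add_zero]
  rfl

lemma BoxCowedge.mapₗ_mact (b c b' c' : ℕ) (p q r : ℤ) (h : p + q + 0 = r) (m : (M.obj b').X p)
    (n : (N.obj c').X q) (f : fixedHom (cell W b) (cell W b') 0)
    (g : fixedHom (cell W c) (cell W c') 0) (e : fixedHom (cell W a) (cell W (b + c)) 0) :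
    φ.mapₗ b c p q 0 r h (mact M p f m) (mact N q g n) e =
      φ.mapₗ b' c' p q 0 r h m n (compFixed 0 0 0 (add_zero 0) (cellTensor 0 f g) e) := by
  refine Eq.trans ?_ (φ.dinatural b c b' c' p q 0 0 0 p q 0 0 (add_zero p) (add_zero q)
    (add_zero 0) (add_zero 0) r h m n f g e)
  rw [mul_zero, Int.negOnePow_zero, one_smul]
  rfl

/-- The linear map on `(L M ⊗ L N) r` induced by a cowedge. -/
def BoxCowedge.onTensor (w : Fin a → W) (r : ℤ) :
    ((((cellL W).obj M ⊗ (cellL W).obj N).X r).V) →ₗ[ℚ] T.X r :=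
  tLift fun i j h => ((φ.mapₗ 1 1 i j 0 r (by lia)).compr₂
    (LinearMap.applyₗ (diagEl w))).compl₁₂ (θ M i) (θ N j)

lemma BoxCowedge.onTensor_tmul (w : Fin a → W) (i j r : ℤ) (h : i + j = r)
    (x : (((cellL W).obj M).X i).V) (y : (((cellL W).obj N).X j).V) :
    φ.onTensor w r (tmul _ _ i j r h x y) =
      φ.mapₗ 1 1 i j 0 r (by lia) (θ M i x) (θ N j y) (diagEl w) :=
  tLift_tmul _ i j h x y

lemma BoxCowedge.d_onTensor (w : Fin a → W) (r : ℤ)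
    (z : (((cellL W).obj M ⊗ (cellL W).obj N).X r).V) :
    (T.d r (r - 1)).hom (φ.onTensor w r z) =
      φ.onTensor w (r - 1) (dV ((cellL W).obj M ⊗ (cellL W).obj N) r (r - 1) z) := by
  have h₁ : (T.d r (r - 1)).hom ∘ₗ φ.onTensor w r =
      φ.onTensor w (r - 1) ∘ₗ dV ((cellL W).obj M ⊗ (cellL W).obj N) r (r - 1) := by
    refine tensor_lhom_ext fun i j h x y => ?_
    refine (congrArg (T.d r (r - 1)).hom (φ.onTensor_tmul w i j r h x y)).trans ?_
    refine (φ.d_mapₗ 1 1 i j r (by lia) (θ M i x) (θ N j y) (diagEl w)).trans ?_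
    refine Eq.trans ?_ (congrArg (φ.onTensor w (r - 1)) (dV_tmul i j r (i - 1) (j - 1) (r - 1) h
      (by lia) (by lia) (by lia) x y)).symm
    refine Eq.trans ?_ (map_add (φ.onTensor w (r - 1)) _ _).symm
    refine congrArg₂ (· + ·) ?_ ?_
    · refine Eq.trans ?_ (φ.onTensor_tmul w (i - 1) j (r - 1) (by lia) _ y).symm
      rw [θ_dV]
    · rw [Units.smul_def, Units.smul_def, map_zsmul]
      refine congrArg (((i.negOnePow : ℤˣ) : ℤ) • ·) ?_
      refine Eq.trans ?_ (φ.onTensor_tmul w i (j - 1) (r - 1) (by lia) x _).symm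
      rw [θ_dV]
  exact LinearMap.congr_fun h₁ z

/-- By linearity x is a basis element y. The left side is then φ at (m · r_{y'}, n · r_{y''}) and
the diagonal, and dinaturality moves r_{y'} ⊗ r_{y''} to the third argument, where it reassembles
r_y. -/
lemma BoxCowedge.onTensor_ev (w : Fin a → W) (b c : ℕ) (p q r : ℤ) (h : p + q = r)
    (m : (M.obj b).X p) (n : (N.obj c).X q) (x : ((cell W (b + c)).X 0).V) :
    φ.onTensor w r (ev (boxEl M N b c p q r h m n) 0 r (zero_add r) x) =
      φ.mapₗ b c p q 0 r (by lia) m n (orbitMap (cell W (b + c)) 0 w x) := by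
  have h₁ : φ.onTensor w r ∘ₗ ev (boxEl M N b c p q r h m n) 0 r (zero_add r) =
      φ.mapₗ b c p q 0 r (by lia) m n ∘ₗ orbitMap (cell W (b + c)) 0 w := by
    refine cell_lhom_ext fun y => ?_
    refine (congrArg (φ.onTensor w r) (val_boxEl b c p q r h m n y)).trans ?_
    refine (φ.onTensor_tmul w p q r h _ _).trans ?_
    rw [θ_val, θ_val, φ.mapₗ_mact]
    refine congrArg (φ.mapₗ b c p q 0 r (by lia) m n) ?_
    refine Eq.symm ((orbitMap_apply (cell W (b + c)) 0 w (δ y)).trans ?_)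
    rw [point_δ_eq, ← rMap_append]
    exact compFixed_assoc _ _ _
  exact LinearMap.congr_fun h₁ x

/-- The linear maps on `(M ⊗ N)(a)` induced by a cowedge. -/
def BoxCowedge.descₗ (r : ℤ) :
    fixedHom (cell W a) ((cellL W).obj M ⊗ (cellL W).obj N) r →ₗ[ℚ] T.X r :=
  letI := Fintype.ofFinite W
  (Fintype.card W : ℚ)⁻¹ • ∑ w : Fin a → W, φ.onTensor w r ∘ₗ valₗ _ r w

lemma BoxCowedge.descₗ_apply [Fintype W] (r : ℤ)
    (z : fixedHom (cell W a) ((cellL W).obj M ⊗ (cellL W).obj N) r) :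
    φ.descₗ r z = (Fintype.card W : ℚ)⁻¹ • ∑ w : Fin a → W, φ.onTensor w r (val z w) := by
  rw [BoxCowedge.descₗ, LinearMap.smul_apply, LinearMap.sum_apply]
  congr!

/-- The map out of `(M ⊗ N)(a)` induced by a cowedge. -/
def BoxCowedge.desc : (M ⊗ N).obj a ⟶ T where
  f r := ModuleCat.ofHom (φ.descₗ r)
  comm' i j hij := by
    replace hij : j + 1 = i := hij
    obtain rfl : j = i - 1 := by lia
    have := Fintype.ofFinite W
    refine ModuleCat.hom_ext (LinearMap.ext fun
      (z : fixedHom (cell W a) ((cellL W).obj M ⊗ (cellL W).obj N) i) => ?_)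
    refine (congrArg (T.d i (i - 1)).hom (φ.descₗ_apply i z)).trans ?_
    refine Eq.trans ?_ (φ.descₗ_apply (i - 1) (homD (cell W a) _ i (i - 1) z)).symm
    rw [map_smul, map_sum]
    refine congrArg ((Fintype.card W : ℚ)⁻¹ • ·) (Finset.sum_congr rfl fun w _ => ?_)
    refine (φ.d_onTensor w i (val z w)).trans ?_
    exact congrArg (φ.onTensor w (i - 1)) (val_homD i (i - 1) z w).symm

/-- The averaging in the definition of `descₗ` matches e = |W|⁻¹ ∑ e(w) e_w, with each e(w) read as
a map ℚW → ℚ(W^(b+c)). -/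
lemma BoxCowedge.descₗ_mul (b c : ℕ) (p q r : ℤ) (h : p + q = r) (m : (M.obj b).X p)
    (n : (N.obj c).X q) (e : fixedHom (cell W a) (cell W (b + c)) 0) :
    φ.descₗ r (compFixed r 0 r (add_zero r) (boxEl M N b c p q r h m n) e) =
      φ.mapₗ b c p q 0 r (by lia) m n e := by
  have := Fintype.ofFinite W
  refine (φ.descₗ_apply r _).trans ?_
  refine Eq.trans ?_ (congrArg (φ.mapₗ b c p q 0 r (by lia) m n)
    (eq_sum_orbitMap (cell W (b + c)) 0 e)).symm
  refine Eq.trans ?_ (map_smul_sum (φ.mapₗ b c p q 0 r (by lia) m n) _ _ _).symm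
  refine congrArg ((Fintype.card W : ℚ)⁻¹ • ·) (Finset.sum_congr rfl fun w _ => ?_)
  refine (congrArg (φ.onTensor w r) (val_comp (boxEl M N b c p q r h m n) e w)).trans ?_
  exact φ.onTensor_ev w b c p q r h m n (val e w)

lemma point_tmul (p q r : ℤ) (h : p + q = r) (x : (((cellL W).obj M).X p).V)
    (y : (((cellL W).obj N).X q).V) :
    point (tmul ((cellL W).obj M) ((cellL W).obj N) p q r h x y) =
      compFixed r 0 r (add_zero r) (boxEl M N 1 1 p q r h (θ M p x) (θ N q y))
        (rMap (fun _ : Fin (1 + 1) => (1 : W))) := by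
  refine val_one_ext ?_
  refine (val_point_one _).trans (Eq.symm ?_)
  refine (val_comp (boxEl M N 1 1 p q r h (θ M p x) (θ N q y)) (rMap _) _).trans ?_
  refine (congrArg (ev (boxEl M N 1 1 p q r h (θ M p x) (θ N q y)) 0 r (zero_add r))
    (val_rMap _ _)).trans ?_
  refine (val_boxEl 1 1 p q r h (θ M p x) (θ N q y) _).trans ?_
  rw [η_θ, η_θ]
  refine congrArg₂ (fun x y => tmul ((cellL W).obj M) ((cellL W).obj N) p q r h x y)
    (Eq.trans ?_ (val_point_one x)) (Eq.trans ?_ (val_point_one y))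
  · exact congrArg (val (point x)) (funext fun i => mul_one (1 : W))
  · exact congrArg (val (point y)) (funext fun i => mul_one (1 : W))

/-- Every element of (M ⊗ N)(a) is an average of maps that factor through ℚW via some e_w. On pure
tensors such a map is a product with b = c = 1, acted on by the diagonal and e_w (`point_tmul`),
where u is prescribed. -/
lemma BoxCowedge.desc_unique (r : ℤ)
    (u : fixedHom (cell W a) ((cellL W).obj M ⊗ (cellL W).obj N) r →ₗ[ℚ] T.X r)
    (hu : ∀ (p q : ℤ) (h : p + q = r) (m : (M.obj (1 : ℕ)).X p) (n : (N.obj (1 : ℕ)).X q)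
      (e : fixedHom (cell W a) (cell W (1 + 1)) 0),
        u (compFixed r 0 r (add_zero r) (boxEl M N 1 1 p q r h m n) e) =
          φ.mapₗ 1 1 p q 0 r (by lia) m n e) : u = φ.descₗ r := by
  have := Fintype.ofFinite W
  have h₁ (w : Fin a → W) : u ∘ₗ orbitMap ((cellL W).obj M ⊗ (cellL W).obj N) r w =
      φ.onTensor w r := by
    refine tensor_lhom_ext fun i j h x y => ?_
    refine Eq.trans ?_ (φ.onTensor_tmul w i j r h x y).symm
    refine Eq.trans ?_ (hu i j h (θ M i x) (θ N j y) (diagEl w))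
    refine congrArg u ((orbitMap_apply _ r w _).trans ?_)
    refine (congrArg (fun z => compFixed r 0 r (add_zero r) z (eMap w))
      (point_tmul i j r h x y)).trans ?_
    exact compFixed_assoc (boxEl M N 1 1 i j r h (θ M i x) (θ N j y)) _ (eMap w)
  refine LinearMap.ext fun z => ?_
  refine (congrArg u (eq_sum_orbitMap _ r z)).trans ?_
  refine Eq.trans ?_ (φ.descₗ_apply r z).symm
  refine (map_smul_sum u _ _ _).trans ?_
  refine congrArg ((Fintype.card W : ℚ)⁻¹ • ·) (Finset.sum_congr rfl fun w _ => ?_)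
  exact LinearMap.congr_fun (h₁ w) (val z w)

lemma boxMul_universal :
    ∃! u : (M ⊗ N).obj a ⟶ T, ∀ (b c : ℕ) (p q s pq r : ℤ) (hpq : p + q = pq) (h : pq + s = r)
      (m : (M.obj b).X p) (n : (N.obj c).X q) (e : fixedHom (cell W a) (cell W (b + c)) s),
      (u.f r).hom (cellAct (M ⊗ N) a (b + c) pq s r h ((boxMul M N b c).app p q pq hpq m n) e) =
        (φ.map b c).app p q s r (by lia) m n e := by
  refine ⟨φ.desc, fun b c p q s pq r hpq h m n e => ?_, fun u hu => ?_⟩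
  · by_cases hs : s = 0
    · subst hs
      obtain rfl : pq = r := by lia
      exact φ.descₗ_mul b c p q pq hpq m n e
    · obtain rfl := cell_hom_eq_zero hs e
      rw [cellAct_zero_right, map_zero]
      exact (map_zero _).symm
  · ext1 r
    refine ModuleCat.hom_ext (φ.desc_unique r (u.f r).hom fun p q h m n e => ?_)
    exact hu 1 1 p q 0 r r h (add_zero r) m n e

end BoxUniversal

section BoxProduct

variable {W : Type} [Group W] [Finite W]

/-- The monoidal structure on right modules is the box product. -/
def boxProduct : BoxProduct W where
  mul M N b c := boxMul M N b c
  mul_act _ _ b c b' c' p q s t pq ps qt st v hpq hps hqt hst hv m n f g :=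
    boxMul_act b c b' c' p q s t pq ps qt st v hpq hps hqt hst hv m n f g
  mul_natural _ _ _ _ f g b c p q r h m n := boxMul_natural f g b c p q r h m n
  universal _ _ _ _ φ := boxMul_universal φ
  unitIso := boxUnitIso W
  leftUnitor _ c q n := boxMul_leftUnitor c q n
  rightUnitor _ b p m := boxMul_rightUnitor b p m
  associator _ _ _ b c d p q r pq qr s hpq hqr h m n k :=
    boxMul_associator b c d p q r pq qr s hpq hqr h m n k
  braiding _ _ b c p q r h m n := boxMul_braiding b c p q r h m n

end BoxProduct

end RatG
end

theorem mainTheorem8 (G : Type) [Group G] [Finite G] (H : Subgroup G) :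
    ∃ (_ : ModelCategory (ChRep (WeylGroup H)))
      (_ : ModelCategory (CellMod (WeylGroup H)))
      (_ : MonoidalCategory (CellMod (WeylGroup H)))
      (_ : SymmetricCategory (CellMod (WeylGroup H)))
      (L : CellMod (WeylGroup H) ⥤ ChRep (WeylGroup H))
      (adj : L ⊣ homFunctor (cell (WeylGroup H))),
      IsProjectiveModel (WeylGroup H) ∧
      IsObjectwiseModel (cellCat (WeylGroup H)) ∧
      Nonempty (BoxProduct (WeylGroup H)) ∧
      Nonempty (IsTensorCoend (cell (WeylGroup H)) adj) ∧
      IsSymmetricMonoidalModel (ChRep (WeylGroup H)) ∧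
      MonoidAxiom (ChRep (WeylGroup H)) ∧
      IsSymmetricMonoidalModel (CellMod (WeylGroup H)) ∧
      MonoidAxiom (CellMod (WeylGroup H)) ∧
      IsQuillenEquivalence adj ∧
      IsStrongSymmetricMonoidal L := by
  exact ⟨repModel _, cellModel _, cellMonoidal, cellSymmetric, cellL _, cellAdj _,
    repModel_isProjectiveModel _, cellModel_isObjectwiseModel _, ⟨boxProduct⟩,
    ⟨isTensorCoend (cellAdj _)⟩, repModel_isSymmetricMonoidalModel _, repModel_monoidAxiom _,
    cellModel_isSymmetricMonoidalModel _, cellModel_monoidAxiom _,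
    cellAdj_isQuillenEquivalence _, cellL_isStrongSymmetricMonoidal _⟩
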